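/- **Setting.** Let $G=(V,E,s,t,\delta)$ be a finite connected graph with at least one edge, simple (no loops, at most one edge between two vertices), oriented, with source and target maps $s,t:E\to V$ and weights $\delta_e>0$; write $e^-=s(e)$, $e^+=t(e)$. Let $n\ge 2$ be even. For each $v\in V$ let: - $X_v$ be an $n$-dimensional real vector space with a symmetric bilinear form $g_v$ of signature $(1,n-1)$ (one plus sign), $\mathbb{C}l(X_v)$ its complexified Clifford algebra with $x^2=g_v(x,x)$, $\mathbb{C}l(X_v)^0$ its even part, and $c_v$ its canonical real structure; - $S_v$ be an irreducible complex representation space of $\mathbb{C}l(X_v)$ with a Krein product $(\cdot,\cdot)_v$ (a nondegenerate hermitian form) for which all $x\in X_v$ are self-adjoint; - $\chi_v=i^{n/2+1}e_1\cdots e_n$ be the chirality operator, where $(e_i)$ is a pseudo-orthonormal basis of $X_v$ (so $\chi_v$ is fixed by an orientation of $X_v$); - $J_v$ be an antilinear operator on $S_v$ with $J_v^2=\epsilon$ ($\epsilon=\pm1$ independent of $v$), $J_vJ_v^\times=-1$, and $J_vaJ_v^{-1}=-c_v(a)$ for all odd $a\in\mathbb{C}l(X_v)$. Here $\times$ denotes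 the adjoint for the Krein product, which for an antilinear $J$ means $(J\psi,\varphi)=\overline{(\psi,J^\times\varphi)}$. For each edge $e$ let $h_e^+:S_{e^-}\to S_{e^+}$ be a linear isomorphism (the discrete connection), $h_e^-=(h_e^+)^{-1}$, and $\gamma_e^\pm\in\mathrm{End}(S_{e^\pm})$. The *split Dirac structure* over $G$ is $(\mathcal A^0,K,(\cdot,\cdot),\pi,D,J,\chi)$, where $\mathcal A^0=\prod_v\mathbb{C}l(X_v)^0$, $K$ is the space of maps $(e,\pm)\mapsto F(e,\pm)\in S_{e^\pm}$ on $E\times\{-,+\}$, and $$(F,F')=\sum_{e}\big((F(e,+),h_e^+F'(e,-))+(F(e,-),h_e^-F'(e,+))\big),\qquad (\pi(a)F)(e,\pm)=a(e^\pm)F(e,\pm),$$ $$(DF)(e,\pm)=\mp\tfrac1{\delta_e}\gamma_e^\pm h_e^\pm F(e,\mp),\qquad (\chi F)(e,\pm)=\chi_{e^\pm}F(e,\pm),\qquad (JF)(e,\pm)=h_e^\pm J_{e^\mp}F(e,\mp).$$ **Definitions.** A *positive time-orientation form* of such a multiplet is an invertible operator $\beta$ of the form $\sum_i\pi(a_i)[D,\pi(b_i)]$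 with $\beta^\times=\beta$, $J\beta J^{-1}=-\beta$, and $\langle\cdot,\cdot\rangle_\beta:=(\cdot,\beta^{-1}\cdot)$ positive definite. The multiplet is an *antilorentzian spectral spacetime* if $(\cdot,\cdot)$ is a Krein product, $D^\times=D$, $\chi^2=1$, $\chi$ commutes with $\pi(\mathcal A^0)$, $\chi D=-D\chi$, $\chi^\times=-\chi$, $J^2=\tilde\epsilon$, $JD=DJ$, $J\chi=\tilde\epsilon''\chi J$, $J^\times J=-1$ for some signs $\tilde\epsilon,\tilde\epsilon''\in\{\pm1\}$ (the pairs $(\tilde\epsilon,\tilde\epsilon'')=(1,1),(-1,-1),(-1,1),(1,-1)$ being those of KO dimension $0,2,4,6$ mod $8$), and a positive time-orientation form exists. It is *reconstructible* if moreover $\pi$ is faithful and $\pi(\mathcal A^0)^{*_\beta}=\pi(\mathcal A^0)$ for some positive time-orientation form $\beta$, where $*_\beta$ is the adjunction of $\langle\cdot,\cdot\rangle_\beta$. The connection is *Clifford* if for each edge $e$ there is a linear $\Lambda:X_{e^-}\to X_{e^+}$ with $h_e^+x=\Lambda(x)h_e^+$ for all $x\in X_{e^-}$. A vector $x\in X_v$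 is *timelike* if $g_v(x,x)>0$, and *future-directed* timelike if moreover $(\cdot,x\,\cdot)_v$ is positive definite. For a path $P$ in $G$ from $v$ to $w$ (edges may be traversed in both directions) let $h_P:S_v\to S_w$ be the composite of the corresponding $h_e^\pm$, and $H_P(a)=h_Pah_P^{-1}$. The *holonomy group* at $v$ is the group of all $H_P$ for closed paths $P$ at $v$. A vector field $v\mapsto u_v\in X_v$ is *parallel* if $u_w=H_P(u_v)$ for all $v,w$ and all paths $P$ from $v$ to $w$. **Theorem.** Assume that: 1. the $\gamma_e^\pm$ are Krein self-adjoint and odd ($\chi_{e^\pm}\gamma_e^\pm=-\gamma_e^\pm\chi_{e^\pm}$), satisfy $J_{e^+}\gamma_e^+J_{e^+}^{-1}=-h_e^+\gamma_e^-h_e^-$, and do not vanish identically on either of the two eigenspaces of $\chi_{e^\pm}$; 2. the connection is metric ($h_e^+$ is Krein-unitary), spin preserving ($h_e^+J_{e^-}=J_{e^+}h_e^+$) and orientation preserving ($\chi_{e^+}h_e^+=h_e^+\chi_{e^-}$). If $n=2$, the split Dirac structure over $G$ is reconstructible. If $n>2$ and the connection is Clifford, the split Dirac structure is reconstructible if and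 only if there is a parallel vector field on $G$ that is future-directed timelike at every vertex; equivalently, for any vertex $v$, if and only if the holonomy group at $v$ fixes a timelike vector of $X_v$. -/

import Mathlib

open scoped TensorProduct ComplexConjugate

noncomputable section

/-! ## Spectral data and antilorentzian spectral spacetimes (finite-dimensional) -/

/-- A multiplet `(A, K, (.,.), π, D, J, χ)`. The product `(.,.)` is antilinear in its
first and linear in its second argument. -/
structure SpectralData (A K : Type*) [Ring A] [Algebra ℂ A] [AddCommGroup K] [Module ℂ K]
    [FiniteDimensional ℂ K] where
  krein : K →ₗ⋆[ℂ] K →ₗ[ℂ] ℂ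
  π : A →ₐ[ℂ] Module.End ℂ K
  D : Module.End ℂ K
  J : K →ₗ⋆[ℂ] K
  χ : Module.End ℂ K

/-- In finite dimension, a Krein product is a nondegenerate hermitian form. -/
structure IsKreinProduct {K : Type*} [AddCommGroup K] [Module ℂ K]
    (B : K →ₗ⋆[ℂ] K →ₗ[ℂ] ℂ) : Prop where
  hermitian : ∀ ψ φ, B φ ψ = conj (B ψ φ)
  nondegenerate : ∀ φ, (∀ ψ, B ψ φ = 0) → φ = 0

/-- `T'` is the adjoint of the linear operator `T` for the form `B`. -/
def IsAdjointFor {K : Type*} [AddCommGroup K] [Module ℂ K]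
    (B : K → K → ℂ) (T T' : Module.End ℂ K) : Prop :=
  ∀ ψ φ, B (T ψ) φ = B ψ (T' φ)

/-- The form `(., T .)` is positive definite. -/
def IsPosDefWith {K : Type*} [AddCommGroup K] [Module ℂ K]
    (B : K →ₗ⋆[ℂ] K →ₗ[ℂ] ℂ) (T : Module.End ℂ K) : Prop :=
  ∀ ψ, ψ ≠ 0 → 0 < (B ψ (T ψ)).re ∧ (B ψ (T ψ)).im = 0

/-- The antilorentzian table of KO signs `(ε, ε'', κ)`. -/
def IsAntilorentzianKOSigns (k : ZMod 8) (ε ε'' κ : ℂ) : Prop :=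
  (k = 2 ∧ ε = -1 ∧ ε'' = -1 ∧ κ = -1) ∨
  (k = 0 ∧ ε = 1 ∧ ε'' = 1 ∧ κ = -1) ∨
  (k = 6 ∧ ε = 1 ∧ ε'' = -1 ∧ κ = -1) ∨
  (k = 4 ∧ ε = -1 ∧ ε'' = 1 ∧ κ = -1)

namespace SpectralData

variable {A K : Type*} [Ring A] [Algebra ℂ A] [AddCommGroup K] [Module ℂ K]
  [FiniteDimensional ℂ K]

/-- The noncommutative 1-forms: finite sums of the operators `π(a) [D, π(b)]`. -/
def oneForms (M : SpectralData A K) : Submodule ℂ (Module.End ℂ K) :=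
  Submodule.span ℂ {T | ∃ a b : A, T = M.π a * (M.D * M.π b - M.π b * M.D)}

/-- The form `⟨F, G⟩_β = (F, β⁻¹ G)`. -/
def innerWith (M : SpectralData A K) (β : (Module.End ℂ K)ˣ) (F G : K) : ℂ :=
  M.krein F ((↑β⁻¹ : Module.End ℂ K) G)

/-- Positive time-orientation 1-forms. -/
structure IsPositiveTimeOrientation (M : SpectralData A K) (β : (Module.End ℂ K)ˣ) : Prop where
  oneForm : (β : Module.End ℂ K) ∈ M.oneForms
  selfAdjoint : IsAdjointFor (fun F G => M.krein F G) (β : Module.End ℂ K) β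
  imaginary : ∀ F, M.J ((β : Module.End ℂ K) F) = -((β : Module.End ℂ K) (M.J F))
  posDef : IsPosDefWith M.krein (↑β⁻¹ : Module.End ℂ K)

/-- Even antilorentzian spectral spacetimes of KO dimension `k`. The adjoint `J^×` of the
antilinear operator `J` is given by `(Jψ, φ) = conj (ψ, J^× φ)`. -/
structure IsAntilorentzianSpacetime (M : SpectralData A K) (k : ZMod 8) : Prop where
  krein : IsKreinProduct M.krein
  D_selfAdjoint : IsAdjointFor (fun F G => M.krein F G) M.D M.D
  χ_sq : M.χ * M.χ = 1
  χ_comm : ∀ a, M.π a * M.χ = M.χ * M.π a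
  χ_D : M.χ * M.D = -(M.D * M.χ)
  χ_adjoint : IsAdjointFor (fun F G => M.krein F G) M.χ (-M.χ)
  J_spec : ∃ ε ε'' κ : ℂ, IsAntilorentzianKOSigns k ε ε'' κ ∧
    (∀ F, M.J (M.J F) = ε • F) ∧
    (∀ F, M.J (M.D F) = M.D (M.J F)) ∧
    (∀ F, M.J (M.χ F) = ε'' • M.χ (M.J F)) ∧
    (∃ J' : K →ₗ⋆[ℂ] K, (∀ F G, M.krein (M.J F) G = conj (M.krein F (J' G))) ∧
      ∀ F, J' (M.J F) = κ • F)
  exists_orientation : ∃ β, M.IsPositiveTimeOrientation β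

/-- A spectral spacetime is reconstructible if `π` is faithful and `π(A)^{*_β} = π(A)` for
some positive time-orientation form `β`, with `*_β` the adjunction of `⟨., .⟩_β`. -/
def IsReconstructible (M : SpectralData A K) : Prop :=
  (∃ k, M.IsAntilorentzianSpacetime k) ∧ Function.Injective M.π ∧
  ∃ β, M.IsPositiveTimeOrientation β ∧
    {T : Module.End ℂ K | ∃ a, IsAdjointFor (M.innerWith β) (M.π a) T} = Set.range M.π

end SpectralData

/-! ## Weighted oriented graphs -/

/-- Positively weighted oriented simple graphs. -/
structure WeightedOrientedGraph (V E : Type*) where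
  src : E → V
  tgt : E → V
  weight : E → ℝ
  weight_pos : ∀ e, 0 < weight e
  loopless : ∀ e, src e ≠ tgt e
  simple : Function.Injective fun e => s(src e, tgt e)

namespace WeightedOrientedGraph

variable {V E : Type*}

/-- The extremities of an edge: `e⁺ = t(e)` for `true`, `e⁻ = s(e)` for `false`. -/
def endpt (G : WeightedOrientedGraph V E) (e : E) : Bool → V
  | true => G.tgt e
  | false => G.src e

/-- Paths from `x`, whose steps run along edges or against them. -/
inductive Walk (G : WeightedOrientedGraph V E) (x : V) : V → Type _
  | nil : Walk G x x
  | fwd (e : E) (p : Walk G x (G.src e)) : Walk G x (G.tgt e)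
  | bwd (e : E) (p : Walk G x (G.tgt e)) : Walk G x (G.src e)

def Connected (G : WeightedOrientedGraph V E) : Prop := ∀ x y, Nonempty (G.Walk x y)

namespace Walk

variable {G : WeightedOrientedGraph V E}

def append {x y : V} (p : G.Walk x y) : {z : V} → G.Walk y z → G.Walk x z
  | _, nil => p
  | _, fwd e q => fwd e (p.append q)
  | _, bwd e q => bwd e (p.append q)

def reverse {x : V} : {y : V} → G.Walk x y → G.Walk y x
  | _, nil => nil
  | _, fwd e p => (bwd e nil).append p.reverse
  | _, bwd e p => (fwd e nil).append p.reverse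

end Walk

end WeightedOrientedGraph

/-! ## Complexified Clifford algebras -/

section Clifford

variable {X : Type*} [AddCommGroup X] [Module ℝ X]

/-- `ℂl(X, g)`, for `Q x = g(x, x)`; the Clifford relation is `x² = g(x, x)`. -/
abbrev CCl (Q : QuadraticForm ℝ X) : Type _ := ℂ ⊗[ℝ] CliffordAlgebra Q

/-- The real vector `x` as an element of `ℂl(X, g)`. -/
def CCl.vec (Q : QuadraticForm ℝ X) (x : X) : CCl Q := 1 ⊗ₜ[ℝ] CliffordAlgebra.ι Q x

/-- The canonical real structure `c` of `ℂl(X, g)`. -/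
def CCl.c (Q : QuadraticForm ℝ X) : CCl Q →ₐ[ℝ] CCl Q :=
  Algebra.TensorProduct.map (Complex.conjAe : ℂ →ₐ[ℝ] ℂ) (AlgHom.id ℝ (CliffordAlgebra Q))

/-- The even part of `ℂl(X, g)`. -/
abbrev CCl.even (Q : QuadraticForm ℝ X) : Subalgebra ℂ (CCl Q) :=
  (CliffordAlgebra.even Q).baseChange ℂ

/-- The odd part of `ℂl(X, g)`. -/
def CCl.odd (Q : QuadraticForm ℝ X) : Submodule ℂ (CCl Q) :=
  (CliffordAlgebra.evenOdd Q 1).baseChange ℂ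

/-- Pseudo-orthonormal bases for signature `(+, -, …, -)`. -/
def IsPseudoOrthonormal {n : ℕ} (Q : QuadraticForm ℝ X) (b : Module.Basis (Fin n) ℝ X) : Prop :=
  (∃ i₀, Q (b i₀) = 1 ∧ ∀ i, i ≠ i₀ → Q (b i) = -1) ∧
  ∀ i j, i ≠ j → QuadraticMap.polar Q (b i) (b j) = 0

end Clifford

/-! ## The split Dirac structure -/

/-- The ingredients of the split Dirac structure over `G`: a discrete Clifford bundle with
fibres `ℂl(X v, g v)`, a discrete spinor bundle with fibres `S v`, a discrete connection `h`
and the operators `γ`. -/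
structure DiscreteSpinorBundle {V E : Type*} (G : WeightedOrientedGraph V E) (n : ℕ)
    (X S : V → Type*)
    [∀ v, AddCommGroup (X v)] [∀ v, Module ℝ (X v)]
    [∀ v, AddCommGroup (S v)] [∀ v, Module ℂ (S v)] [∀ v, FiniteDimensional ℂ (S v)] where
  /-- the antilorentzian metric `Q v x = g_v(x, x)` on the `n`-dimensional space `X v` -/
  Q : ∀ v, QuadraticForm ℝ (X v)
  antilorentzian : ∀ v, ∃ b : Module.Basis (Fin n) ℝ (X v), IsPseudoOrthonormal (Q v) b
  /-- the irreducible representation of `ℂl(X v, g v)` on `S v` -/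
  ρ : ∀ v, CCl (Q v) →ₐ[ℂ] Module.End ℂ (S v)
  nontrivial : ∀ v, Nontrivial (S v)
  irreducible : ∀ v (W : Submodule ℂ (S v)), (∀ a, ∀ ψ ∈ W, ρ v a ψ ∈ W) → W = ⊥ ∨ W = ⊤
  /-- the Krein product on `S v`, for which real vectors are self-adjoint -/
  krein : ∀ v, S v →ₗ⋆[ℂ] S v →ₗ[ℂ] ℂ
  isKrein : ∀ v, IsKreinProduct (krein v)
  krein_compatible : ∀ v x,
    IsAdjointFor (fun ψ φ => krein v ψ φ) (ρ v (CCl.vec (Q v) x)) (ρ v (CCl.vec (Q v) x))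
  /-- the chirality operator of `ℂl(X v, g v)`, for one of the two orientations of `X v` -/
  χ : ∀ v, Module.End ℂ (S v)
  χ_eq : ∀ v, ∃ b : Module.Basis (Fin n) ℝ (X v), IsPseudoOrthonormal (Q v) b ∧
    χ v = ρ v (Complex.I ^ (n / 2 + 1) • (List.ofFn fun i => CCl.vec (Q v) (b i)).prod)
  /-- the charge conjugation on `S v`: `J² = ε`, `J J^× = -1`, `c(a) = -J a J⁻¹` for odd `a` -/
  J : ∀ v, S v →ₗ⋆[ℂ] S v
  ε : ℂ
  ε_sign : ε = 1 ∨ ε = -1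
  J_sq : ∀ v ψ, J v (J v ψ) = ε • ψ
  J_adjoint : ∀ v, ∃ J' : S v →ₗ⋆[ℂ] S v,
    (∀ ψ φ, krein v (J v ψ) φ = conj (krein v ψ (J' φ))) ∧ ∀ ψ, J v (J' ψ) = -ψ
  J_real : ∀ v, ∀ a ∈ CCl.odd (Q v), ∀ ψ, ρ v (CCl.c (Q v) a) (J v ψ) = -J v (ρ v a ψ)
  /-- the parallel transport `h_e⁺ : S_{e⁻} → S_{e⁺}` -/
  h : ∀ e, S (G.src e) ≃ₗ[ℂ] S (G.tgt e)
  /-- the operators `γ_e^±` -/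
  γ : ∀ e (b : Bool), Module.End ℂ (S (G.endpt e b))

namespace DiscreteSpinorBundle

variable {V E : Type*} {G : WeightedOrientedGraph V E} {n : ℕ} {X S : V → Type*}
  [∀ v, AddCommGroup (X v)] [∀ v, Module ℝ (X v)]
  [∀ v, AddCommGroup (S v)] [∀ v, Module ℂ (S v)] [∀ v, FiniteDimensional ℂ (S v)]

/-- Clifford multiplication by a real vector. -/
def cliff (B : DiscreteSpinorBundle G n X S) (v : V) (x : X v) : Module.End ℂ (S v) :=
  B.ρ v (CCl.vec (B.Q v) x)

/-- `h_e^± : S_{e^∓} → S_{e^±}`, with `h_e⁻` the inverse of `h_e⁺`. -/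
def hpm (B : DiscreteSpinorBundle G n X S) (e : E) :
    (b : Bool) → S (G.endpt e (!b)) ≃ₗ[ℂ] S (G.endpt e b)
  | true => B.h e
  | false => (B.h e).symm

/-- The algebra `A⁰` of even sections of the discrete Clifford bundle. -/
abbrev EvenSections (B : DiscreteSpinorBundle G n X S) : Type _ := ∀ v, CCl.even (B.Q v)

/-- The sections of the discrete spinor bundle over the split graph `E × {-, +}`. -/
abbrev Sections (_B : DiscreteSpinorBundle G n X S) : Type _ :=
  ∀ p : E × Bool, S (G.endpt p.1 p.2)

/-- `(F, F') = ∑_e (F(e,+), h_e⁺ F'(e,-)) + (F(e,-), h_e⁻ F'(e,+))`. -/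
def splitKrein [Fintype E] (B : DiscreteSpinorBundle G n X S) :
    B.Sections →ₗ⋆[ℂ] B.Sections →ₗ[ℂ] ℂ :=
  LinearMap.mk₂'ₛₗ (starRingEnd ℂ) (RingHom.id ℂ)
    (fun F F' => ∑ e : E,
      (B.krein (G.endpt e true) (F (e, true)) (B.hpm e true (F' (e, false))) +
        B.krein (G.endpt e false) (F (e, false)) (B.hpm e false (F' (e, true)))))
    (by
      intro F₁ F₂ F'
      simp only [Pi.add_apply, map_add, LinearMap.add_apply, ← Finset.sum_add_distrib]
      exact Finset.sum_congr rfl fun _ _ => by ring)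
    (by
      intro c F F'
      simp only [Pi.smul_apply, LinearMap.map_smulₛₗ, LinearMap.smul_apply, Finset.smul_sum,
        smul_add])
    (by
      intro F F₁ F₂
      rw [← Finset.sum_add_distrib]
      refine Finset.sum_congr rfl fun e _ => ?_
      have h₁ := (B.hpm e true).map_add (F₁ (e, false)) (F₂ (e, false))
      have h₂ := (B.hpm e false).map_add (F₁ (e, true)) (F₂ (e, true))
      simp only [Pi.add_apply]
      erw [h₁, h₂, map_add, map_add]
      ring)
    (by
      intro c F F'
      simp only [RingHom.id_apply, Finset.smul_sum]
      refine Finset.sum_congr rfl fun e _ => ?_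
      have h₁ := (B.hpm e true).map_smul c (F' (e, false))
      have h₂ := (B.hpm e false).map_smul c (F' (e, true))
      simp only [Pi.smul_apply]
      erw [h₁, h₂, map_smul, map_smul]
      rw [smul_add])

/-- `(π(a) F)(e,±) = a(e^±) · F(e,±)`. -/
def splitRep (B : DiscreteSpinorBundle G n X S) :
    B.EvenSections →ₐ[ℂ] Module.End ℂ B.Sections :=
  AlgHom.ofLinearMap
    { toFun := fun a =>
        { toFun := fun F p => B.ρ _ (a (G.endpt p.1 p.2) : CCl (B.Q _)) (F p)
          map_add' := fun F F' => by ext p; simp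
          map_smul' := fun c F => by ext p; simp }
      map_add' := fun a a' => by ext F p; simp
      map_smul' := fun c a => by ext F p; simp }
    (by ext F p; simp)
    (fun a a' => by ext F p; simp)

/-- `(D F)(e,±) = ∓ (1/δ_e) γ_e^± h_e^± F(e,∓)`. -/
def splitDirac (B : DiscreteSpinorBundle G n X S) : Module.End ℂ B.Sections where
  toFun F p := ((if p.2 then -1 else 1) / (G.weight p.1 : ℂ)) •
    B.γ p.1 p.2 (B.hpm p.1 p.2 (F (p.1, !p.2)))
  map_add' F F' := by ext p; simp
  map_smul' c F := by ext p; simp [smul_comm c]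

/-- `(χ F)(e,±) = χ_{e^±} F(e,±)`. -/
def splitChirality (B : DiscreteSpinorBundle G n X S) : Module.End ℂ B.Sections where
  toFun F p := B.χ (G.endpt p.1 p.2) (F p)
  map_add' F F' := by ext p; simp
  map_smul' c F := by ext p; simp

/-- `(J F)(e,±) = h_e^± J_{e^∓} F(e,∓)`. -/
def splitJ (B : DiscreteSpinorBundle G n X S) : B.Sections →ₗ⋆[ℂ] B.Sections where
  toFun F p := B.hpm p.1 p.2 (B.J (G.endpt p.1 (!p.2)) (F (p.1, !p.2)))
  map_add' F F' := by ext p; simp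
  map_smul' c F := by ext p; simp

/-- The split Dirac structure over `G`. -/
def splitDiracStructure [Fintype E] (B : DiscreteSpinorBundle G n X S) :
    SpectralData B.EvenSections B.Sections where
  krein := B.splitKrein
  π := B.splitRep
  D := B.splitDirac
  J := B.splitJ
  χ := B.splitChirality

/-! ### The discrete connection -/

/-- The connection is metric: parallel transport is Krein-unitary. -/
def IsMetric (B : DiscreteSpinorBundle G n X S) : Prop :=
  ∀ e ψ φ, B.krein (G.tgt e) (B.h e ψ) (B.h e φ) = B.krein (G.src e) ψ φ

def IsSpinPreserving (B : DiscreteSpinorBundle G n X S) : Prop :=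
  ∀ e ψ, B.h e (B.J (G.src e) ψ) = B.J (G.tgt e) (B.h e ψ)

def PreservesOrientation (B : DiscreteSpinorBundle G n X S) : Prop :=
  ∀ e ψ, B.χ (G.tgt e) (B.h e ψ) = B.h e (B.χ (G.src e) ψ)

def IsCliffordConnection (B : DiscreteSpinorBundle G n X S) : Prop :=
  ∀ e, ∃ Λ : X (G.src e) →ₗ[ℝ] X (G.tgt e), ∀ x ψ,
    B.h e (B.cliff (G.src e) x ψ) = B.cliff (G.tgt e) (Λ x) (B.h e ψ)

/-- The necessary and sufficient conditions for the split Dirac structure to be an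
antilorentzian spectral spacetime. -/
structure IsSpectral (B : DiscreteSpinorBundle G n X S) : Prop where
  γ_selfAdjoint : ∀ e b,
    IsAdjointFor (fun ψ φ => B.krein (G.endpt e b) ψ φ) (B.γ e b) (B.γ e b)
  γ_odd : ∀ e b, B.χ (G.endpt e b) * B.γ e b = -(B.γ e b * B.χ (G.endpt e b))
  /-- `J_{e⁺} γ_e⁺ J_{e⁺}⁻¹ = - h_e⁺ γ_e⁻ h_e⁻` -/
  γ_real : ∀ e (ψ : S (G.tgt e)),
    B.J (G.tgt e) (B.γ e true ψ) = -(B.h e (B.γ e false ((B.h e).symm (B.J (G.tgt e) ψ))))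
  γ_left : ∀ e b, ∃ ψ, B.χ (G.endpt e b) ψ = -ψ ∧ B.γ e b ψ ≠ 0
  γ_right : ∀ e b, ∃ ψ, B.χ (G.endpt e b) ψ = ψ ∧ B.γ e b ψ ≠ 0
  metric : B.IsMetric
  spinPreserving : B.IsSpinPreserving
  preservesOrientation : B.PreservesOrientation

/-! ### Holonomy and parallel vector fields -/

/-- Parallel transport `h_P : S_x → S_y` along a path. -/
def transport (B : DiscreteSpinorBundle G n X S) {x : V} : {y : V} → G.Walk x y → S x ≃ₗ[ℂ] S y
  | _, .nil => LinearEquiv.refl ℂ _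
  | _, .fwd e p => (B.transport p).trans (B.h e)
  | _, .bwd e p => (B.transport p).trans (B.h e).symm

/-- `H_P(a) = h_P a h_P⁻¹`, on operators on spinors. -/
def adTransport (B : DiscreteSpinorBundle G n X S) {x y : V} (p : G.Walk x y) :
    Module.End ℂ (S x) ≃ₐ[ℂ] Module.End ℂ (S y) :=
  (B.transport p).conjAlgEquiv ℂ

theorem transport_append (B : DiscreteSpinorBundle G n X S) {x y z : V} (p : G.Walk x y)
    (q : G.Walk y z) : B.transport (p.append q) = (B.transport p).trans (B.transport q) := by
  induction q with
  | nil => rfl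
  | fwd e q ih => simp only [WeightedOrientedGraph.Walk.append, transport, ih]; rfl
  | bwd e q ih => simp only [WeightedOrientedGraph.Walk.append, transport, ih]; rfl

theorem transport_reverse (B : DiscreteSpinorBundle G n X S) {x y : V} (p : G.Walk x y) :
    B.transport p.reverse = (B.transport p).symm := by
  induction p with
  | nil => rfl
  | fwd e p ih => simp only [WeightedOrientedGraph.Walk.reverse, transport_append, ih]; rfl
  | bwd e p ih => simp only [WeightedOrientedGraph.Walk.reverse, transport_append, ih]; rfl

/-- The holonomy group at `x`: all holonomy operators `Ad(h_P)` for closed paths `P` at `x`. -/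
def holonomyGroup (B : DiscreteSpinorBundle G n X S) (x : V) :
    Subgroup (Module.End ℂ (S x) ≃ₐ[ℂ] Module.End ℂ (S x)) where
  carrier := Set.range fun p : G.Walk x x => B.adTransport p
  one_mem' := ⟨.nil, by ext; rfl⟩
  mul_mem' := by
    rintro _ _ ⟨p, rfl⟩ ⟨q, rfl⟩
    exact ⟨q.append p, by simp only [adTransport, transport_append]; rfl⟩
  inv_mem' := by
    rintro _ ⟨p, rfl⟩
    exact ⟨p.reverse, by simp only [adTransport, transport_reverse]; rfl⟩

def IsTimelike (B : DiscreteSpinorBundle G n X S) {v : V} (x : X v) : Prop := 0 < B.Q v x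

/-- Future-directed timelike vectors: those `x` for which `(., x .)` is positive definite. -/
def IsFutureTimelike (B : DiscreteSpinorBundle G n X S) {v : V} (x : X v) : Prop :=
  B.IsTimelike x ∧ IsPosDefWith (B.krein v) (B.cliff v x)

/-- Parallel (covariantly constant) vector fields. -/
def IsParallel (B : DiscreteSpinorBundle G n X S) (u : ∀ v, X v) : Prop :=
  ∀ (v w : V) (p : G.Walk v w), B.cliff w (u w) = B.adTransport p (B.cliff v (u v))

/-- The vector `x` is fixed by the holonomy group at `v`. -/
def IsHolonomyFixed (B : DiscreteSpinorBundle G n X S) {v : V} (x : X v) : Prop :=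
  ∀ g ∈ B.holonomyGroup v, g (B.cliff v x) = B.cliff v x

end DiscreteSpinorBundle

end

/-!
A positive time-orientation form is the off-diagonal operator `F(e,±) ↦ T_e^± h_e^± F(e,∓)` of a
`J`-real family of positive odd operators `T_e^±` on the fibres. Reconstructibility says that
conjugation by `T` preserves the even sections, hence acts in the same way at all edges ending at a
given vertex, so that the values of `T` over a vertex differ only by positive scalars on each of the
two chiralities.

For `n > 2` and each chirality `σ`, the functional `y ↦ Re Tr(P_σ T y)` on vectors is represented by
a timelike vector, whose direction does not change when `T` is rescaled on each chirality. The sum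
over both chiralities of the normalised vectors depends only on the vertex and is compatible with
`J` and with transport, hence is a parallel field. Conversely, a parallel future-directed timelike
field `u` gives the family `T = u`. For `n = 2` the even operators commute, so every positive family
normalises them. A timelike vector fixed by the holonomy group extends to a parallel field by
transport along paths.
-/

noncomputable section

/-! ### Anticommuting families -/

section AnticommutingFamilies

variable {𝕜 R ι : Type*} [Field 𝕜] [Ring R] [Algebra 𝕜 R] {e : ι → R} {s : ι → 𝕜}

/-- A family of pairwise anticommuting elements of an algebra whose squares are nonzero scalars,
such as an orthogonal basis of a nondegenerate quadratic space in a Clifford algebra. -/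
structure IsAnticommutingFamily (e : ι → R) (s : ι → 𝕜) : Prop where
  anticomm : ∀ i j, i ≠ j → e i * e j = -(e j * e i)
  mul_self : ∀ i, e i * e i = s i • (1 : R)
  ne_zero : ∀ i, s i ≠ 0

namespace IsAnticommutingFamily

theorem isUnit (he : IsAnticommutingFamily e s) (i : ι) : IsUnit (e i) :=
  ⟨⟨e i, (s i)⁻¹ • e i, by simp [he.mul_self, he.ne_zero], by simp [he.mul_self, he.ne_zero]⟩, rfl⟩

theorem mul_prod [DecidableEq ι] (he : IsAnticommutingFamily e s) (i : ι) (l : List ι) :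
    e i * (l.map e).prod = (-1 : 𝕜) ^ l.countP (· ≠ i) • ((l.map e).prod * e i) := by
  induction l with
  | nil => simp
  | cons k l ih =>
    rw [List.map_cons, List.prod_cons, mul_assoc (e k), ← mul_assoc]
    obtain rfl | hki := eq_or_ne k i
    · rw [mul_assoc, ih, List.countP_cons_of_neg (by simp), mul_smul_comm]
    · rw [he.anticomm i k hki.symm, neg_mul, mul_assoc, ih,
        List.countP_cons_of_pos (by simpa using hki), pow_succ, mul_neg_one, neg_smul,
        mul_smul_comm]

theorem prod_reverse (he : IsAnticommutingFamily e s) {l : List ι} (hl : l.Nodup) :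
    (l.reverse.map e).prod = (-1 : 𝕜) ^ l.length.choose 2 • (l.map e).prod := by
  classical
  induction l with
  | nil => simp
  | cons k l ih =>
    obtain ⟨hkl, hl⟩ := List.nodup_cons.1 hl
    have hcount : l.countP (· ≠ k) = l.length :=
      List.countP_eq_length.2 fun j hj => by simpa using fun h : j = k => hkl (h ▸ hj)
    rw [List.reverse_cons, List.map_append, List.prod_append, ih hl, List.map_singleton,
      List.prod_singleton, List.map_cons, List.prod_cons, he.mul_prod, hcount, smul_mul_assoc,
      List.length_cons, Nat.choose_succ_succ' l.length 1, Nat.choose_one_right, smul_smul,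
      ← pow_add, show l.length + l.length.choose 2 + l.length = l.length.choose 2 + 2 * l.length by
        ring, pow_add _ _ (2 * _), pow_mul, neg_one_sq, one_pow, mul_one]

theorem prod_reverse_mul (he : IsAnticommutingFamily e s) (l : List ι) :
    (l.reverse.map e).prod * (l.map e).prod = (l.map s).prod • (1 : R) := by
  induction l with
  | nil => simp
  | cons k l ih =>
    rw [List.reverse_cons, List.map_append, List.prod_append, List.map_singleton,
      List.prod_singleton, List.map_cons, List.prod_cons, mul_assoc, ← mul_assoc (e k),
      he.mul_self, smul_one_mul, mul_smul_comm, ih, smul_smul, List.map_cons, List.prod_cons]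

end IsAnticommutingFamily

section Monomials

variable [DecidableEq ι]

/-- The product of the `e i` with `i ∈ I`, in the order in which they appear in the list `l`. -/
def orderedMonomial (e : ι → R) (l : List ι) (I : Finset ι) : R :=
  ((l.filter (· ∈ I)).map e).prod

@[simp]
theorem orderedMonomial_empty (e : ι → R) (l : List ι) : orderedMonomial e l ∅ = 1 := by
  simp [orderedMonomial]

theorem orderedMonomial_cons (e : ι → R) (k : ι) (l : List ι) (I : Finset ι) :
    orderedMonomial e (k :: l) I =
      (if k ∈ I then e k else 1) * orderedMonomial e l I := by
  by_cases hk : k ∈ I <;> simp [orderedMonomial, hk]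

theorem orderedMonomial_congr {l : List ι} {I J : Finset ι} (h : ∀ i ∈ l, i ∈ I ↔ i ∈ J) :
    orderedMonomial e l I = orderedMonomial e l J := by
  unfold orderedMonomial
  congr 2
  exact List.filter_congr fun i hi => by simp [h i hi]

theorem eq_of_forall_even_card_erase_iff [Fintype ι] (hι : Even (Fintype.card ι)) {I J : Finset ι}
    (h : ∀ i, Even (I.erase i).card ↔ Even (J.erase i).card) : I = J := by
  have herase (I : Finset ι) (i : ι) : Even (I.erase i).card ↔ (Even I.card ↔ i ∉ I) := by
    by_cases hi : i ∈ I
    · have := Finset.card_erase_add_one hi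
      grind
    · simp [hi]
  simp only [herase] at h
  by_cases hcard : Even I.card ↔ Even J.card
  · ext i
    have := h i
    tauto
  · have hJ : J = Iᶜ := by
      ext i
      have := h i
      rw [Finset.mem_compl]
      tauto
    have := Finset.card_add_card_compl I
    rw [hJ] at hcard
    grind

namespace IsAnticommutingFamily

theorem isUnit_orderedMonomial (he : IsAnticommutingFamily e s) (l : List ι) (I : Finset ι) :
    IsUnit (orderedMonomial e l I) := by
  refine List.prod_isUnit fun x hx => ?_
  obtain ⟨i, -, rfl⟩ := List.mem_map.1 hx
  exact he.isUnit i

theorem mul_orderedMonomial_comm (he : IsAnticommutingFamily e s) {l : List ι}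
    (hl : l.Nodup) (hmem : ∀ i, i ∈ l) (i : ι) (I : Finset ι) :
    e i * orderedMonomial e l I =
      (-1 : 𝕜) ^ (I.erase i).card • (orderedMonomial e l I * e i) := by
  have hcount : (l.filter (· ∈ I)).countP (· ≠ i) = (I.erase i).card := by
    rw [List.countP_eq_length_filter, List.filter_filter,
      ← List.toFinset_card_of_nodup (hl.filter _)]
    congr 1
    ext j
    simp [hmem j]
  rw [orderedMonomial, he.mul_prod, hcount]

theorem mul_orderedMonomial (he : IsAnticommutingFamily e s) {l : List ι} (hl : l.Nodup) {i : ι}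
    (hi : i ∈ l) (I : Finset ι) :
    ∃ c : 𝕜, e i * orderedMonomial e l I = c • orderedMonomial e l (symmDiff {i} I) := by
  induction l with
  | nil => simp at hi
  | cons k l ih =>
    obtain ⟨hkl, hl⟩ := List.nodup_cons.1 hl
    rw [orderedMonomial_cons, orderedMonomial_cons, ← mul_assoc]
    obtain rfl | hki := eq_or_ne k i
    · have hrest : orderedMonomial e l (symmDiff {k} I) = orderedMonomial e l I :=
        orderedMonomial_congr fun j hj => by
          simp [Finset.mem_symmDiff, show j ≠ k from fun h => hkl (h ▸ hj)]
      by_cases hkI : k ∈ I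
      · exact ⟨s k, by simp [hrest, hkI, Finset.mem_symmDiff, he.mul_self]⟩
      · exact ⟨1, by simp [hrest, hkI, Finset.mem_symmDiff]⟩
    · obtain ⟨c, hc⟩ := ih hl ((List.mem_cons.1 hi).resolve_left hki.symm)
      by_cases hkI : k ∈ I
      · exact ⟨-c, by simp [hkI, Finset.mem_symmDiff, hki, he.anticomm i k hki.symm, mul_assoc, hc]⟩
      · exact ⟨c, by simp [hkI, Finset.mem_symmDiff, hki, hc]⟩

theorem mem_span_range_orderedMonomial (he : IsAnticommutingFamily e s) {l : List ι} (hl : l.Nodup)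
    (hmem : ∀ i, i ∈ l) {a : R} (ha : a ∈ Algebra.adjoin 𝕜 (Set.range e)) :
    a ∈ Submodule.span 𝕜 (Set.range (orderedMonomial e l)) := by
  suffices ∀ x ∈ Submodule.span 𝕜 (Set.range (orderedMonomial e l)),
      a * x ∈ Submodule.span 𝕜 (Set.range (orderedMonomial e l)) by
    simpa using this 1 (Submodule.subset_span ⟨∅, orderedMonomial_empty e l⟩)
  induction ha using Algebra.adjoin_induction with
  | mem _ ha =>
    obtain ⟨i, rfl⟩ := ha
    intro x hx
    induction hx using Submodule.span_induction with
    | mem _ hx =>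
      obtain ⟨I, rfl⟩ := hx
      obtain ⟨c, hc⟩ := he.mul_orderedMonomial hl (hmem i) I
      rw [hc]
      exact Submodule.smul_mem _ c (Submodule.subset_span ⟨_, rfl⟩)
    | zero => simp
    | add x y _ _ hx hy => rw [mul_add]; exact add_mem hx hy
    | smul c x _ hx => rw [mul_smul_comm]; exact Submodule.smul_mem _ c hx
  | algebraMap c =>
    exact fun x hx => by
      simpa [Algebra.algebraMap_eq_smul_one] using Submodule.smul_mem _ c hx
  | add a b _ _ ha hb => exact fun x hx => by rw [add_mul]; exact add_mem (ha x hx) (hb x hx)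
  | mul a b _ _ ha hb => exact fun x hx => by rw [mul_assoc]; exact ha _ (hb x hx)

theorem linearIndependent_orderedMonomial [Fintype ι] [Nontrivial R] (h2 : (2 : 𝕜) ≠ 0)
    (hι : Even (Fintype.card ι)) (he : IsAnticommutingFamily e s) {l : List ι} (hl : l.Nodup)
    (hmem : ∀ i, i ∈ l) : LinearIndependent 𝕜 (orderedMonomial e l) := by
  -- The monomials are joint eigenvectors of the maps `x ↦ e i * x * e i`, with distinct characters.
  let f (i : ι) : Module.End 𝕜 R := LinearMap.mulLeftRight 𝕜 (e i, e i)
  have hf (i : ι) (x : R) : f i x = e i * x * e i := LinearMap.mulLeftRight_apply ..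
  have hcomm (i j : ι) : Commute (f i) (f j) := by
    obtain rfl | hij := eq_or_ne i j
    · exact Commute.refl _
    · refine LinearMap.ext fun x => ?_
      rw [Module.End.mul_apply, Module.End.mul_apply, hf, hf, hf, hf]
      simp only [← mul_assoc, he.anticomm i j hij, neg_mul]
      simp only [mul_assoc, he.anticomm i j hij, mul_neg]
  let χ (I : Finset ι) (i : ι) : 𝕜 := (-1) ^ (I.erase i).card * s i
  have hχ : Function.Injective χ := fun I J hIJ => by
    refine eq_of_forall_even_card_erase_iff hι fun i => ?_
    have h := mul_right_cancel₀ (he.ne_zero i) (congrFun hIJ i)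
    have hne : (-1 : 𝕜) ≠ 1 := fun h1 => h2 (by linear_combination -h1)
    rw [← neg_one_pow_eq_one_iff_even hne, h, neg_one_pow_eq_one_iff_even hne]
  have hindep := Module.End.independent_iInf_maxGenEigenspace_of_forall_mapsTo f
    fun i j c => Module.End.mapsTo_maxGenEigenspace_of_comm (hcomm j i) c
  have hmem_iInf (I : Finset ι) : orderedMonomial e l I ∈ ⨅ i, (f i).maxGenEigenspace (χ I i) := by
    refine (Submodule.mem_iInf _).2 fun i => (Module.End.mem_maxGenEigenspace _ _ _).2 ⟨1, ?_⟩
    rw [pow_one, LinearMap.sub_apply, hf, he.mul_orderedMonomial_comm hl hmem, smul_mul_assoc,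
      mul_assoc, he.mul_self, mul_smul_comm, mul_one, smul_smul, LinearMap.smul_apply,
      Module.End.one_apply, sub_self]
  exact (hindep.comp hχ).linearIndependent _ hmem_iInf
    fun I => (he.isUnit_orderedMonomial l I).ne_zero

end IsAnticommutingFamily

end Monomials

theorem IsAnticommutingFamily.injective_of_adjoin_eq_top {R' : Type*} [Ring R'] [Nontrivial R']
    [Algebra 𝕜 R'] [Fintype ι] (h2 : (2 : 𝕜) ≠ 0) (hι : Even (Fintype.card ι))
    (he : IsAnticommutingFamily e s) (htop : Algebra.adjoin 𝕜 (Set.range e) = ⊤)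
    (f : R →ₐ[𝕜] R') : Function.Injective f := by
  classical
  have hfe : IsAnticommutingFamily (f ∘ e) s :=
    ⟨fun i j hij => by simp [← map_mul, he.anticomm i j hij],
      fun i => by simp [← map_mul, he.mul_self], he.ne_zero⟩
  have hmem : ∀ i, i ∈ (Finset.univ : Finset ι).toList := by simp
  have hf (I : Finset ι) : f (orderedMonomial e Finset.univ.toList I) =
      orderedMonomial (f ∘ e) Finset.univ.toList I := by
    simp [orderedMonomial, map_list_prod]
  have hindep := hfe.linearIndependent_orderedMonomial h2 hι (Finset.nodup_toList _) hmem
  refine (injective_iff_map_eq_zero f).2 fun a ha => ?_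
  have hspan := he.mem_span_range_orderedMonomial (Finset.nodup_toList _) hmem
    (htop ▸ Algebra.mem_top : a ∈ Algebra.adjoin 𝕜 (Set.range e))
  obtain ⟨c, rfl⟩ := (Submodule.mem_span_range_iff_exists_fun 𝕜).1 hspan
  rw [map_sum] at ha
  simp only [map_smul, hf] at ha
  simp [Fintype.linearIndependent_iff.1 hindep c ha]

end AnticommutingFamilies

/-! ### Hermitian forms -/

section HermitianForms

variable {K : Type*} [AddCommGroup K] [Module ℂ K] {B : K →ₗ⋆[ℂ] K →ₗ[ℂ] ℂ}
  {T T' U U' : Module.End ℂ K}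

namespace IsKreinProduct

theorem eq_of_forall (hB : IsKreinProduct B) {φ φ' : K} (h : ∀ ψ, B ψ φ = B ψ φ') : φ = φ' :=
  sub_eq_zero.1 (hB.nondegenerate _ fun ψ => by rw [map_sub, h, sub_self])

theorem exists_operator [FiniteDimensional ℂ K] (hB : IsKreinProduct B)
    (C : K →ₗ⋆[ℂ] K →ₗ[ℂ] ℂ) : ∃ T : Module.End ℂ K, ∀ ψ φ, C ψ φ = B ψ (T φ) := by
  let b := Module.finBasis ℂ K
  let coords (M : K →ₗ⋆[ℂ] K →ₗ[ℂ] ℂ) : K →ₗ[ℂ] Fin (Module.finrank ℂ K) → ℂ :=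
    LinearMap.pi fun i => M (b i)
  have coords_eq {M : K →ₗ⋆[ℂ] K →ₗ[ℂ] ℂ} {φ φ' : K} (h : coords M φ = coords B φ') (ψ : K) :
      M ψ φ = B ψ φ' :=
    LinearMap.congr_fun (b.ext (f₁ := M.flip φ) (f₂ := B.flip φ') fun i => congrFun h i) ψ
  have hinj : Function.Injective (coords B) := fun φ φ' h => hB.eq_of_forall (coords_eq h)
  let L := LinearEquiv.ofInjectiveOfFinrankEq (coords B) hinj (by simp)
  exact ⟨L.symm ∘ₗ coords C, fun ψ φ => coords_eq (L.apply_symm_apply _).symm ψ⟩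

theorem exists_adjoint [FiniteDimensional ℂ K] (hB : IsKreinProduct B) (T : Module.End ℂ K) :
    ∃ T', IsAdjointFor (fun ψ φ => B ψ φ) T T' :=
  hB.exists_operator (B.comp T)

end IsKreinProduct

namespace IsAdjointFor

theorem symm (hB : IsKreinProduct B) (h : IsAdjointFor (fun ψ φ => B ψ φ) T T') :
    IsAdjointFor (fun ψ φ => B ψ φ) T' T :=
  fun ψ φ => by
    change B (T' ψ) φ = B ψ (T φ)
    rw [hB.hermitian φ, hB.hermitian (T φ)]
    exact congrArg conj (h φ ψ).symm

theorem mul {B : K → K → ℂ} (hT : IsAdjointFor B T T') (hU : IsAdjointFor B U U') :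
    IsAdjointFor B (T * U) (U' * T') :=
  fun ψ φ => (hT (U ψ) φ).trans (hU ψ (T' φ))

theorem unique (hB : IsKreinProduct B) (h : IsAdjointFor (fun ψ φ => B ψ φ) T T')
    (hU : IsAdjointFor (fun ψ φ => B ψ φ) T U) : T' = U :=
  LinearMap.ext fun φ => hB.eq_of_forall fun ψ => (h ψ φ).symm.trans (hU ψ φ)

theorem im_eq_zero (hB : IsKreinProduct B) (hT : IsAdjointFor (fun ψ φ => B ψ φ) T T) (ψ : K) :
    (B ψ (T ψ)).im = 0 :=
  Complex.conj_eq_iff_im.1 ((hB.hermitian ψ (T ψ)).symm.trans (hT ψ ψ))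

end IsAdjointFor

namespace IsPosDefWith

theorem injective (hT : IsPosDefWith B T) : Function.Injective T := by
  refine (injective_iff_map_eq_zero T).2 fun ψ hψ => by_contra fun h => ?_
  simpa [hψ] using (hT ψ h).1

theorem isUnit [FiniteDimensional ℂ K] (hT : IsPosDefWith B T) : IsUnit T :=
  (LinearMap.isUnit_iff_ker_eq_bot T).2 (LinearMap.ker_eq_bot.2 hT.injective)

theorem nonneg (hT : IsPosDefWith B T) (ψ : K) : 0 ≤ (B ψ (T ψ)).re ∧ (B ψ (T ψ)).im = 0 := by
  obtain rfl | hψ := eq_or_ne ψ 0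
  · simp
  · exact ⟨(hT ψ hψ).1.le, (hT ψ hψ).2⟩

theorem add (hT : IsPosDefWith B T) (hU : IsPosDefWith B U) : IsPosDefWith B (T + U) :=
  fun ψ hψ => by
    simpa [(hT ψ hψ).2, (hU ψ hψ).2] using add_pos (hT ψ hψ).1 (hU ψ hψ).1

theorem smul (hT : IsPosDefWith B T) {r : ℝ} (hr : 0 < r) : IsPosDefWith B ((r : ℂ) • T) :=
  fun ψ hψ => by simpa [(hT ψ hψ).2, hr] using (hT ψ hψ).1

end IsPosDefWith

theorem exists_orthonormal_basis [FiniteDimensional ℂ K] (hB : ∀ ψ φ, B φ ψ = conj (B ψ φ))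
    (hpos : IsPosDefWith B 1) :
    ∃ b : Module.Basis (Fin (Module.finrank ℂ K)) ℂ K, ∀ i φ, b.repr φ i = B (b i) φ := by
  let core : InnerProductSpace.Core ℂ K :=
    { inner := fun ψ φ => B ψ φ
      conj_inner_symm := fun ψ φ => (hB φ ψ).symm
      re_inner_nonneg := fun ψ => (hpos.nonneg ψ).1
      add_left := fun ψ φ χ => by simp
      smul_left := fun ψ φ c => by simp
      definite := fun ψ (h : B ψ ψ = 0) => by
        by_contra hψ
        simpa [h] using (hpos ψ hψ).1 }
  let _ : NormedAddCommGroup K := core.toNormedAddCommGroup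
  let _ : InnerProductSpace ℂ K := InnerProductSpace.ofCore core.toCore
  exact ⟨(stdOrthonormalBasis ℂ K).toBasis, fun i φ => by
    rw [OrthonormalBasis.coe_toBasis_repr_apply, OrthonormalBasis.repr_apply_apply,
      OrthonormalBasis.coe_toBasis]; rfl⟩

theorem trace_pos_of_posDef [FiniteDimensional ℂ K] (hB : IsKreinProduct B)
    {T U W W' : Module.End ℂ K} (hT : IsPosDefWith B T) (hTT : IsAdjointFor (fun ψ φ => B ψ φ) T T)
    (hU : IsPosDefWith B U) (hW : IsAdjointFor (fun ψ φ => B ψ φ) W W') (hW0 : W ≠ 0) :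
    0 < (LinearMap.trace ℂ K (T * (W' * (U * W)))).re ∧
      (LinearMap.trace ℂ K (T * (W' * (U * W)))).im = 0 := by
  -- In a basis that is orthonormal for `(T ·, ·)`, the trace is the sum of the positive numbers
  -- `(W T b, U W T b)`.
  obtain ⟨b, hb⟩ := exists_orthonormal_basis (B := B.comp T)
    (fun ψ φ => (hTT φ ψ).trans (hB.hermitian (T ψ) φ))
    (fun ψ hψ => by
      rw [LinearMap.comp_apply, show B (T ψ) ((1 : Module.End ℂ K) ψ) = B ψ (T ψ) from hTT ψ ψ]
      exact hT ψ hψ)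
  have htr : LinearMap.trace ℂ K (T * (W' * (U * W))) =
      ∑ i, B (W (T (b i))) (U (W (T (b i)))) := by
    rw [LinearMap.trace_mul_comm, LinearMap.trace_eq_matrix_trace ℂ b, Matrix.trace]
    refine Finset.sum_congr rfl fun i _ => ?_
    rw [Matrix.diag_apply, LinearMap.toMatrix_apply, hb]
    exact (hW _ _).symm
  rw [htr, Complex.re_sum, Complex.im_sum]
  refine ⟨?_, Finset.sum_eq_zero fun i _ => (hU.nonneg _).2⟩
  obtain ⟨i, hi⟩ : ∃ i, W (T (b i)) ≠ 0 := by
    by_contra! h0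
    exact hW0 (hT.isUnit.mul_left_eq_zero.1 (b.ext h0 : W * T = 0))
  exact Finset.sum_pos' (fun i _ => (hU.nonneg _).1) ⟨i, Finset.mem_univ i, (hU _ hi).1⟩

theorem exists_posDef_form [FiniteDimensional ℂ K] :
    ∃ p : K →ₗ⋆[ℂ] K →ₗ[ℂ] ℂ, (∀ ψ φ, p φ ψ = conj (p ψ φ)) ∧ IsPosDefWith p 1 := by
  let f := (Module.finBasis ℂ K).equivFun.trans (WithLp.linearEquiv 2 ℂ (Fin _ → ℂ)).symm
  refine ⟨((innerₛₗ ℂ).comp f.toLinearMap).compl₂ f.toLinearMap,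
    fun ψ φ => (inner_conj_symm (𝕜 := ℂ) (f φ) (f ψ)).symm, fun ψ hψ => ?_⟩
  have hfψ : f ψ ≠ 0 := (map_ne_zero_iff f f.injective).2 hψ
  have him := inner_self_im (𝕜 := ℂ) (f ψ)
  exact ⟨(inner_self_nonneg (𝕜 := ℂ)).lt_of_ne' fun h =>
    hfψ (inner_self_eq_zero.1 (Complex.ext h him)), him⟩

theorem exists_invariant_posDef_form [FiniteDimensional ℂ K] (l : List (Module.End ℂ K))
    (hsq : ∀ f ∈ l, f * f = 1) (hcomm : ∀ f ∈ l, ∀ g ∈ l, f * g = g * f ∨ f * g = -(g * f)) :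
    ∃ p : K →ₗ⋆[ℂ] K →ₗ[ℂ] ℂ, (∀ ψ φ, p φ ψ = conj (p ψ φ)) ∧ IsPosDefWith p 1 ∧
      ∀ f ∈ l, ∀ ψ φ, p (f ψ) (f φ) = p ψ φ := by
  induction l with
  | nil =>
    obtain ⟨p, hherm, hpos⟩ := exists_posDef_form (K := K)
    exact ⟨p, hherm, hpos, by simp⟩
  | cons f l ih =>
    obtain ⟨p, hherm, hpos, hinv⟩ := ih (fun g hg => hsq g (List.mem_cons_of_mem f hg))
      fun g hg g' hg' => hcomm g (List.mem_cons_of_mem f hg) g' (List.mem_cons_of_mem f hg')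
    have hff (ψ : K) : f (f ψ) = ψ := LinearMap.congr_fun (hsq f List.mem_cons_self) ψ
    refine ⟨p + (p.comp f).compl₂ f, fun ψ φ => by simp [hherm ψ φ, hherm (f ψ) (f φ)],
      fun ψ hψ => ?_, fun g hg ψ φ => ?_⟩
    · have hfψ : f ψ ≠ 0 := fun h => hψ (by rw [← hff ψ, h, map_zero])
      have h₁ := hpos ψ hψ
      have h₂ := hpos (f ψ) hfψ
      simp only [Module.End.one_apply] at h₁ h₂
      simpa [h₁.2, h₂.2] using add_pos h₁.1 h₂.1
    · simp only [LinearMap.add_apply, LinearMap.compl₂_apply, LinearMap.comp_apply]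
      obtain rfl | hgl := List.mem_cons.1 hg
      · rw [hff, hff, add_comm]
      · have hfg : p (f (g ψ)) (f (g φ)) = p (g (f ψ)) (g (f φ)) := by
          simp only [← Module.End.mul_apply]
          obtain h | h := hcomm f List.mem_cons_self g hg <;> simp [h]
        rw [hfg, hinv g hgl, hinv g hgl]

theorem trace_eq_conj_of_antilinear [FiniteDimensional ℂ K] (J : K →ₗ⋆[ℂ] K)
    (hJ : Function.Injective J) {A C : Module.End ℂ K} (h : ∀ ψ, A (J ψ) = J (C ψ)) :
    LinearMap.trace ℂ K A = conj (LinearMap.trace ℂ K C) := by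
  let b := Module.finBasis ℂ K
  have hindep : LinearIndependent ℂ (J ∘ b) :=
    b.linearIndependent.map_of_injective_injective (starRingEnd ℂ) J.toAddMonoidHom
      (by simp) (fun ψ hψ => hJ (hψ.trans (map_zero J).symm)) (by simp)
  let b' := Module.Basis.mk hindep (hindep.span_eq_top_of_card_eq_finrank' (by simp)).ge
  have hb' (ψ : K) (i : Fin (Module.finrank ℂ K)) : b'.repr (J ψ) i = conj (b.repr ψ i) := by
    have hrepr (j : Fin (Module.finrank ℂ K)) : b'.repr (J (b j)) = Finsupp.single j 1 := by
      rw [← b'.repr_self, Module.Basis.mk_apply, Function.comp_apply]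
    conv_lhs => rw [← b.sum_repr ψ]
    simp only [map_sum, LinearMap.map_smulₛₗ, map_smul, hrepr, Finsupp.coe_finsetSum,
      Finset.sum_apply, Finsupp.coe_smul, Pi.smul_apply, Finsupp.single_apply, smul_eq_mul,
      mul_ite, mul_one, mul_zero, Finset.sum_ite_eq', Finset.mem_univ, if_true]
  rw [LinearMap.trace_eq_matrix_trace ℂ b', LinearMap.trace_eq_matrix_trace ℂ b, Matrix.trace,
    Matrix.trace, map_sum]
  refine Finset.sum_congr rfl fun i _ => ?_
  rw [Matrix.diag_apply, Matrix.diag_apply, LinearMap.toMatrix_apply, LinearMap.toMatrix_apply,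
    ← hb', ← h, Module.Basis.mk_apply, Function.comp_apply]

end HermitianForms

/-! ### Irreducible representations -/

section IrreducibleRepresentations

variable {𝕜 A S : Type*} [Field 𝕜] [IsAlgClosed 𝕜] [Ring A] [Algebra 𝕜 A] [AddCommGroup S]
  [Module 𝕜 S] [FiniteDimensional 𝕜 S] [Nontrivial S] (ρ : A →ₐ[𝕜] Module.End 𝕜 S)

theorem exists_eq_smul_one_of_irreducible
    (hirr : ∀ W : Submodule 𝕜 S, (∀ a, ∀ ψ ∈ W, ρ a ψ ∈ W) → W = ⊥ ∨ W = ⊤)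
    {T : Module.End 𝕜 S} (hT : ∀ a, Commute T (ρ a)) : ∃ c : 𝕜, T = c • (1 : Module.End 𝕜 S) := by
  obtain ⟨c, hc⟩ := Module.End.exists_eigenvalue T
  have htop : Module.End.eigenspace T c = ⊤ := by
    refine (hirr _ fun a ψ hψ => ?_).resolve_left hc
    rw [Module.End.mem_eigenspace_iff] at hψ ⊢
    rw [← Module.End.mul_apply, (hT a).eq, Module.End.mul_apply, hψ, map_smul]
  exact ⟨c, LinearMap.ext fun ψ => Module.End.mem_eigenspace_iff.1 (htop ▸ Submodule.mem_top)⟩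

/-- Burnside's theorem. -/
theorem surjective_of_irreducible
    (hirr : ∀ W : Submodule 𝕜 S, (∀ a, ∀ ψ ∈ W, ρ a ψ ∈ W) → W = ⊥ ∨ W = ⊤) :
    Function.Surjective ρ := by
  let _ : Module A S := Module.compHom S ρ.toRingHom
  have smul_def (a : A) (ψ : S) : a • ψ = ρ a ψ := rfl
  have : IsScalarTower 𝕜 A S := ⟨fun z a ψ => by simp [smul_def]⟩
  have : IsSimpleModule A S :=
    { eq_bot_or_eq_top := fun W => by
        simpa using hirr (W.restrictScalars 𝕜) fun a ψ h => W.smul_mem a h }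
  intro T
  let f : Module.End (Module.End A S) S :=
    { toFun := T
      map_add' := map_add T
      map_smul' := fun g ψ => by
        obtain ⟨c, hc⟩ := exists_eq_smul_one_of_irreducible ρ hirr (T := g.restrictScalars 𝕜)
          fun a => LinearMap.ext fun ψ => map_smul g a ψ
        have hg (φ : S) : g φ = c • φ := LinearMap.congr_fun hc φ
        rw [Module.End.smul_def, hg, map_smul, RingHom.id_apply, Module.End.smul_def, hg] }
  have : Module.Finite (Module.End A S) S := Module.Finite.of_restrictScalars_finite 𝕜 _ _
  obtain ⟨a, ha⟩ := Module.Finite.toModuleEnd_moduleEnd_surjective f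
  exact ⟨a, LinearMap.ext fun ψ => LinearMap.congr_fun ha ψ⟩

end IrreducibleRepresentations

/-! ### The complexified Clifford algebra -/

namespace CCl

variable {X : Type*} [AddCommGroup X] [Module ℝ X] {Q : QuadraticForm ℝ X}

theorem vec_add (x y : X) : vec Q (x + y) = vec Q x + vec Q y := by
  simp [vec, TensorProduct.tmul_add]

theorem vec_smul (r : ℝ) (x : X) : vec Q (r • x) = (r : ℂ) • vec Q x := by
  rw [vec, vec, map_smul, TensorProduct.tmul_smul]
  exact (Complex.coe_smul r _).symm

theorem vec_eq_sum {ι : Type*} [Fintype ι] (b : Module.Basis ι ℝ X) (x : X) :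
    vec Q x = ∑ i, (b.repr x i : ℂ) • vec Q (b i) := by
  simp only [← vec_smul]
  simp only [vec, ← TensorProduct.tmul_sum, ← map_sum, b.sum_repr]

theorem one_tmul_algebraMap (r : ℝ) :
    (1 ⊗ₜ[ℝ] algebraMap ℝ (CliffordAlgebra Q) r : CCl Q) = (r : ℂ) • 1 := by
  rw [Algebra.algebraMap_eq_smul_one, TensorProduct.tmul_smul]
  exact (Complex.coe_smul r (1 : CCl Q)).symm

theorem vec_mul_self (x : X) : vec Q x * vec Q x = (Q x : ℂ) • (1 : CCl Q) := by
  rw [vec, Algebra.TensorProduct.tmul_mul_tmul, CliffordAlgebra.ι_sq_scalar, one_mul,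
    one_tmul_algebraMap]

theorem vec_mul_add_swap (x y : X) : vec Q x * vec Q y + vec Q y * vec Q x =
    ((QuadraticMap.polar Q x y : ℝ) : ℂ) • (1 : CCl Q) := by
  rw [vec, vec, Algebra.TensorProduct.tmul_mul_tmul, Algebra.TensorProduct.tmul_mul_tmul,
    ← TensorProduct.tmul_add, CliffordAlgebra.ι_mul_ι_add_swap, one_mul, one_tmul_algebraMap]

theorem vec_mem_odd (x : X) : vec Q x ∈ odd Q :=
  Submodule.tmul_mem_baseChange_of_mem 1 (CliffordAlgebra.ι_mem_evenOdd_one Q x)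

theorem c_vec (x : X) : c Q (vec Q x) = vec Q x := by
  simp [c, vec]

theorem vec_mul_vec_mem_even (x y : X) : vec Q x * vec Q y ∈ even Q := by
  rw [vec, vec, Algebra.TensorProduct.tmul_mul_tmul]
  exact Subalgebra.tmul_mem_baseChange (CliffordAlgebra.ι_mul_ι_mem_evenOdd_zero Q x y) _

theorem tmul_eq_smul (z : ℂ) (w : CliffordAlgebra Q) : z ⊗ₜ[ℝ] w = z • (1 ⊗ₜ[ℝ] w : CCl Q) := by
  rw [TensorProduct.smul_tmul', smul_eq_mul, mul_one]

theorem induction {P : CCl Q → Prop} (one : P 1) (smul : ∀ (z : ℂ) a, P a → P (z • a))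
    (add : ∀ a a', P a → P a' → P (a + a')) (mul : ∀ x a, P a → P (vec Q x * a)) (a : CCl Q) :
    P a := by
  induction a using TensorProduct.induction_on with
  | zero => simpa only [zero_smul] using smul 0 1 one
  | add a a' h h' => exact add a a' h h'
  | tmul z w =>
    rw [tmul_eq_smul]
    refine smul z _ ?_
    induction w using CliffordAlgebra.left_induction with
    | algebraMap r => rw [one_tmul_algebraMap]; exact smul r _ one
    | add x y hx hy => rw [TensorProduct.tmul_add]; exact add _ _ hx hy
    | ι_mul w x hw =>
      simpa only [vec, Algebra.TensorProduct.tmul_mul_tmul, one_mul] using mul x _ hw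

theorem even_induction {P : CCl Q → Prop} (one : P 1) (smul : ∀ (z : ℂ) a, P a → P (z • a))
    (add : ∀ a a', P a → P a' → P (a + a'))
    (mul : ∀ x y a, P a → P (vec Q x * vec Q y * a)) {a : CCl Q} (ha : a ∈ even Q) : P a := by
  obtain ⟨t, rfl⟩ := ha
  induction t using TensorProduct.induction_on with
  | zero => simpa only [zero_smul, map_zero] using smul 0 1 one
  | add a a' h h' => rw [map_add]; exact add _ _ h h'
  | tmul z w =>
    obtain ⟨w, hw⟩ := w
    change P (z ⊗ₜ[ℝ] w)
    rw [tmul_eq_smul]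
    refine smul z _ ?_
    induction w, hw using CliffordAlgebra.even_induction with
    | algebraMap r => rw [one_tmul_algebraMap]; exact smul r _ one
    | add x y _ _ hx hy => rw [TensorProduct.tmul_add]; exact add _ _ hx hy
    | ι_mul_ι_mul x y w _ hw =>
      simpa only [vec, Algebra.TensorProduct.tmul_mul_tmul, one_mul] using mul x y _ hw

theorem adjoin_range_vec_basis {ι : Type*} [Finite ι] (b : Module.Basis ι ℝ X) :
    Algebra.adjoin ℂ (Set.range fun i => vec Q (b i)) = ⊤ := by
  have := Fintype.ofFinite ι
  refine Algebra.eq_top_iff.2 fun a => ?_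
  induction a using CCl.induction with
  | one => exact one_mem _
  | smul z a h => exact Subalgebra.smul_mem _ h z
  | add a a' h h' => exact add_mem h h'
  | mul x a h =>
    rw [vec_eq_sum b x]
    exact mul_mem (sum_mem fun i _ =>
      Subalgebra.smul_mem _ (Algebra.subset_adjoin (Set.mem_range_self i)) _) h

theorem exists_even_add_vec_mul_even {e : X} (he : Q e = 1) (a : CCl Q) :
    ∃ a₀ ∈ even Q, ∃ a₁ ∈ even Q, a = a₀ + vec Q e * a₁ := by
  have hee : vec Q e * vec Q e = 1 := by rw [vec_mul_self, he, Complex.ofReal_one, one_smul]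
  induction a using CCl.induction with
  | one => exact ⟨1, one_mem _, 0, zero_mem _, by rw [mul_zero, add_zero]⟩
  | smul z a h =>
    obtain ⟨a₀, h₀, a₁, h₁, rfl⟩ := h
    exact ⟨z • a₀, Subalgebra.smul_mem _ h₀ z, z • a₁, Subalgebra.smul_mem _ h₁ z, by
      rw [smul_add, mul_smul_comm]⟩
  | add a a' h h' =>
    obtain ⟨a₀, h₀, a₁, h₁, rfl⟩ := h
    obtain ⟨a₀', h₀', a₁', h₁', rfl⟩ := h'
    exact ⟨a₀ + a₀', add_mem h₀ h₀', a₁ + a₁', add_mem h₁ h₁', by rw [mul_add]; abel⟩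
  | mul x a h =>
    obtain ⟨a₀, h₀, a₁, h₁, rfl⟩ := h
    refine ⟨vec Q x * vec Q e * a₁, mul_mem (vec_mul_vec_mem_even _ _) h₁,
      vec Q e * vec Q x * a₀, mul_mem (vec_mul_vec_mem_even _ _) h₀, ?_⟩
    rw [mul_add, ← mul_assoc (vec Q e), ← mul_assoc (vec Q e), hee, one_mul, mul_assoc, add_comm]

end CCl

theorem IsPseudoOrthonormal.isAnticommutingFamily_vec {n : ℕ} {X : Type*} [AddCommGroup X]
    [Module ℝ X] {Q : QuadraticForm ℝ X} {b : Module.Basis (Fin n) ℝ X}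
    (hb : IsPseudoOrthonormal Q b) :
    IsAnticommutingFamily (fun i => CCl.vec Q (b i)) (fun i => (Q (b i) : ℂ)) where
  anticomm i j hij := by
    have h := CCl.vec_mul_add_swap (Q := Q) (b i) (b j)
    rw [hb.2 i j hij, Complex.ofReal_zero, zero_smul] at h
    exact eq_neg_of_add_eq_zero_left h
  mul_self i := CCl.vec_mul_self (b i)
  ne_zero i := by
    obtain ⟨⟨i₀, h₀, h⟩, -⟩ := hb
    by_cases hi : i = i₀
    · simp [hi, h₀]
    · simp [h i hi]

theorem IsPseudoOrthonormal.prod_eq_neg_one {n : ℕ} {X : Type*} [AddCommGroup X]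
    [Module ℝ X] {Q : QuadraticForm ℝ X} {b : Module.Basis (Fin n) ℝ X}
    (hb : IsPseudoOrthonormal Q b) (hn : Even n) : ∏ i, (Q (b i) : ℂ) = -1 := by
  obtain ⟨⟨i₀, h₀, h⟩, -⟩ := hb
  have hodd : Odd (n - 1) := Nat.Even.sub_odd (Fin.pos i₀) hn odd_one
  rw [← Finset.mul_prod_erase _ _ (Finset.mem_univ i₀), h₀, Finset.prod_congr rfl
    fun i hi => by rw [h i (Finset.ne_of_mem_erase hi)], Finset.prod_const,
    Finset.card_erase_of_mem (Finset.mem_univ i₀), Finset.card_univ, Fintype.card_fin]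
  simp [hodd.neg_one_pow]

theorem neg_one_pow_choose_two_of_even {R : Type*} [Ring R] {n : ℕ} (hn : Even n) :
    (-1 : R) ^ (n.choose 2) = (-1) ^ (n / 2) := by
  obtain ⟨m, rfl⟩ := hn
  have h : (m + m).choose 2 + m = 2 * (m * m) := by
    rw [Nat.choose_two_right]
    cases m with
    | zero => rfl
    | succ k =>
      have hprod : (k + 1 + (k + 1)) * (k + 1 + (k + 1) - 1) = 2 * ((k + 1) * (2 * k + 1)) := by
        rw [show k + 1 + (k + 1) - 1 = 2 * k + 1 by omega]
        ring
      rw [hprod, Nat.mul_div_cancel_left _ two_pos]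
      ring
  rw [← two_mul, Nat.mul_div_cancel_left _ two_pos, two_mul]
  refine neg_one_pow_congr ?_
  exact Nat.even_add.1 (h ▸ even_two_mul (m * m))

theorem neg_one_pow_mul_self {R : Type*} [Ring R] (n : ℕ) : (-1 : R) ^ n * (-1) ^ n = 1 := by
  rw [← pow_add, ← two_mul, pow_mul, neg_one_sq, one_pow]

namespace DiscreteSpinorBundle

variable {V E : Type*} {G : WeightedOrientedGraph V E} {n : ℕ} {X S : V → Type*}
  [∀ v, AddCommGroup (X v)] [∀ v, Module ℝ (X v)]
  [∀ v, AddCommGroup (S v)] [∀ v, Module ℂ (S v)] [∀ v, FiniteDimensional ℂ (S v)]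
  (B : DiscreteSpinorBundle G n X S) (v : V)

theorem cliff_add (x y : X v) : B.cliff v (x + y) = B.cliff v x + B.cliff v y := by
  simp only [cliff, CCl.vec_add, map_add]

theorem cliff_smul (r : ℝ) (x : X v) : B.cliff v (r • x) = (r : ℂ) • B.cliff v x := by
  simp only [cliff, CCl.vec_smul, map_smul]

theorem cliff_neg (x : X v) : B.cliff v (-x) = -B.cliff v x := by
  simpa using B.cliff_smul v (-1) x

theorem cliff_sub (x y : X v) : B.cliff v (x - y) = B.cliff v x - B.cliff v y := by
  rw [sub_eq_add_neg, cliff_add, cliff_neg, sub_eq_add_neg]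

theorem cliff_eq_sum {ι : Type*} [Fintype ι] (b : Module.Basis ι ℝ (X v)) (x : X v) :
    B.cliff v x = ∑ i, (b.repr x i : ℂ) • B.cliff v (b i) := by
  rw [cliff, CCl.vec_eq_sum b x, map_sum]
  simp only [map_smul, cliff]

theorem cliff_mul_self (x : X v) :
    B.cliff v x * B.cliff v x = (B.Q v x : ℂ) • (1 : Module.End ℂ (S v)) := by
  rw [cliff, ← map_mul, CCl.vec_mul_self, map_smul, map_one]

theorem cliff_mul_add_swap (x y : X v) :
    B.cliff v x * B.cliff v y + B.cliff v y * B.cliff v x =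
      ((QuadraticMap.polar (B.Q v) x y : ℝ) : ℂ) • (1 : Module.End ℂ (S v)) := by
  rw [cliff, cliff, ← map_mul, ← map_mul, ← map_add, CCl.vec_mul_add_swap, map_smul, map_one]

theorem cliff_mul_cliff_mul_cliff (x y : X v) : B.cliff v x * B.cliff v y * B.cliff v x =
    B.cliff v (QuadraticMap.polar (B.Q v) x y • x - B.Q v x • y) := by
  rw [eq_sub_of_add_eq (B.cliff_mul_add_swap v x y), sub_mul, smul_one_mul, mul_assoc,
    cliff_mul_self, mul_smul_one, cliff_sub, cliff_smul, cliff_smul]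

theorem J_cliff (x : X v) (ψ : S v) : B.J v (B.cliff v x ψ) = -B.cliff v x (B.J v ψ) := by
  have h := B.J_real v _ (CCl.vec_mem_odd x) ψ
  rw [CCl.c_vec] at h
  rw [cliff, h, neg_neg]

theorem J_prod_cliff {ι : Type*} (x : ι → X v) (l : List ι) (ψ : S v) :
    B.J v ((l.map fun i => B.cliff v (x i)).prod ψ) =
      (-1 : ℂ) ^ l.length • (l.map fun i => B.cliff v (x i)).prod (B.J v ψ) := by
  induction l with
  | nil => simp
  | cons i l ih =>
    simp only [List.map_cons, List.prod_cons, Module.End.mul_apply, J_cliff, ih, map_smul,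
      List.length_cons, pow_succ', mul_smul, neg_one_smul]

theorem isAdjointFor_prod_cliff {ι : Type*} (x : ι → X v) (l : List ι) :
    IsAdjointFor (fun ψ φ => B.krein v ψ φ) (l.map fun i => B.cliff v (x i)).prod
      (l.reverse.map fun i => B.cliff v (x i)).prod := by
  induction l with
  | nil => exact fun _ _ => rfl
  | cons i l ih => simpa [cliff] using IsAdjointFor.mul (B.krein_compatible v (x i)) ih

theorem exists_frame : ∃ b : Module.Basis (Fin n) ℝ (X v), IsPseudoOrthonormal (B.Q v) b ∧
    B.χ v = Complex.I ^ (n / 2 + 1) • ((List.finRange n).map fun i => B.cliff v (b i)).prod := by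
  obtain ⟨b, hb, h⟩ := B.χ_eq v
  refine ⟨b, hb, ?_⟩
  rw [h, map_smul, map_list_prod, List.ofFn_eq_map, List.map_map]
  rfl

variable {B v}

theorem isAnticommutingFamily_cliff {b : Module.Basis (Fin n) ℝ (X v)}
    (hb : IsPseudoOrthonormal (B.Q v) b) :
    IsAnticommutingFamily (fun i => B.cliff v (b i)) (fun i => (B.Q v (b i) : ℂ)) where
  anticomm i j hij := by
    simpa only [map_mul, map_neg, cliff] using
      congrArg (B.ρ v) (hb.isAnticommutingFamily_vec.anticomm i j hij)
  mul_self i := B.cliff_mul_self v (b i)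
  ne_zero := hb.isAnticommutingFamily_vec.ne_zero

theorem χ_cliff (hn : Even n) (x : X v) : B.χ v * B.cliff v x = -(B.cliff v x * B.χ v) := by
  obtain ⟨b, hb, hχ⟩ := B.exists_frame v
  have hbasis (i : Fin n) : B.χ v * B.cliff v (b i) = -(B.cliff v (b i) * B.χ v) := by
    have hcount : (List.finRange n).countP (· ≠ i) = n - 1 := by
      rw [List.countP_eq_length_filter, ← List.toFinset_card_of_nodup
        ((List.nodup_finRange n).filter _), List.toFinset_filter, List.toFinset_finRange]
      simp [Finset.filter_ne']
    have hodd : Odd (n - 1) := Nat.Even.sub_odd (Fin.pos i) hn odd_one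
    have h := (isAnticommutingFamily_cliff hb).mul_prod i (List.finRange n)
    rw [hcount, hodd.neg_one_pow, neg_one_smul] at h
    rw [hχ, mul_smul_comm, h, smul_mul_assoc, smul_neg, neg_neg]
  rw [B.cliff_eq_sum v b x, Finset.mul_sum, Finset.sum_mul, ← Finset.sum_neg_distrib]
  exact Finset.sum_congr rfl fun i _ => by
    rw [mul_smul_comm, hbasis, smul_mul_assoc, smul_neg]

theorem χ_adjoint (hn : Even n) :
    IsAdjointFor (fun ψ φ => B.krein v ψ φ) (B.χ v) (-B.χ v) := by
  obtain ⟨b, hb, hχ⟩ := B.exists_frame v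
  intro ψ φ
  have h : B.krein v (((List.finRange n).map fun i => B.cliff v (b i)).prod ψ) φ = _ :=
    B.isAdjointFor_prod_cliff v b (List.finRange n) ψ φ
  rw [(isAnticommutingFamily_cliff hb).prod_reverse (List.nodup_finRange n),
    List.length_finRange, neg_one_pow_choose_two_of_even hn] at h
  simp only [hχ, LinearMap.smul_apply, LinearMap.map_smulₛₗ, LinearMap.neg_apply, h, map_smul,
    smul_eq_mul, map_neg, map_pow, Complex.conj_I]
  rw [neg_pow, pow_succ (-1 : ℂ), ← mul_assoc]
  linear_combination (-(Complex.I ^ (n / 2 + 1)) *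
    B.krein v ψ (((List.finRange n).map fun i => B.cliff v (b i)).prod φ)) *
      neg_one_pow_mul_self (R := ℂ) (n / 2)

theorem χ_mul_self (hn : Even n) : B.χ v * B.χ v = 1 := by
  obtain ⟨b, hb, hχ⟩ := B.exists_frame v
  have he := isAnticommutingFamily_cliff hb
  have h := he.prod_reverse_mul (List.finRange n)
  rw [he.prod_reverse (List.nodup_finRange n), List.length_finRange,
    neg_one_pow_choose_two_of_even hn, smul_mul_assoc,
    ← List.ofFn_eq_map (f := fun i => (B.Q v (b i) : ℂ)), List.prod_ofFn,
    hb.prod_eq_neg_one hn] at h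
  have hI : Complex.I ^ (n / 2 + 1) * Complex.I ^ (n / 2 + 1) = -(-1) ^ (n / 2) := by
    rw [← mul_pow, Complex.I_mul_I, pow_succ, mul_neg_one]
  rw [hχ, smul_mul_smul_comm, hI, neg_smul, h, neg_one_smul, neg_neg]

theorem J_χ (hn : Even n) (ψ : S v) :
    B.J v (B.χ v ψ) = (-1 : ℂ) ^ (n / 2 + 1) • B.χ v (B.J v ψ) := by
  obtain ⟨b, -, hχ⟩ := B.exists_frame v
  rw [hχ, LinearMap.smul_apply, LinearMap.map_smulₛₗ, J_prod_cliff, List.length_finRange,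
    hn.neg_one_pow, one_smul, LinearMap.smul_apply, smul_smul, map_pow, Complex.conj_I, neg_pow]

theorem exists_eq_smul_one_of_commute_cliff {T : Module.End ℂ (S v)}
    (hT : ∀ x, Commute T (B.cliff v x)) : ∃ c : ℂ, T = c • (1 : Module.End ℂ (S v)) := by
  have := B.nontrivial v
  refine exists_eq_smul_one_of_irreducible (B.ρ v) (B.irreducible v) fun a => ?_
  induction a using CCl.induction with
  | one => simp
  | smul z a h => exact map_smul (B.ρ v) z a ▸ h.smul_right z
  | add a a' h h' => exact map_add (B.ρ v) a a' ▸ h.add_right h'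
  | mul x a h => exact map_mul (B.ρ v) _ a ▸ (hT x).mul_right h

theorem commute_χ_ρ_of_mem_even (hn : Even n) {a : CCl (B.Q v)} (ha : a ∈ CCl.even (B.Q v)) :
    Commute (B.χ v) (B.ρ v a) := by
  refine CCl.even_induction (P := fun a => Commute (B.χ v) (B.ρ v a))
    (by simp) (fun z a h => ?_) (fun a a' h h' => ?_) (fun x y a h => ?_) ha
  · exact map_smul (B.ρ v) z a ▸ h.smul_right z
  · exact map_add (B.ρ v) a a' ▸ h.add_right h'
  · rw [map_mul, map_mul]
    refine Commute.mul_right (?_ : B.χ v * (B.cliff v x * B.cliff v y) =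
      B.cliff v x * B.cliff v y * B.χ v) h
    rw [← mul_assoc, χ_cliff hn, neg_mul, mul_assoc, χ_cliff hn, mul_neg, neg_neg, mul_assoc]

theorem ρ_surjective (B : DiscreteSpinorBundle G n X S) (v : V) : Function.Surjective (B.ρ v) :=
  have := B.nontrivial v
  surjective_of_irreducible (B.ρ v) (B.irreducible v)

theorem exists_even_of_commute_χ (hn : Even n) {T : Module.End ℂ (S v)}
    (hT : Commute (B.χ v) T) : ∃ a : CCl.even (B.Q v), B.ρ v a = T := by
  obtain ⟨a, rfl⟩ := B.ρ_surjective v T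
  obtain ⟨b, ⟨⟨i₀, h₀, -⟩, -⟩, -⟩ := B.exists_frame v
  obtain ⟨a₀, ha₀, a₁, ha₁, rfl⟩ := CCl.exists_even_add_vec_mul_even h₀ a
  refine ⟨⟨a₀, ha₀⟩, ?_⟩
  set U := B.cliff v (b i₀) * B.ρ v a₁
  have hanti : B.χ v * U = -(U * B.χ v) := by
    rw [← mul_assoc, χ_cliff hn, neg_mul, mul_assoc, (commute_χ_ρ_of_mem_even hn ha₁).eq,
      mul_assoc]
  have hcomm : B.χ v * U = U * B.χ v := by
    have h := hT.sub_right (commute_χ_ρ_of_mem_even hn ha₀)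
    rwa [← map_sub, add_sub_cancel_left, map_mul] at h
  have hU : U * B.χ v = 0 := by
    have h : (2 : ℂ) • (U * B.χ v) = 0 :=
      (two_smul ℂ _).trans (eq_neg_iff_add_eq_zero.1 (hcomm.symm.trans hanti))
    exact (smul_eq_zero.1 h).resolve_left two_ne_zero
  have hU0 : U = 0 := by
    rw [← mul_one U, ← χ_mul_self (B := B) (v := v) hn, ← mul_assoc, hU, zero_mul]
  rw [map_add, map_mul]
  exact (left_eq_add.2 hU0)

theorem ρ_injective (hn : Even n) : Function.Injective (B.ρ v) := by
  have := B.nontrivial v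
  obtain ⟨b, hb, -⟩ := B.exists_frame v
  exact hb.isAnticommutingFamily_vec.injective_of_adjoin_eq_top two_ne_zero
    (by rwa [Fintype.card_fin]) (CCl.adjoin_range_vec_basis b) (B.ρ v)

end DiscreteSpinorBundle

/-! ### Timelike vectors -/

theorem IsPseudoOrthonormal.mul_self_eq_one {n : ℕ} {X : Type*} [AddCommGroup X] [Module ℝ X]
    {Q : QuadraticForm ℝ X} {b : Module.Basis (Fin n) ℝ X} (hb : IsPseudoOrthonormal Q b)
    (i : Fin n) : Q (b i) * Q (b i) = 1 := by
  obtain ⟨⟨i₀, h₀, h⟩, -⟩ := hb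
  obtain rfl | hi := eq_or_ne i i₀
  · rw [h₀, one_mul]
  · rw [h i hi]; norm_num

theorem IsPseudoOrthonormal.nondegenerate_polarBilin {n : ℕ} {X : Type*} [AddCommGroup X]
    [Module ℝ X] {Q : QuadraticForm ℝ X} {b : Module.Basis (Fin n) ℝ X}
    (hb : IsPseudoOrthonormal Q b) : Q.polarBilin.Nondegenerate := by
  refine LinearMap.IsOrthoᵢ.nondegenerate_of_not_isOrtho_basis_self b (fun i j hij => hb.2 i j hij)
    fun i h => ?_
  have hpolar : QuadraticMap.polar Q (b i) (b i) = 0 := h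
  have hQ := hb.mul_self_eq_one i
  rw [QuadraticMap.polar_self, smul_eq_zero_iff_right two_ne_zero] at hpolar
  simp [hpolar] at hQ

namespace DiscreteSpinorBundle

variable {V E : Type*} {G : WeightedOrientedGraph V E} {n : ℕ} {X S : V → Type*}
  [∀ v, AddCommGroup (X v)] [∀ v, Module ℝ (X v)]
  [∀ v, AddCommGroup (S v)] [∀ v, Module ℂ (S v)] [∀ v, FiniteDimensional ℂ (S v)]
  (B : DiscreteSpinorBundle G n X S) (v : V)

theorem isAdjointFor_cliff (x : X v) :
    IsAdjointFor (fun ψ φ => B.krein v ψ φ) (B.cliff v x) (B.cliff v x) :=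
  B.krein_compatible v x

theorem krein_cliff (x : X v) (ψ φ : S v) :
    B.krein v (B.cliff v x ψ) φ = B.krein v ψ (B.cliff v x φ) :=
  B.krein_compatible v x ψ φ

theorem cliff_cliff_self (x : X v) (ψ : S v) :
    B.cliff v x (B.cliff v x ψ) = (B.Q v x : ℂ) • ψ :=
  LinearMap.congr_fun (B.cliff_mul_self v x) ψ

theorem nondegenerate_polarBilin : (B.Q v).polarBilin.Nondegenerate := by
  obtain ⟨b, hb⟩ := B.antilorentzian v
  exact hb.nondegenerate_polarBilin

theorem finrank_vectors (B : DiscreteSpinorBundle G n X S) (v : V) :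
    Module.finrank ℝ (X v) = n := by
  obtain ⟨b, -⟩ := B.antilorentzian v
  rw [Module.finrank_eq_card_basis b, Fintype.card_fin]

theorem finiteDimensional_vectors (B : DiscreteSpinorBundle G n X S) (v : V) :
    FiniteDimensional ℝ (X v) := by
  obtain ⟨b, -⟩ := B.antilorentzian v
  exact Module.Finite.of_basis b

theorem cliff_injective : Function.Injective (B.cliff v) := by
  have := B.nontrivial v
  intro x y hxy
  refine sub_eq_zero.1 ((B.nondegenerate_polarBilin v).1 (x - y) fun z => ?_)
  have h := B.cliff_mul_add_swap v (x - y) z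
  rw [cliff_sub, hxy, sub_self, zero_mul, mul_zero, add_zero] at h
  exact_mod_cast (smul_eq_zero.1 h.symm).resolve_right one_ne_zero

variable {B v}

theorem exists_posDef_form_cliff {b : Module.Basis (Fin n) ℝ (X v)}
    (hb : IsPseudoOrthonormal (B.Q v) b) :
    ∃ p : S v →ₗ⋆[ℂ] S v →ₗ[ℂ] ℂ, (∀ ψ φ, p φ ψ = conj (p ψ φ)) ∧ IsPosDefWith p 1 ∧
      ∀ i ψ φ, p (B.cliff v (b i) ψ) φ = B.Q v (b i) * p ψ (B.cliff v (b i) φ) := by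
  have hphase (i : Fin n) : ∃ z : ℂ, z * z * B.Q v (b i) = 1 ∧ conj z * z = 1 := by
    obtain h | h := mul_self_eq_one_iff.1 (hb.mul_self_eq_one i)
    · exact ⟨1, by simp [h]⟩
    · exact ⟨Complex.I, by simp [h]⟩
  choose z hz hconj using hphase
  have hc := isAnticommutingFamily_cliff hb
  let f (i : Fin n) : Module.End ℂ (S v) := z i • B.cliff v (b i)
  have hfsq (i : Fin n) : f i * f i = 1 := by
    rw [smul_mul_smul_comm, cliff_mul_self, smul_smul, hz, one_smul]
  have hfcomm (i j : Fin n) : f i * f j = f j * f i ∨ f i * f j = -(f j * f i) := by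
    obtain rfl | hij := eq_or_ne i j
    · exact .inl rfl
    · exact .inr (by simp only [f, smul_mul_smul_comm, hc.anticomm i j hij, smul_neg,
        mul_comm (z i)])
  obtain ⟨p, hherm, hpos, hinv⟩ := exists_invariant_posDef_form (List.ofFn f)
    (by simpa [List.forall_mem_ofFn_iff] using hfsq)
    (by simpa [List.forall_mem_ofFn_iff] using hfcomm)
  refine ⟨p, hherm, hpos, fun i ψ φ => ?_⟩
  have hunitary (φ : S v) : p (B.cliff v (b i) ψ) (B.cliff v (b i) φ) = p ψ φ := by
    have h := hinv (f i) ((List.mem_ofFn' f (f i)).2 ⟨i, rfl⟩) ψ φ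
    rwa [LinearMap.smul_apply, LinearMap.smul_apply, map_smul, LinearMap.map_smulₛₗ,
      LinearMap.smul_apply, smul_smul, mul_comm, hconj, one_smul] at h
  rw [← hunitary, cliff_cliff_self, map_smul, smul_eq_mul, ← mul_assoc, ← Complex.ofReal_mul,
    hb.mul_self_eq_one, Complex.ofReal_one, one_mul]

variable (B v)

/-- Both forms have the same adjunction on vectors, so they differ by an operator that commutes
with the irreducible representation. -/
theorem exists_krein_cliff_eq_mul : ∃ e : X v, B.Q v e = 1 ∧
    ∃ (p : S v →ₗ⋆[ℂ] S v →ₗ[ℂ] ℂ) (c : ℂ), IsPosDefWith p 1 ∧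
      ∀ ψ φ, B.krein v ψ (B.cliff v e φ) = c * p ψ φ := by
  obtain ⟨b, hb⟩ := B.antilorentzian v
  have hc := isAnticommutingFamily_cliff hb
  obtain ⟨p, hherm, hpos, hp⟩ := exists_posDef_form_cliff hb
  obtain ⟨i₀, h₀, hneg⟩ := hb.1
  have hpK : IsKreinProduct p := ⟨hherm, fun φ h => by
    by_contra hφ
    simpa [h] using (hpos φ hφ).1⟩
  have hkrein (i : Fin n) (ψ φ : S v) :
      B.krein v (B.cliff v (b i) ψ) (B.cliff v (b i₀) φ) =
        B.Q v (b i) * B.krein v ψ (B.cliff v (b i₀) (B.cliff v (b i) φ)) := by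
    rw [krein_cliff]
    obtain rfl | hi := eq_or_ne i i₀
    · rw [h₀, Complex.ofReal_one, one_mul]
    · have h := LinearMap.congr_fun (hc.anticomm i i₀ hi) φ
      simp only [Module.End.mul_apply, LinearMap.neg_apply] at h
      rw [h, hneg i hi, map_neg, Complex.ofReal_neg, Complex.ofReal_one, neg_one_mul]
  obtain ⟨T, hT⟩ := hpK.exists_operator ((B.krein v).compl₂ (B.cliff v (b i₀)))
  have hcomm (i : Fin n) : Commute T (B.cliff v (b i)) := LinearMap.ext fun φ =>
    hpK.eq_of_forall fun ψ => by
      have h := hp i ψ (T φ)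
      rw [← hT, LinearMap.compl₂_apply, hkrein] at h
      rw [Module.End.mul_apply, Module.End.mul_apply, ← hT]
      refine mul_left_cancel₀ (fun h0 => ?_) h
      simpa [Complex.ofReal_eq_zero.1 h0] using hb.mul_self_eq_one i
  obtain ⟨c, rfl⟩ := exists_eq_smul_one_of_commute_cliff (T := T) fun x => by
    rw [B.cliff_eq_sum v b x]
    exact Commute.sum_right _ _ _ fun i _ => (hcomm i).smul_right _
  exact ⟨b i₀, h₀, p, c, hpos, fun ψ φ => by simpa using hT ψ φ⟩

theorem exists_isFutureTimelike : ∃ e : X v, B.IsFutureTimelike e := by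
  have := B.nontrivial v
  obtain ⟨ψ₀, hψ₀⟩ := exists_ne (0 : S v)
  obtain ⟨e, he, p, c, hpos, hc⟩ := B.exists_krein_cliff_eq_mul v
  have hreal (x : X v) (ψ : S v) : (B.krein v ψ (B.cliff v x ψ)).im = 0 :=
    (B.isAdjointFor_cliff v x).im_eq_zero (B.isKrein v) ψ
  have hp (ψ : S v) (hψ : ψ ≠ 0) : 0 < (p ψ ψ).re ∧ (p ψ ψ).im = 0 := hpos ψ hψ
  have hre (ψ : S v) (hψ : ψ ≠ 0) :
      (B.krein v ψ (B.cliff v e ψ)).re = c.re * (p ψ ψ).re := by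
    rw [hc, Complex.mul_re, (hp ψ hψ).2, mul_zero, sub_zero]
  have hc_im : c.im = 0 := by
    have h := hreal e ψ₀
    rw [hc, Complex.mul_im, (hp ψ₀ hψ₀).2, mul_zero, zero_add] at h
    exact (mul_eq_zero.1 h).resolve_right (hp ψ₀ hψ₀).1.ne'
  have hc_re : c.re ≠ 0 := fun h => hψ₀ <| by
    have h0 : B.cliff v e ψ₀ = 0 := (B.isKrein v).nondegenerate _ fun ψ => by
      rw [hc, Complex.ext (w := 0) h hc_im, zero_mul]
    simpa [h0, he] using (B.cliff_cliff_self v e ψ₀).symm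
  have htimelike : B.IsTimelike e := one_pos.trans_eq he.symm
  obtain hneg | hpos := hc_re.lt_or_gt
  · refine ⟨-e, by rwa [IsTimelike, QuadraticMap.map_neg], fun ψ hψ => ⟨?_, hreal _ ψ⟩⟩
    rw [cliff_neg, LinearMap.neg_apply, map_neg, Complex.neg_re, hre ψ hψ]
    exact neg_pos.2 (mul_neg_of_neg_of_pos hneg (hp ψ hψ).1)
  · exact ⟨e, htimelike, fun ψ hψ => ⟨hre ψ hψ ▸ mul_pos hpos (hp ψ hψ).1, hreal e ψ⟩⟩

variable {B v}

theorem polar_mul_krein_cliff (x y : X v) (ψ : S v) :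
    ((QuadraticMap.polar (B.Q v) x y : ℝ) : ℂ) * B.krein v ψ (B.cliff v x ψ) =
      B.krein v (B.cliff v x ψ) (B.cliff v y (B.cliff v x ψ)) +
        B.Q v x * B.krein v ψ (B.cliff v y ψ) := by
  have h : B.cliff v x (B.cliff v y (B.cliff v x ψ)) =
      ((QuadraticMap.polar (B.Q v) x y : ℝ) : ℂ) • B.cliff v x ψ -
        (B.Q v x : ℂ) • B.cliff v y ψ := by
    simpa only [cliff_sub, cliff_smul, Module.End.mul_apply, LinearMap.sub_apply,
      LinearMap.smul_apply] using LinearMap.congr_fun (B.cliff_mul_cliff_mul_cliff v x y) ψ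
  rw [krein_cliff, h, map_sub, map_smul, map_smul, smul_eq_mul, smul_eq_mul, sub_add_cancel]

theorem IsFutureTimelike.polar_mul_re_krein_pos {x y : X v} (hy : B.IsFutureTimelike y)
    (hx : B.IsTimelike x) {ψ : S v} (hψ : ψ ≠ 0) :
    0 < QuadraticMap.polar (B.Q v) x y * (B.krein v ψ (B.cliff v x ψ)).re := by
  rw [← Complex.re_ofReal_mul, polar_mul_krein_cliff, Complex.add_re, Complex.re_ofReal_mul]
  exact add_pos_of_nonneg_of_pos (hy.2.nonneg _).1 (mul_pos hx (hy.2 ψ hψ).1)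

theorem IsFutureTimelike.isFutureTimelike_iff {x y : X v} (hy : B.IsFutureTimelike y)
    (hx : B.IsTimelike x) : B.IsFutureTimelike x ↔ 0 < QuadraticMap.polar (B.Q v) x y := by
  have := B.nontrivial v
  obtain ⟨ψ₀, hψ₀⟩ := exists_ne (0 : S v)
  refine ⟨fun h => (mul_pos_iff_of_pos_right (h.2 ψ₀ hψ₀).1).1
    (hy.polar_mul_re_krein_pos hx hψ₀), fun h => ⟨hx, fun ψ hψ =>
      ⟨(mul_pos_iff_of_pos_left h).1 (hy.polar_mul_re_krein_pos hx hψ),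
        (B.isAdjointFor_cliff v x).im_eq_zero (B.isKrein v) ψ⟩⟩⟩

end DiscreteSpinorBundle

/-! ### The timelike vector of a positive odd operator -/

theorem exists_mul_eq_smul_of_commute_compression {𝕜 M : Type*} [Field 𝕜] [AddCommGroup M]
    [Module 𝕜 M] {C P : Module.End 𝕜 M} (h : ∀ A : Module.End 𝕜 M, Commute C (P * A * P)) :
    ∃ c : 𝕜, C * P = c • P := by
  by_cases hP : P = 0
  · exact ⟨0, by simp [hP]⟩
  obtain ⟨ψ, hψ⟩ : ∃ ψ, P ψ ≠ 0 := by
    by_contra! h0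
    exact hP (LinearMap.ext h0)
  obtain ⟨l, hl⟩ := Module.Projective.exists_dual_eq_one 𝕜 hψ
  refine ⟨l (P (C ψ)), LinearMap.ext fun φ => ?_⟩
  simpa [hl] using LinearMap.congr_fun (h (l.smulRight φ)) ψ

namespace DiscreteSpinorBundle

variable {V E : Type*} {G : WeightedOrientedGraph V E} {n : ℕ} {X S : V → Type*}
  [∀ v, AddCommGroup (X v)] [∀ v, Module ℝ (X v)]
  [∀ v, AddCommGroup (S v)] [∀ v, Module ℂ (S v)] [∀ v, FiniteDimensional ℂ (S v)]
  {B : DiscreteSpinorBundle G n X S} {v : V}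

theorem IsTimelike.isFutureTimelike_or_neg {x : X v} (hx : B.IsTimelike x) :
    B.IsFutureTimelike x ∨ B.IsFutureTimelike (-x) := by
  have := B.nontrivial v
  obtain ⟨ψ, hψ⟩ := exists_ne (0 : S v)
  obtain ⟨e, he⟩ := B.exists_isFutureTimelike v
  have hx' : B.IsTimelike (-x) := by rwa [IsTimelike, QuadraticMap.map_neg]
  rw [he.isFutureTimelike_iff hx, he.isFutureTimelike_iff hx', QuadraticMap.polar_neg_left,
    neg_pos]
  exact (left_ne_zero_of_mul (he.polar_mul_re_krein_pos hx hψ).ne').lt_or_gt.symm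

theorem IsFutureTimelike.add {x y : X v} (hx : B.IsFutureTimelike x)
    (hy : B.IsFutureTimelike y) : B.IsFutureTimelike (x + y) := by
  refine ⟨?_, by rw [cliff_add]; exact hx.2.add hy.2⟩
  rw [IsTimelike, QuadraticMap.map_add (B.Q v)]
  exact add_pos (add_pos hx.1 hy.1) ((hy.isFutureTimelike_iff hx.1).1 hx)

theorem IsFutureTimelike.smul {x : X v} (hx : B.IsFutureTimelike x) {r : ℝ} (hr : 0 < r) :
    B.IsFutureTimelike (r • x) := by
  refine ⟨?_, by rw [cliff_smul]; exact hx.2.smul hr⟩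
  rw [IsTimelike, QuadraticMap.map_smul, smul_eq_mul]
  exact mul_pos (mul_pos hr hr) hx.1

variable (B v) in
theorem exists_polar_eq_zero_and_ne_zero (hn : 2 < n) (x : X v) :
    ∃ z, QuadraticMap.polar (B.Q v) x z = 0 ∧ B.Q v z ≠ 0 := by
  obtain ⟨b, ⟨i₀, -, hneg⟩, horth⟩ := B.antilorentzian v
  obtain ⟨i, hi, j, hj, hij⟩ := (Finset.univ.erase i₀).one_lt_card.1 (by
    rw [Finset.card_erase_of_mem (Finset.mem_univ _), Finset.card_univ, Fintype.card_fin]; lia)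
  replace hi := hneg i (Finset.ne_of_mem_erase hi)
  replace hj := hneg j (Finset.ne_of_mem_erase hj)
  set r := QuadraticMap.polar (B.Q v) x (b i) with hr
  set s := QuadraticMap.polar (B.Q v) x (b j) with hs
  obtain hr0 | hr0 := eq_or_ne r 0
  · exact ⟨b i, hr0, by rw [hi]; norm_num⟩
  · refine ⟨s • b i + (-r) • b j, ?_, ?_⟩
    · simp only [QuadraticMap.polar_add_right, QuadraticMap.polar_smul_right, ← hr, ← hs,
        smul_eq_mul]
      ring
    · rw [QuadraticMap.map_add (B.Q v), QuadraticMap.map_smul, QuadraticMap.map_smul, hi, hj,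
        QuadraticMap.polar_smul_left, QuadraticMap.polar_smul_right, horth i j hij]
      simp only [smul_eq_mul, mul_zero, add_zero]
      exact ne_of_lt (by nlinarith [mul_self_pos.2 hr0, mul_self_nonneg s])

theorem J_injective (B : DiscreteSpinorBundle G n X S) (v : V) : Function.Injective (B.J v) := by
  have hε : B.ε ≠ 0 := by rcases B.ε_sign with h | h <;> simp [h]
  intro ψ φ hψ
  have h := congrArg (B.J v) hψ
  rw [B.J_sq, B.J_sq] at h
  exact smul_right_injective _ hε h

variable (B v) in
/-- An odd Krein self-adjoint operator `T` on the spinor fibre at `v` for which `(·, T ·)` is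
positive definite. Clifford multiplication by a future-directed timelike vector is an example. -/
structure IsPositiveOdd (T : Module.End ℂ (S v)) : Prop where
  odd : B.χ v * T = -(T * B.χ v)
  selfAdjoint : IsAdjointFor (fun ψ φ => B.krein v ψ φ) T T
  posDef : IsPosDefWith (B.krein v) T

theorem IsFutureTimelike.isPositiveOdd (hn : Even n) {x : X v} (hx : B.IsFutureTimelike x) :
    B.IsPositiveOdd v (B.cliff v x) :=
  ⟨χ_cliff hn x, B.isAdjointFor_cliff v x, hx.2⟩

section ChiralProjections

variable {σ : ℝ}

variable (B v σ) in
/-- The projection onto the eigenspace of the chirality for the eigenvalue `σ = ±1`. -/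
def chiralProj : Module.End ℂ (S v) := (2⁻¹ : ℂ) • (1 + (σ : ℂ) • B.χ v)

theorem smul_χ_mul_self (hn : Even n) (hσ : σ * σ = 1) :
    ((σ : ℂ) • B.χ v) * ((σ : ℂ) • B.χ v) = 1 := by
  rw [smul_mul_smul_comm, χ_mul_self hn, ← Complex.ofReal_mul, hσ, Complex.ofReal_one, one_smul]

theorem chiralProj_mul_self (hn : Even n) (hσ : σ * σ = 1) :
    B.chiralProj v σ * B.chiralProj v σ = B.chiralProj v σ := by
  rw [chiralProj, smul_mul_smul_comm, mul_add, add_mul, add_mul, smul_χ_mul_self hn hσ]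
  simp only [mul_one, one_mul]
  module

theorem chiralProj_add_neg : B.chiralProj v σ + B.chiralProj v (-σ) = 1 := by
  simp only [chiralProj, Complex.ofReal_neg]
  module

theorem chiralProj_mul_odd {T : Module.End ℂ (S v)} (hT : B.χ v * T = -(T * B.χ v)) :
    B.chiralProj v σ * T = T * B.chiralProj v (-σ) := by
  simp only [chiralProj, smul_mul_assoc, mul_smul_comm, mul_add, add_mul, one_mul, mul_one, hT,
    Complex.ofReal_neg]
  module

theorem commute_χ_chiralProj : Commute (B.χ v) (B.chiralProj v σ) :=
  ((Commute.one_right _).add_right ((Commute.refl _).smul_right _)).smul_right _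

theorem χ_mul_chiralProj (hn : Even n) (hσ : σ * σ = 1) :
    B.χ v * B.chiralProj v σ = (σ : ℂ) • B.chiralProj v σ := by
  have h : (σ : ℂ) * σ = 1 := by exact_mod_cast hσ
  rw [chiralProj, mul_smul_comm, mul_add, mul_smul_comm, χ_mul_self hn, mul_one,
    smul_comm (σ : ℂ) (2⁻¹ : ℂ), smul_add (σ : ℂ), smul_smul (σ : ℂ) σ, h, one_smul, add_comm]

theorem commute_χ_compression (hn : Even n) (hσ : σ * σ = 1) (A : Module.End ℂ (S v)) :
    Commute (B.χ v) (B.chiralProj v σ * A * B.chiralProj v σ) := by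
  rw [commute_iff_eq, mul_assoc (_ * A), ← commute_χ_chiralProj.eq, mul_assoc, ← mul_assoc,
    χ_mul_chiralProj hn hσ, mul_smul_comm, smul_mul_assoc, mul_assoc]

theorem chiralProj_apply_of_eigen (hσ : σ * σ = 1) {ψ : S v} (hψ : B.χ v ψ = (σ : ℂ) • ψ) :
    B.chiralProj v σ ψ = ψ := by
  have h : (σ : ℂ) * σ = 1 := by exact_mod_cast hσ
  simp only [chiralProj, LinearMap.smul_apply, LinearMap.add_apply, Module.End.one_apply, hψ,
    smul_smul, h]
  module

theorem chiralProj_adjoint (hn : Even n) :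
    IsAdjointFor (fun ψ φ => B.krein v ψ φ) (B.chiralProj v σ) (B.chiralProj v (-σ)) := by
  intro ψ φ
  have h : B.krein v (B.χ v ψ) φ = B.krein v ψ (-B.χ v φ) := χ_adjoint hn ψ φ
  simp only [chiralProj, LinearMap.smul_apply, LinearMap.add_apply, Module.End.one_apply,
    LinearMap.map_smulₛₗ, map_add, h, map_inv₀, Complex.conj_ofNat, Complex.conj_ofReal, map_smul,
    map_neg, smul_eq_mul, Complex.ofReal_neg]
  ring

theorem J_chiralProj (hn : Even n) (ψ : S v) :
    B.J v (B.chiralProj v ((-1) ^ (n / 2 + 1) * σ) ψ) = B.chiralProj v σ (B.J v ψ) := by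
  simp only [chiralProj, LinearMap.smul_apply, LinearMap.add_apply, Module.End.one_apply,
    LinearMap.map_smulₛₗ, map_add, J_χ hn, Complex.conj_ofReal, smul_smul, map_inv₀,
    Complex.conj_ofNat]
  push_cast
  rw [mul_right_comm, neg_one_pow_mul_self, one_mul]

theorem chiralProj_ne_zero (hn : Even n) : B.chiralProj v σ ≠ 0 := by
  have := B.nontrivial v
  obtain ⟨e, he⟩ := B.exists_isFutureTimelike v
  intro h
  have hneg : B.chiralProj v (-σ) = 0 := by
    have hswap := chiralProj_mul_odd (σ := σ) (χ_cliff (B := B) hn e)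
    rw [h, zero_mul] at hswap
    exact he.2.isUnit.mul_right_eq_zero.1 hswap.symm
  simpa [h, hneg] using chiralProj_add_neg (B := B) (v := v) (σ := σ)

theorem cliff_mul_chiralProj_ne_zero (hn : Even n) (hn2 : 2 < n) {x : X v} (hx : x ≠ 0) :
    B.cliff v x * B.chiralProj v σ ≠ 0 := by
  obtain ⟨z, hxz, hz⟩ := B.exists_polar_eq_zero_and_ne_zero v hn2 x
  intro h
  have hanti := B.cliff_mul_add_swap v x z
  rw [hxz, Complex.ofReal_zero, zero_smul] at hanti
  have hneg : B.cliff v x * B.chiralProj v (-σ) = 0 := by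
    have hzero : B.cliff v x * B.chiralProj v (-σ) * B.cliff v z = 0 := by
      rw [mul_assoc, chiralProj_mul_odd (χ_cliff hn z), neg_neg, ← mul_assoc,
        eq_neg_of_add_eq_zero_left hanti, neg_mul, mul_assoc, h, mul_zero, neg_zero]
    have hsq := congrArg (· * B.cliff v z) hzero
    simp only [mul_assoc, cliff_mul_self, zero_mul, mul_smul_comm, mul_one] at hsq
    exact (smul_eq_zero.1 hsq).resolve_left (Complex.ofReal_ne_zero.2 hz)
  refine hx (B.cliff_injective v ?_)
  rw [← mul_one (B.cliff v x), ← chiralProj_add_neg (B := B) (v := v) (σ := σ), mul_add, h, hneg,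
    add_zero]
  simpa using (B.cliff_smul v 0 0).symm

end ChiralProjections

section ChiralTraces

variable {σ : ℝ} {T T' : Module.End ℂ (S v)}

variable (B v σ T) in
/-- The real functional `y ↦ Re Tr(P_σ T y)` on vectors, where `P_σ` projects onto the
chirality `σ`. -/
def chiralTrace : X v →ₗ[ℝ] ℝ where
  toFun y := (LinearMap.trace ℂ (S v) (B.chiralProj v σ * T * B.cliff v y)).re
  map_add' x y := by rw [cliff_add, mul_add, map_add, Complex.add_re]
  map_smul' r x := by
    rw [cliff_smul, mul_smul_comm, map_smul, smul_eq_mul, Complex.re_ofReal_mul]; rfl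

theorem chiralTrace_apply (y : X v) : B.chiralTrace v σ T y =
    (LinearMap.trace ℂ (S v) (B.chiralProj v σ * T * B.cliff v y)).re := rfl

theorem trace_chiralProj_pos (hn : Even n) (hσ : σ * σ = 1) (hT : B.IsPositiveOdd v T)
    {U Z : Module.End ℂ (S v)} (hU : IsPosDefWith (B.krein v) U)
    (hZ : IsAdjointFor (fun ψ φ => B.krein v ψ φ) Z Z) (hZ0 : Z * B.chiralProj v σ ≠ 0) :
    0 < (LinearMap.trace ℂ (S v) (B.chiralProj v σ * T * (Z * U * Z))).re ∧
      (LinearMap.trace ℂ (S v) (B.chiralProj v σ * T * (Z * U * Z))).im = 0 := by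
  have h := trace_pos_of_posDef (B.isKrein v) hT.posDef hT.selfAdjoint hU
    (IsAdjointFor.mul hZ (chiralProj_adjoint (B := B) (v := v) (σ := σ) hn)) hZ0
  have heq : T * (B.chiralProj v (-σ) * Z * (U * (Z * B.chiralProj v σ))) =
      (B.chiralProj v σ * T * (Z * U * Z)) * B.chiralProj v σ := by
    rw [chiralProj_mul_odd hT.odd]
    simp only [mul_assoc]
  rwa [heq, LinearMap.trace_mul_comm, mul_assoc (B.chiralProj v σ) T, ← mul_assoc,
    chiralProj_mul_self hn hσ, ← mul_assoc] at h

theorem trace_chiralProj_cliff_pos (hn : Even n) (hσ : σ * σ = 1) (hT : B.IsPositiveOdd v T)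
    {y : X v} (hy : B.IsFutureTimelike y) :
    0 < (LinearMap.trace ℂ (S v) (B.chiralProj v σ * T * B.cliff v y)).re ∧
      (LinearMap.trace ℂ (S v) (B.chiralProj v σ * T * B.cliff v y)).im = 0 := by
  have hQ : 0 < B.Q v y := hy.1
  have h := trace_chiralProj_pos hn hσ hT hy.2 (B.isAdjointFor_cliff v y)
    fun h0 => chiralProj_ne_zero hn (hy.2.isUnit.mul_right_eq_zero.1 h0)
  rwa [cliff_mul_self, smul_one_mul, mul_smul_comm, map_smul, smul_eq_mul, Complex.re_ofReal_mul,
    Complex.im_ofReal_mul, mul_pos_iff_of_pos_left hQ, mul_eq_zero_iff_left hQ.ne'] at h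

theorem chiralTrace_reflection_pos (hn : Even n) (hn2 : 2 < n) (hσ : σ * σ = 1)
    (hT : B.IsPositiveOdd v T) {x y : X v} (hx : x ≠ 0) (hy : B.IsFutureTimelike y) :
    0 < B.chiralTrace v σ T (QuadraticMap.polar (B.Q v) x y • x - B.Q v x • y) := by
  rw [chiralTrace_apply, ← cliff_mul_cliff_mul_cliff]
  exact (trace_chiralProj_pos hn hσ hT hy.2 (B.isAdjointFor_cliff v x)
    (cliff_mul_chiralProj_ne_zero hn hn2 hx)).1

end ChiralTraces

section DualVectors

variable (B v)

/-- The vector representing a functional with respect to the polarised metric. -/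
def dualVec (f : X v →ₗ[ℝ] ℝ) : X v :=
  haveI := B.finiteDimensional_vectors v
  (LinearMap.BilinForm.toDual (B.Q v).polarBilin (B.nondegenerate_polarBilin v)).symm f

theorem polar_dualVec (f : X v →ₗ[ℝ] ℝ) (y : X v) :
    QuadraticMap.polar (B.Q v) (B.dualVec v f) y = f y :=
  haveI := B.finiteDimensional_vectors v
  LinearMap.BilinForm.apply_toDual_symm_apply (B := (B.Q v).polarBilin)
    (hB := B.nondegenerate_polarBilin v) f y

theorem eq_dualVec {f : X v →ₗ[ℝ] ℝ} {x : X v}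
    (h : ∀ y, QuadraticMap.polar (B.Q v) x y = f y) : x = B.dualVec v f :=
  sub_eq_zero.1 <| (B.nondegenerate_polarBilin v).1 _ fun y => by
    rw [QuadraticMap.polarBilin_apply_apply, QuadraticMap.polar_sub_left, h, polar_dualVec,
      sub_self]

/-- The vector representing a functional, normalised to length one when it is timelike. -/
def unitVec (f : X v →ₗ[ℝ] ℝ) : X v := (√(B.Q v (B.dualVec v f)))⁻¹ • B.dualVec v f

theorem unitVec_smul {r : ℝ} (hr : 0 < r) (f : X v →ₗ[ℝ] ℝ) :
    B.unitVec v (r • f) = B.unitVec v f := by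
  have h : B.dualVec v (r • f) = r • B.dualVec v f := (B.eq_dualVec v fun y => by
    rw [QuadraticMap.polar_smul_left, polar_dualVec]; rfl).symm
  rw [unitVec, h, QuadraticMap.map_smul, smul_eq_mul, Real.sqrt_mul (mul_self_nonneg r),
    Real.sqrt_mul_self hr.le, smul_smul, unitVec, mul_inv, mul_right_comm,
    inv_mul_cancel₀ hr.ne', one_mul]

variable {B v}

theorem isFutureTimelike_dualVec_chiralTrace (hn : Even n) (hn2 : 2 < n) {σ : ℝ} (hσ : σ * σ = 1)
    {T : Module.End ℂ (S v)} (hT : B.IsPositiveOdd v T) :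
    B.IsFutureTimelike (B.dualVec v (B.chiralTrace v σ T)) := by
  obtain ⟨e, he⟩ := B.exists_isFutureTimelike v
  have hfe : 0 < B.chiralTrace v σ T e := (trace_chiralProj_cliff_pos hn hσ hT he).1
  set f := B.chiralTrace v σ T with hf
  set x := B.dualVec v f with hx
  have hxe : QuadraticMap.polar (B.Q v) x e = f e := B.polar_dualVec v f e
  have hx0 : x ≠ 0 := fun h => hfe.ne' (by rw [← hxe, h, QuadraticMap.polar_zero_left])
  have hreflect : f (QuadraticMap.polar (B.Q v) x e • x - B.Q v x • e) = f e * B.Q v x := by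
    rw [map_sub, map_smul, map_smul, ← B.polar_dualVec v f x, ← hx, QuadraticMap.polar_self, hxe]
    simp only [smul_eq_mul, nsmul_eq_mul]
    ring
  have hQ := chiralTrace_reflection_pos hn hn2 hσ hT hx0 he
  rw [← hf, hreflect] at hQ
  exact (he.isFutureTimelike_iff ((mul_pos_iff_of_pos_left hfe).1 hQ)).2 (hxe ▸ hfe)

theorem isFutureTimelike_unitVec_chiralTrace (hn : Even n) (hn2 : 2 < n) {σ : ℝ} (hσ : σ * σ = 1)
    {T : Module.End ℂ (S v)} (hT : B.IsPositiveOdd v T) :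
    B.IsFutureTimelike (B.unitVec v (B.chiralTrace v σ T)) :=
  have h := isFutureTimelike_dualVec_chiralTrace hn hn2 hσ hT
  h.smul (inv_pos.2 (Real.sqrt_pos.2 h.1))

end DualVectors

section TimeVectors

/-- The timelike vector attached to a positive odd operator `T`: the sum of the unit vectors
representing its chiral traces. Normalising each chirality separately makes it insensitive to
rescalings of `T` by different positive factors on the two chiralities. -/
def timeVec (B : DiscreteSpinorBundle G n X S) (v : V) (T : Module.End ℂ (S v)) : X v :=
  B.unitVec v (B.chiralTrace v 1 T) + B.unitVec v (B.chiralTrace v (-1) T)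

theorem isFutureTimelike_timeVec (hn : Even n) (hn2 : 2 < n) {T : Module.End ℂ (S v)}
    (hT : B.IsPositiveOdd v T) : B.IsFutureTimelike (B.timeVec v T) :=
  (isFutureTimelike_unitVec_chiralTrace hn hn2 (by norm_num) hT).add
    (isFutureTimelike_unitVec_chiralTrace hn hn2 (by norm_num) hT)

theorem exists_chiralProj_mul_eq_smul (hn : Even n) {T T' : Module.End ℂ (S v)}
    (hT : B.χ v * T = -(T * B.χ v)) (hunit : IsUnit T)
    (h : ∀ A, Commute (B.χ v) A → ∃ A', A' * T = T * A ∧ A' * T' = T' * A) {σ : ℝ}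
    (hσ : σ * σ = 1) :
    ∃ c : ℂ, B.chiralProj v σ * T' = c • (B.chiralProj v σ * T) := by
  obtain ⟨T, rfl⟩ := hunit
  set C := (↑T⁻¹ : Module.End ℂ (S v)) * T'
  have hTC : T' = T * C := (T.mul_inv_cancel_left T').symm
  have hcomm {A : Module.End ℂ (S v)} (hA : Commute (B.χ v) A) : Commute C A := by
    obtain ⟨A', hA'T, hA'T'⟩ := h A hA
    refine T.isUnit.mul_left_cancel ?_
    rw [← mul_assoc, ← hTC, ← hA'T', hTC, ← mul_assoc, hA'T, mul_assoc]
  have hP : Commute (B.χ v) (B.chiralProj v (-σ)) := commute_χ_chiralProj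
  obtain ⟨c, hc⟩ := exists_mul_eq_smul_of_commute_compression (C := C) (P := B.chiralProj v (-σ))
    fun A => hcomm (commute_χ_compression hn (by rwa [neg_mul_neg]) A)
  refine ⟨c, ?_⟩
  rw [hTC, ← mul_assoc, chiralProj_mul_odd hT, mul_assoc, ← (hcomm hP).eq, hc, mul_smul_comm]

theorem exists_chiralTrace_eq_smul (hn : Even n) {T T' : Module.End ℂ (S v)}
    (hT : B.IsPositiveOdd v T) (hT' : B.IsPositiveOdd v T') {σ : ℝ} (hσ : σ * σ = 1) {c : ℂ}
    (hc : B.chiralProj v σ * T' = c • (B.chiralProj v σ * T)) :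
    ∃ r : ℝ, 0 < r ∧ B.chiralTrace v σ T' = r • B.chiralTrace v σ T := by
  obtain ⟨e, he⟩ := B.exists_isFutureTimelike v
  have htrace (y : X v) : LinearMap.trace ℂ (S v) (B.chiralProj v σ * T' * B.cliff v y) =
      c * LinearMap.trace ℂ (S v) (B.chiralProj v σ * T * B.cliff v y) := by
    rw [hc, smul_mul_assoc, map_smul, smul_eq_mul]
  obtain ⟨hpos, him⟩ := trace_chiralProj_cliff_pos hn hσ hT he
  obtain ⟨hpos', him'⟩ := trace_chiralProj_cliff_pos hn hσ hT' he
  rw [htrace, Complex.mul_re, him, mul_zero, sub_zero] at hpos'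
  rw [htrace, Complex.mul_im, him, mul_zero, zero_add] at him'
  have hc_im : c.im = 0 := (mul_eq_zero.1 him').resolve_right hpos.ne'
  refine ⟨c.re, (mul_pos_iff_of_pos_right hpos).1 hpos', LinearMap.ext fun y => ?_⟩
  rw [chiralTrace_apply, htrace, Complex.mul_re, hc_im, zero_mul, sub_zero]
  rfl

theorem timeVec_eq (hn : Even n) {T T' : Module.End ℂ (S v)} (hT : B.IsPositiveOdd v T)
    (hT' : B.IsPositiveOdd v T')
    (h : ∀ A, Commute (B.χ v) A → ∃ A', A' * T = T * A ∧ A' * T' = T' * A) :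
    B.timeVec v T = B.timeVec v T' := by
  have hunit {σ : ℝ} (hσ : σ * σ = 1) :
      B.unitVec v (B.chiralTrace v σ T') = B.unitVec v (B.chiralTrace v σ T) := by
    obtain ⟨c, hc⟩ := exists_chiralProj_mul_eq_smul hn hT.odd hT.posDef.isUnit h hσ
    obtain ⟨r, hr, hr'⟩ := exists_chiralTrace_eq_smul hn hT hT' hσ hc
    rw [hr', unitVec_smul _ _ hr]
  rw [timeVec, timeVec, hunit (by norm_num), hunit (by norm_num)]

theorem chiralTrace_of_J (hn : Even n) {T T' : Module.End ℂ (S v)}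
    (h : ∀ ψ, T (B.J v ψ) = -B.J v (T' ψ)) (σ : ℝ) :
    B.chiralTrace v σ T = B.chiralTrace v ((-1) ^ (n / 2 + 1) * σ) T' := by
  ext y
  rw [chiralTrace_apply, chiralTrace_apply, trace_eq_conj_of_antilinear (B.J v) (B.J_injective v)
    (C := B.chiralProj v ((-1) ^ (n / 2 + 1) * σ) * T' * B.cliff v y), Complex.conj_re]
  intro ψ
  have hy : B.cliff v y (B.J v ψ) = -B.J v (B.cliff v y ψ) := by rw [J_cliff, neg_neg]
  simp only [Module.End.mul_apply]
  rw [J_chiralProj hn, hy, map_neg, h, neg_neg]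

theorem timeVec_of_J (hn : Even n) {T T' : Module.End ℂ (S v)}
    (h : ∀ ψ, T (B.J v ψ) = -B.J v (T' ψ)) : B.timeVec v T = B.timeVec v T' := by
  rw [timeVec, timeVec, chiralTrace_of_J hn h, chiralTrace_of_J hn h]
  obtain h | h := neg_one_pow_eq_or ℝ (n / 2 + 1)
  · rw [h, one_mul, one_mul]
  · rw [h, neg_one_mul, neg_one_mul, neg_neg, add_comm]

end TimeVectors

section Intertwiners

variable {w : V} (h : S v ≃ₗ[ℂ] S w)

theorem Q_eq_of_intertwines {x : X v} {y : X w}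
    (hxy : ∀ ψ, h (B.cliff v x ψ) = B.cliff w y (h ψ)) : B.Q w y = B.Q v x := by
  have := B.nontrivial v
  obtain ⟨ψ, hψ⟩ := exists_ne (0 : S v)
  have hsq := B.cliff_cliff_self w y (h ψ)
  rw [← hxy, ← hxy, cliff_cliff_self, map_smul] at hsq
  exact_mod_cast (smul_left_injective ℂ ((map_ne_zero_iff h h.injective).2 hψ) hsq).symm

variable {h} {Λ : X v →ₗ[ℝ] X w} (hΛ : ∀ x ψ, h (B.cliff v x ψ) = B.cliff w (Λ x) (h ψ))
include hΛ

theorem polar_eq_of_intertwines (x y : X v) :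
    QuadraticMap.polar (B.Q w) (Λ x) (Λ y) = QuadraticMap.polar (B.Q v) x y := by
  simp only [QuadraticMap.polar, ← map_add, Q_eq_of_intertwines h (hΛ _)]

theorem surjective_of_intertwines : Function.Surjective Λ := by
  have := B.finiteDimensional_vectors v
  have := B.finiteDimensional_vectors w
  refine (LinearMap.injective_iff_surjective_of_finrank_eq_finrank
    ((B.finrank_vectors v).trans (B.finrank_vectors w).symm)).1 fun x y hxy => ?_
  refine B.cliff_injective v (LinearMap.ext fun ψ => h.injective ?_)
  rw [hΛ, hΛ, hxy]

theorem dualVec_of_intertwines {f : X v →ₗ[ℝ] ℝ} {g : X w →ₗ[ℝ] ℝ} (hfg : ∀ y, g (Λ y) = f y) :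
    B.dualVec w g = Λ (B.dualVec v f) :=
  (B.eq_dualVec w fun y => by
    obtain ⟨y, rfl⟩ := surjective_of_intertwines hΛ y
    rw [polar_eq_of_intertwines hΛ, polar_dualVec, hfg]).symm

theorem unitVec_of_intertwines {f : X v →ₗ[ℝ] ℝ} {g : X w →ₗ[ℝ] ℝ} (hfg : ∀ y, g (Λ y) = f y) :
    B.unitVec w g = Λ (B.unitVec v f) := by
  rw [unitVec, unitVec, dualVec_of_intertwines hΛ hfg, Q_eq_of_intertwines h (hΛ _), map_smul]

theorem chiralTrace_conj (hχ : ∀ ψ, B.χ w (h ψ) = h (B.χ v ψ)) (T : Module.End ℂ (S v)) (σ : ℝ)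
    (y : X v) : B.chiralTrace w σ (h.conj T) (Λ y) = B.chiralTrace v σ T y := by
  rw [chiralTrace_apply, chiralTrace_apply, ← LinearMap.trace_conj' _ h]
  congr 2
  ext ψ
  obtain ⟨φ, rfl⟩ := h.surjective ψ
  simp [LinearEquiv.conj_apply, chiralProj, ← hΛ, hχ, -Complex.coe_smul]

theorem timeVec_conj (hχ : ∀ ψ, B.χ w (h ψ) = h (B.χ v ψ)) (T : Module.End ℂ (S v)) :
    B.timeVec w (h.conj T) = Λ (B.timeVec v T) := by
  rw [timeVec, timeVec, map_add, unitVec_of_intertwines hΛ (chiralTrace_conj hΛ hχ T 1),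
    unitVec_of_intertwines hΛ (chiralTrace_conj hΛ hχ T (-1))]

end Intertwiners

end DiscreteSpinorBundle

/-! ### Even and odd operators -/

theorem mem_span_mul_mul_of_ne_zero {𝕜 M : Type*} [Field 𝕜] [AddCommGroup M] [Module 𝕜 M]
    [FiniteDimensional 𝕜 M] {D : Module.End 𝕜 M} (hD : D ≠ 0) (T : Module.End 𝕜 M) :
    T ∈ Submodule.span 𝕜 (Set.range fun p : Module.End 𝕜 M × Module.End 𝕜 M => p.1 * D * p.2) := by
  obtain ⟨ψ, hψ⟩ : ∃ ψ, D ψ ≠ 0 := by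
    by_contra! h
    exact hD (LinearMap.ext h)
  obtain ⟨l, hl⟩ := Module.Projective.exists_dual_eq_one 𝕜 hψ
  let b := Module.finBasis 𝕜 M
  have hT : T = ∑ i, l.smulRight (T (b i)) * D * (b.coord i).smulRight ψ := by
    refine b.ext fun j => ?_
    simp [LinearMap.sum_apply, Finsupp.single_apply, apply_ite D, apply_ite l, hl]
  rw [hT]
  exact sum_mem fun i _ => Submodule.subset_span ⟨(_, _), rfl⟩

namespace DiscreteSpinorBundle

variable {V E : Type*} {G : WeightedOrientedGraph V E} {n : ℕ} {X S : V → Type*}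
  [∀ v, AddCommGroup (X v)] [∀ v, Module ℝ (X v)]
  [∀ v, AddCommGroup (S v)] [∀ v, Module ℂ (S v)] [∀ v, FiniteDimensional ℂ (S v)]
  {B : DiscreteSpinorBundle G n X S} {v : V}

theorem cliff_mul_cliff_mem_adjoin_χ (hn : n = 2) (x y : X v) :
    B.cliff v x * B.cliff v y ∈ Algebra.adjoin ℂ {B.χ v} := by
  subst hn
  obtain ⟨b, hb, hχ⟩ := B.exists_frame v
  have h01 : B.cliff v (b 0) * B.cliff v (b 1) ∈ Algebra.adjoin ℂ {B.χ v} := by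
    have h : B.cliff v (b 0) * B.cliff v (b 1) = -B.χ v := by
      rw [hχ]
      simp [List.finRange_succ]
    rw [h]
    exact neg_mem (Algebra.self_mem_adjoin_singleton ℂ _)
  have hii (i) : B.cliff v (b i) * B.cliff v (b i) ∈ Algebra.adjoin ℂ {B.χ v} := by
    rw [cliff_mul_self]
    exact Subalgebra.smul_mem _ (one_mem _) _
  have hij (i j) : B.cliff v (b i) * B.cliff v (b j) ∈ Algebra.adjoin ℂ {B.χ v} := by
    fin_cases i <;> fin_cases j
    · exact hii 0
    · exact h01
    · have h10 := (isAnticommutingFamily_cliff hb).anticomm (i := 1) (j := 0) (by simp)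
      exact h10 ▸ neg_mem h01
    · exact hii 1
  rw [B.cliff_eq_sum v b x, B.cliff_eq_sum v b y, Finset.sum_mul_sum]
  refine sum_mem fun i _ => sum_mem fun j _ => ?_
  rw [smul_mul_smul_comm]
  exact Subalgebra.smul_mem _ (hij i j) _

theorem commute_of_eq_two (hn : n = 2) {A A' : Module.End ℂ (S v)}
    (hA : Commute (B.χ v) A) (hA' : Commute (B.χ v) A') : Commute A A' := by
  obtain ⟨a, rfl⟩ := exists_even_of_commute_χ (hn ▸ even_two) hA
  suffices h : B.ρ v a ∈ Algebra.adjoin ℂ {B.χ v} from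
    (Algebra.commute_of_mem_adjoin_singleton_of_commute h hA'.symm).symm
  refine CCl.even_induction (P := fun a => B.ρ v a ∈ Algebra.adjoin ℂ {B.χ v}) ?_
    (fun z a h => ?_) (fun a a' h h' => ?_) (fun x y a h => ?_) a.2
  · rw [map_one]; exact one_mem _
  · rw [map_smul]; exact Subalgebra.smul_mem _ h z
  · rw [map_add]; exact add_mem h h'
  · rw [map_mul, map_mul]; exact mul_mem (cliff_mul_cliff_mem_adjoin_χ hn x y) h

theorem odd_mul_chiralProj_mem_span (hn : Even n) {γ T : Module.End ℂ (S v)}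
    (hγ : B.χ v * γ = -(γ * B.χ v)) (hT : B.χ v * T = -(T * B.χ v)) {σ : ℝ} (hσ : σ * σ = 1)
    {ψ : S v} (hψ : B.χ v ψ = (σ : ℂ) • ψ) (hγψ : γ ψ ≠ 0) :
    T * B.chiralProj v σ ∈ Submodule.span ℂ {T' | ∃ A C, Commute (B.χ v) A ∧
      Commute (B.χ v) C ∧ T' = A * γ * C} := by
  have hσ' : -σ * -σ = 1 := by rwa [neg_mul_neg]
  set P := B.chiralProj v σ
  set P' := B.chiralProj v (-σ)
  have hPP : P * P = P := chiralProj_mul_self hn hσ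
  have hP'T {T : Module.End ℂ (S v)} (hT : B.χ v * T = -(T * B.χ v)) : P' * T = T * P := by
    simpa only [neg_neg] using chiralProj_mul_odd hT (σ := -σ)
  have hPψ : P ψ = ψ := chiralProj_apply_of_eigen hσ hψ
  have hγP : γ * P ≠ 0 := fun h => hγψ <| by simpa [hPψ] using LinearMap.congr_fun h ψ
  have hcompress : T * P = P' * T * P := by rw [hP'T hT, mul_assoc, hPP]
  rw [hcompress]
  clear hcompress hT
  induction mem_span_mul_mul_of_ne_zero hγP T using Submodule.span_induction with
  | zero => simp
  | add T T' _ _ h h' => simpa only [mul_add, add_mul] using add_mem h h'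
  | smul z T _ h => simpa only [mul_smul_comm, smul_mul_assoc] using Submodule.smul_mem _ z h
  | mem T h =>
    obtain ⟨⟨A, C⟩, rfl⟩ := h
    refine Submodule.subset_span ⟨P' * A * P', P * C * P, commute_χ_compression hn hσ' A,
      commute_χ_compression hn hσ C, ?_⟩
    have h : P' * γ * P = γ * P := by rw [hP'T hγ, mul_assoc, hPP]
    calc P' * (A * (γ * P) * C) * P = P' * A * (γ * P) * C * P := by simp only [mul_assoc]
      _ = P' * A * (P' * γ * P) * C * P := by rw [h]
      _ = P' * A * P' * γ * (P * C * P) := by simp only [mul_assoc]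

theorem odd_mem_span (hn : Even n) {γ T : Module.End ℂ (S v)} (hγ : B.χ v * γ = -(γ * B.χ v))
    (hT : B.χ v * T = -(T * B.χ v)) (hl : ∃ ψ, B.χ v ψ = -ψ ∧ γ ψ ≠ 0)
    (hr : ∃ ψ, B.χ v ψ = ψ ∧ γ ψ ≠ 0) :
    T ∈ Submodule.span ℂ {T' | ∃ A C, Commute (B.χ v) A ∧ Commute (B.χ v) C ∧
      T' = A * γ * C} := by
  obtain ⟨ψ, hψ, hψ0⟩ := hl
  obtain ⟨φ, hφ, hφ0⟩ := hr
  have h := chiralProj_add_neg (B := B) (v := v) (σ := 1)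
  rw [← mul_one T, ← h, mul_add]
  exact add_mem
    (odd_mul_chiralProj_mem_span hn hγ hT (by norm_num) (by rw [hφ]; simp) hφ0)
    (odd_mul_chiralProj_mem_span hn hγ hT (by norm_num) (by rw [hψ]; simp) hψ0)

end DiscreteSpinorBundle

/-! ### Off-diagonal operators -/

namespace WeightedOrientedGraph

variable {V E : Type*} {G : WeightedOrientedGraph V E}

theorem endpt_ne_endpt_not (e : E) (b : Bool) : G.endpt e b ≠ G.endpt e (!b) := by
  cases b
  · exact G.loopless e
  · exact (G.loopless e).symm

theorem eq_of_endpt_eq {p q : E × Bool} (h : G.endpt p.1 p.2 = G.endpt q.1 q.2)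
    (h' : G.endpt p.1 (!p.2) = G.endpt q.1 (!q.2)) : p = q := by
  have hends (p : E × Bool) :
      s(G.src p.1, G.tgt p.1) = s(G.endpt p.1 p.2, G.endpt p.1 (!p.2)) := by
    rcases p with ⟨e, _ | _⟩
    · rfl
    · exact Sym2.eq_swap
  obtain ⟨e, b⟩ := p
  obtain ⟨e', b'⟩ := q
  obtain rfl : e = e' := G.simple <|
    (hends (e, b)).trans <| (congrArg₂ (fun v w => s(v, w)) h h').trans (hends (e', b')).symm
  obtain rfl | rfl := Bool.eq_or_eq_not b b'
  · rfl
  · exact absurd h.symm (endpt_ne_endpt_not e b')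

theorem exists_endpt_eq [Nonempty E] (hG : G.Connected) (v : V) :
    ∃ p : E × Bool, G.endpt p.1 p.2 = v := by
  obtain ⟨e⟩ := ‹Nonempty E›
  obtain ⟨w⟩ := hG (G.src e) v
  cases w with
  | nil => exact ⟨(e, false), rfl⟩
  | fwd e' _ => exact ⟨(e', true), rfl⟩
  | bwd e' _ => exact ⟨(e', false), rfl⟩

end WeightedOrientedGraph

namespace DiscreteSpinorBundle

variable {V E : Type*} {G : WeightedOrientedGraph V E} {n : ℕ} {X S : V → Type*}
  [∀ v, AddCommGroup (X v)] [∀ v, Module ℝ (X v)]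
  [∀ v, AddCommGroup (S v)] [∀ v, Module ℂ (S v)] [∀ v, FiniteDimensional ℂ (S v)]

section Transport

variable {B : DiscreteSpinorBundle G n X S}

theorem IsMetric.krein_hpm (hB : B.IsMetric) (e : E) (b : Bool) (ψ φ : S (G.endpt e (!b))) :
    B.krein _ (B.hpm e b ψ) (B.hpm e b φ) = B.krein _ ψ φ := by
  have hsymm (ψ φ : S (G.tgt e)) :
      B.krein (G.src e) ((B.h e).symm ψ) ((B.h e).symm φ) = B.krein (G.tgt e) ψ φ := by
    rw [← hB e, LinearEquiv.apply_symm_apply, LinearEquiv.apply_symm_apply]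
  cases b
  · exact hsymm ψ φ
  · exact hB e ψ φ

theorem PreservesOrientation.χ_hpm (hB : B.PreservesOrientation) (e : E) (b : Bool)
    (ψ : S (G.endpt e (!b))) : B.χ _ (B.hpm e b ψ) = B.hpm e b (B.χ _ ψ) := by
  have hsymm (φ : S (G.tgt e)) :
      B.χ (G.src e) ((B.h e).symm φ) = (B.h e).symm (B.χ (G.tgt e) φ) := by
    rw [LinearEquiv.eq_symm_apply, ← hB, LinearEquiv.apply_symm_apply]
  cases b
  · exact hsymm ψ
  · exact hB e ψ

theorem IsSpinPreserving.J_hpm (hB : B.IsSpinPreserving) (e : E) (b : Bool)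
    (ψ : S (G.endpt e (!b))) : B.J _ (B.hpm e b ψ) = B.hpm e b (B.J _ ψ) := by
  have hsymm (φ : S (G.tgt e)) :
      B.J (G.src e) ((B.h e).symm φ) = (B.h e).symm (B.J (G.tgt e) φ) := by
    rw [LinearEquiv.eq_symm_apply, hB, LinearEquiv.apply_symm_apply]
  cases b
  · exact hsymm ψ
  · exact (hB e ψ).symm

theorem PreservesOrientation.commute_χ_conj (hB : B.PreservesOrientation) {e : E} {b : Bool}
    {A : Module.End ℂ (S (G.endpt e (!b)))} (hA : Commute (B.χ _) A) :
    Commute (B.χ _) ((B.hpm e b).conj A) := by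
  refine LinearMap.ext fun ψ => ?_
  obtain ⟨φ, rfl⟩ := (B.hpm e b).surjective ψ
  simpa only [Module.End.mul_apply, LinearEquiv.conj_apply_apply, LinearEquiv.symm_apply_apply,
    hB.χ_hpm] using congrArg (B.hpm e b) (LinearMap.congr_fun hA.eq φ)

end Transport

variable (B : DiscreteSpinorBundle G n X S)

/-- Parallel transport of the value at each end of an edge to the other end. -/
def swap : Module.End ℂ B.Sections where
  toFun F p := B.hpm p.1 p.2 (F (p.1, !p.2))
  map_add' F F' := by ext p; simp
  map_smul' c F := by ext p; simp

theorem swap_apply (F : B.Sections) (p : E × Bool) :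
    B.swap F p = B.hpm p.1 p.2 (F (p.1, !p.2)) := rfl

@[simp]
theorem swap_swap (F : B.Sections) : B.swap (B.swap F) = F := by
  ext ⟨e, b⟩
  cases b
  · exact (B.h e).symm_apply_apply _
  · exact (B.h e).apply_symm_apply _

/-- Families of operators on the fibres over the split graph. -/
abbrev EdgeOperators (_B : DiscreteSpinorBundle G n X S) : Type _ :=
  ∀ p : E × Bool, Module.End ℂ (S (G.endpt p.1 p.2))

/-- The off-diagonal operators `F(e,±) ↦ T_e^± h_e^± F(e,∓)`, of which the Dirac operator and all
one-forms are instances. -/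
def offDiag : B.EdgeOperators →ₗ[ℂ] Module.End ℂ B.Sections where
  toFun T :=
    { toFun := fun F p => T p (B.swap F p)
      map_add' := fun F F' => by ext p; simp
      map_smul' := fun c F => by ext p; simp }
  map_add' T T' := rfl
  map_smul' c T := rfl

theorem offDiag_apply (T : B.EdgeOperators) (F : B.Sections) (p : E × Bool) :
    B.offDiag T F p = T p (B.swap F p) := rfl

theorem splitRep_apply (a : B.EvenSections) (F : B.Sections) (p : E × Bool) :
    B.splitRep a F p = B.ρ _ (a (G.endpt p.1 p.2) : CCl (B.Q _)) (F p) := rfl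

theorem swap_splitJ (F : B.Sections) (p : E × Bool) : B.swap (B.splitJ F) p = B.J _ (F p) :=
  congrFun (B.swap_swap fun p => B.J _ (F p)) p

variable {B} {T : B.EdgeOperators}

theorem offDiag_injective : Function.Injective B.offDiag := fun T T' h => by
  classical
  refine funext fun p => LinearMap.ext fun ψ => ?_
  simpa [offDiag_apply] using congrFun (LinearMap.congr_fun h (B.swap (Pi.single p ψ))) p

theorem PreservesOrientation.swap_splitChirality (hB : B.PreservesOrientation) (F : B.Sections)
    (p : E × Bool) : B.swap (B.splitChirality F) p = B.χ _ (B.swap F p) :=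
  (hB.χ_hpm p.1 p.2 _).symm

theorem IsSpinPreserving.splitJ_apply (hB : B.IsSpinPreserving) (F : B.Sections) (p : E × Bool) :
    B.splitJ F p = B.J _ (B.swap F p) := (hB.J_hpm p.1 p.2 _).symm

section Krein

variable [Fintype E]

theorem splitKrein_eq (F F' : B.Sections) :
    B.splitKrein F F' = ∑ p : E × Bool, B.krein _ (F p) (B.swap F' p) := by
  rw [Fintype.sum_prod_type]
  simp only [Fintype.sum_bool]
  rfl

namespace IsMetric

variable (hB : B.IsMetric)
include hB

theorem splitKrein_eq_sum_swap (F F' : B.Sections) :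
    B.splitKrein F F' = ∑ p : E × Bool, B.krein _ (B.swap F p) (F' p) := by
  rw [splitKrein_eq, ← ((Equiv.refl E).prodCongr Equiv.boolNot).sum_comp]
  refine Finset.sum_congr rfl fun p _ => ?_
  conv_rhs => rw [← B.swap_swap F']
  exact (hB.krein_hpm p.1 p.2 (F (p.1, !p.2)) (B.swap F' (p.1, !p.2))).symm

theorem isKreinProduct_splitKrein : IsKreinProduct B.splitKrein where
  hermitian F F' := by
    rw [hB.splitKrein_eq_sum_swap, splitKrein_eq, map_sum]
    exact Finset.sum_congr rfl fun p _ => (B.isKrein _).hermitian _ _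
  nondegenerate F' h := by
    classical
    refine funext fun p => (B.isKrein _).nondegenerate _ fun ψ => ?_
    have := h (B.swap (Pi.single p ψ))
    rwa [hB.splitKrein_eq_sum_swap, swap_swap, Finset.sum_eq_single p _ (by simp),
      Pi.single_eq_same] at this
    exact fun q _ hq => by rw [Pi.single_eq_of_ne hq, map_zero, LinearMap.zero_apply]

variable (T)

theorem splitKrein_offDiag (F F' : B.Sections) :
    B.splitKrein F (B.offDiag T F') =
      ∑ p : E × Bool, B.krein _ (B.swap F p) (T p (B.swap F' p)) :=
  hB.splitKrein_eq_sum_swap F (B.offDiag T F')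

theorem splitKrein_offDiag_single [DecidableEq E] (p : E × Bool) (F : B.Sections)
    (φ : S (G.endpt p.1 p.2)) :
    B.splitKrein F (B.offDiag T (B.swap (Pi.single p φ))) = B.krein _ (B.swap F p) (T p φ) := by
  rw [hB.splitKrein_offDiag, swap_swap, Finset.sum_eq_single p _ (by simp), Pi.single_eq_same]
  exact fun q _ hq => by rw [Pi.single_eq_of_ne hq, map_zero, map_zero]

variable {T}

theorem isAdjointFor_offDiag_iff :
    IsAdjointFor (fun F F' => B.splitKrein F F') (B.offDiag T) (B.offDiag T) ↔
      ∀ p, IsAdjointFor (fun ψ φ => B.krein _ ψ φ) (T p) (T p) := by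
  classical
  refine ⟨fun h p ψ φ => ?_, fun h F F' => ?_⟩
  · have := h (B.swap (Pi.single p ψ)) (B.swap (Pi.single p φ))
    simp only [hB.splitKrein_offDiag_single, swap_swap, Pi.single_eq_same] at this ⊢
    rw [← this, hB.isKreinProduct_splitKrein.hermitian, hB.splitKrein_offDiag_single, swap_swap,
      Pi.single_eq_same, ← (B.isKrein _).hermitian]
  · simp only [hB.splitKrein_offDiag]
    rw [splitKrein_eq]
    exact Finset.sum_congr rfl fun p _ => h p _ _

theorem isPosDefWith_offDiag_iff :
    IsPosDefWith B.splitKrein (B.offDiag T) ↔ ∀ p, IsPosDefWith (B.krein _) (T p) := by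
  classical
  refine ⟨fun h p ψ hψ => ?_, fun h F hF => ?_⟩
  · have h0 : B.swap (Pi.single p ψ) ≠ 0 := fun h0 => hψ <| by
      simpa [h0] using (congrFun (B.swap_swap (Pi.single p ψ)) p).symm
    simpa only [hB.splitKrein_offDiag_single, swap_swap, Pi.single_eq_same] using h _ h0
  · obtain ⟨p, hp⟩ : ∃ p, B.swap F p ≠ 0 := by
      by_contra! h0
      exact hF (by rw [← B.swap_swap F, show B.swap F = 0 from funext h0, map_zero])
    rw [hB.splitKrein_offDiag, Complex.re_sum, Complex.im_sum]
    exact ⟨Finset.sum_pos' (fun q _ => ((h q).nonneg _).1) ⟨p, Finset.mem_univ p, (h p _ hp).1⟩,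
      Finset.sum_eq_zero fun q _ => ((h q).nonneg _).2⟩

end IsMetric

end Krein

section RealStructure

/-- The relation `h_e^± J T_e^∓ = s T_e^± J h_e^±`, expressing that the off-diagonal operator of `T`
commutes with the charge conjugation up to the sign `s`. -/
def IsJReal (s : ℂ) (T : B.EdgeOperators) : Prop :=
  ∀ p ψ, B.hpm p.1 p.2 (B.J _ (T (p.1, !p.2) ψ)) = s • T p (B.J _ (B.hpm p.1 p.2 ψ))

theorem splitJ_offDiag_iff {s : ℂ} :
    (∀ F, B.splitJ (B.offDiag T F) = s • B.offDiag T (B.splitJ F)) ↔ IsJReal s T := by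
  classical
  have hentry (F : B.Sections) (p : E × Bool) :
      B.splitJ (B.offDiag T F) p = (s • B.offDiag T (B.splitJ F)) p ↔
        B.hpm p.1 p.2 (B.J _ (T (p.1, !p.2) (B.swap F (p.1, !p.2)))) =
          s • T p (B.J _ (B.hpm p.1 p.2 (B.swap F (p.1, !p.2)))) := by
    rw [Pi.smul_apply, offDiag_apply, swap_splitJ, ← B.swap_apply, swap_swap]
    rfl
  refine ⟨fun h p ψ => ?_, fun h F => funext fun p => (hentry F p).2 (h p _)⟩
  have hψ := (hentry _ p).1 (congrFun (h (B.swap (Pi.single (p.1, !p.2) ψ))) p)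
  rwa [swap_swap, Pi.single_eq_same] at hψ

theorem IsSpinPreserving.isJReal_neg_one (hB : B.IsSpinPreserving)
    (h : ∀ e (ψ : S (G.tgt e)),
      B.J _ (T (e, true) ψ) = -B.h e (T (e, false) ((B.h e).symm (B.J _ ψ)))) :
    IsJReal (-1) T := by
  rintro ⟨e, b⟩ ψ
  have hentry (T₁ : Module.End ℂ (S (G.tgt e))) (T₀ : Module.End ℂ (S (G.src e)))
      (h : ∀ ψ, B.J _ (T₁ ψ) = -B.h e (T₀ ((B.h e).symm (B.J _ ψ)))) :
      (∀ ψ, (B.h e).symm (B.J _ (T₁ ψ)) = (-1 : ℂ) • T₀ (B.J _ ((B.h e).symm ψ))) ∧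
      ∀ ψ, B.h e (B.J _ (T₀ ψ)) = (-1 : ℂ) • T₁ (B.J _ (B.h e ψ)) := by
    refine ⟨fun ψ => ?_, fun ψ => B.J_injective _ ?_⟩
    · rw [h, map_neg, LinearEquiv.symm_apply_apply, neg_one_smul]
      exact congrArg (-T₀ ·) (hB.J_hpm e false ψ).symm
    · rw [neg_one_smul, map_neg, h, neg_neg, B.J_sq, ← hB, B.J_sq, map_smul, map_smul, map_smul,
        map_smul, LinearEquiv.symm_apply_apply]
  cases b
  · exact (hentry _ _ (h e)).1 ψ
  · exact (hentry _ _ (h e)).2 ψ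

end RealStructure

end DiscreteSpinorBundle

/-! ### One-forms -/

namespace WeightedOrientedGraph

variable {V E : Type*} (G : WeightedOrientedGraph V E)

/-- The coefficients `∓1/δ_e` of the Dirac operator. -/
def diracCoeff (p : E × Bool) : ℂ := (if p.2 then -1 else 1) / (G.weight p.1 : ℂ)

theorem diracCoeff_ne_zero (p : E × Bool) : G.diracCoeff p ≠ 0 :=
  div_ne_zero (by split_ifs <;> simp) (Complex.ofReal_ne_zero.2 (G.weight_pos p.1).ne')

theorem conj_diracCoeff (p : E × Bool) : conj (G.diracCoeff p) = G.diracCoeff p := by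
  rw [diracCoeff, map_div₀, Complex.conj_ofReal]
  split_ifs <;> simp

theorem diracCoeff_not (e : E) (b : Bool) : G.diracCoeff (e, !b) = -G.diracCoeff (e, b) := by
  cases b <;> simp [diracCoeff, neg_div]

end WeightedOrientedGraph

namespace DiscreteSpinorBundle

variable {V E : Type*} {G : WeightedOrientedGraph V E} {n : ℕ} {X S : V → Type*}
  [∀ v, AddCommGroup (X v)] [∀ v, Module ℝ (X v)]
  [∀ v, AddCommGroup (S v)] [∀ v, Module ℂ (S v)] [∀ v, FiniteDimensional ℂ (S v)]
  {B : DiscreteSpinorBundle G n X S} {T : B.EdgeOperators}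

theorem splitDirac_eq_offDiag :
    B.splitDirac = B.offDiag fun p => G.diracCoeff p • B.γ p.1 p.2 := rfl

variable (B) in
/-- Families of operators anticommuting with the chirality operators. -/
def oddFamilies : Submodule ℂ B.EdgeOperators where
  carrier := {T | ∀ p, B.χ _ * T p = -(T p * B.χ _)}
  add_mem' hT hT' p := by rw [Pi.add_apply, mul_add, hT p, hT' p, add_mul, neg_add]
  zero_mem' p := by simp
  smul_mem' c T hT p := by rw [Pi.smul_apply, mul_smul_comm, hT p, smul_mul_assoc, smul_neg]

theorem mul_odd_mul {v : V} {A T C : Module.End ℂ (S v)} (hA : Commute (B.χ v) A)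
    (hT : B.χ v * T = -(T * B.χ v)) (hC : Commute (B.χ v) C) :
    B.χ v * (A * T * C) = -(A * T * C * B.χ v) := by
  have hT' : SemiconjBy (B.χ v) T (-T) := hT.trans (neg_mul _ _).symm
  simpa [SemiconjBy] using ((show SemiconjBy (B.χ v) A A from hA).mul_right hT').mul_right hC

theorem splitRep_mul_offDiag (a : B.EvenSections) (T : B.EdgeOperators) :
    B.splitRep a * B.offDiag T =
      B.offDiag fun p => B.ρ _ (a (G.endpt p.1 p.2) : CCl (B.Q _)) * T p := rfl

theorem offDiag_mul_splitRep (T : B.EdgeOperators) (a : B.EvenSections) :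
    B.offDiag T * B.splitRep a = B.offDiag fun p =>
      T p * (B.hpm p.1 p.2).conj (B.ρ _ (a (G.endpt p.1 (!p.2)) : CCl (B.Q _))) := by
  refine LinearMap.ext fun F => funext fun p => congrArg (T p) ?_
  exact congrArg (fun ψ => B.hpm p.1 p.2 (B.ρ _ (a (G.endpt p.1 (!p.2)) : CCl (B.Q _)) ψ))
    ((B.hpm p.1 p.2).symm_apply_apply (F (p.1, !p.2))).symm

theorem splitRep_mul_commutator (a b : B.EvenSections) :
    B.splitRep a * (B.splitDirac * B.splitRep b - B.splitRep b * B.splitDirac) =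
      B.offDiag fun p => G.diracCoeff p • (B.ρ _ (a (G.endpt p.1 p.2) : CCl (B.Q _)) *
        (B.γ p.1 p.2 * (B.hpm p.1 p.2).conj (B.ρ _ (b (G.endpt p.1 (!p.2)) : CCl (B.Q _))) -
          B.ρ _ (b (G.endpt p.1 p.2) : CCl (B.Q _)) * B.γ p.1 p.2)) := by
  rw [splitDirac_eq_offDiag, offDiag_mul_splitRep, splitRep_mul_offDiag, ← map_sub,
    splitRep_mul_offDiag]
  congr 1
  funext p
  rw [Pi.sub_apply, smul_mul_assoc, mul_smul_comm, ← smul_sub, mul_smul_comm]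

namespace IsSpectral

variable [Fintype E] (hB : B.IsSpectral) (hn : Even n)
include hB hn

theorem oneForms_le_map_offDiag :
    B.splitDiracStructure.oneForms ≤ B.oddFamilies.map B.offDiag := by
  refine Submodule.span_le.2 ?_
  rintro _ ⟨a, b, rfl⟩
  refine ⟨_, fun p => ?_, (splitRep_mul_commutator a b).symm⟩
  have heven (a : B.EvenSections) (v : V) := commute_χ_ρ_of_mem_even hn (a v).2
  have hodd := hB.γ_odd p.1 p.2
  have h₁ := mul_odd_mul (heven a _) hodd
    (hB.preservesOrientation.commute_χ_conj (heven b (G.endpt p.1 (!p.2))))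
  have h₂ := mul_odd_mul ((heven a _).mul_right (heven b (G.endpt p.1 p.2))) hodd
    (Commute.one_right _)
  rw [mul_one] at h₂
  rw [mul_smul_comm, smul_mul_assoc, ← smul_neg, mul_sub, ← mul_assoc _ (B.γ p.1 p.2),
    ← mul_assoc _ _ (B.γ p.1 p.2), mul_sub, sub_mul, neg_sub', h₁, h₂]

theorem offDiag_single_mem_oneForms [DecidableEq E] (p : E × Bool)
    {A C : Module.End ℂ (S (G.endpt p.1 p.2))} (hA : Commute (B.χ _) A)
    (hC : Commute (B.χ _) C) :
    B.offDiag (Pi.single p (A * B.γ p.1 p.2 * C)) ∈ B.splitDiracStructure.oneForms := by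
  classical
  have hC' : Commute (B.χ _) ((B.hpm p.1 p.2).symm.conj C) := by
    refine LinearMap.ext fun ψ => (B.hpm p.1 p.2).injective ?_
    simpa only [Module.End.mul_apply, LinearEquiv.conj_apply_apply, LinearEquiv.symm_symm,
      ← hB.preservesOrientation.χ_hpm, LinearEquiv.apply_symm_apply]
      using LinearMap.congr_fun hC (B.hpm p.1 p.2 ψ)
  obtain ⟨a, rfl⟩ := exists_even_of_commute_χ hn hA
  obtain ⟨b, hb⟩ := exists_even_of_commute_χ hn hC'
  refine (Submodule.smul_mem_iff _ (G.diracCoeff_ne_zero p)).1 (Submodule.subset_span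
    ⟨Pi.single (G.endpt p.1 p.2) a, Pi.single (G.endpt p.1 (!p.2)) b, ?_⟩)
  refine Eq.trans ?_ (splitRep_mul_commutator _ _).symm
  rw [← map_smul]
  congr 1
  funext q
  obtain rfl | hqp := eq_or_ne q p
  · have hCC : (B.hpm q.1 q.2).conj ((B.hpm q.1 q.2).symm.conj C) = C := by
      ext ψ; simp [LinearEquiv.conj_apply]
    simp [hb, hCC, mul_assoc, G.endpt_ne_endpt_not q.1 q.2]
  · rw [Pi.smul_apply, Pi.single_eq_of_ne hqp]
    by_cases h : G.endpt q.1 q.2 = G.endpt p.1 p.2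
    · have h₁ : G.endpt q.1 (!q.2) ≠ G.endpt p.1 (!p.2) := fun h' =>
        hqp (G.eq_of_endpt_eq h h')
      have h₂ : G.endpt q.1 q.2 ≠ G.endpt p.1 (!p.2) := h ▸ G.endpt_ne_endpt_not p.1 p.2
      simp [Pi.single_eq_of_ne h₁, Pi.single_eq_of_ne h₂]
    · simp [Pi.single_eq_of_ne h]

theorem map_offDiag_le_oneForms :
    B.oddFamilies.map B.offDiag ≤ B.splitDiracStructure.oneForms := by
  classical
  rintro _ ⟨T, hT, rfl⟩
  rw [← Finset.univ_sum_single T, map_sum]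
  refine sum_mem fun p _ => ?_
  have hspan := odd_mem_span hn (hB.γ_odd p.1 p.2) (hT p) (hB.γ_left p.1 p.2) (hB.γ_right p.1 p.2)
  refine (Submodule.span_le (p := B.splitDiracStructure.oneForms.comap
    (B.offDiag ∘ₗ LinearMap.single ℂ _ p))).2 ?_ hspan
  rintro _ ⟨A, C, hA, hC, rfl⟩
  exact hB.offDiag_single_mem_oneForms hn p hA hC

theorem oneForms_eq : B.splitDiracStructure.oneForms = B.oddFamilies.map B.offDiag :=
  (hB.oneForms_le_map_offDiag hn).antisymm (hB.map_offDiag_le_oneForms hn)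

end IsSpectral

end DiscreteSpinorBundle

/-! ### Positive time-orientation forms -/

theorem exists_isAntilorentzianKOSigns {ε ε'' : ℂ} (hε : ε = 1 ∨ ε = -1)
    (hε'' : ε'' = 1 ∨ ε'' = -1) : ∃ k, IsAntilorentzianKOSigns k ε ε'' (-1) := by
  rcases hε with rfl | rfl <;> rcases hε'' with rfl | rfl
  · exact ⟨0, .inr (.inl ⟨rfl, rfl, rfl, rfl⟩)⟩
  · exact ⟨6, .inr (.inr (.inl ⟨rfl, rfl, rfl, rfl⟩))⟩
  · exact ⟨4, .inr (.inr (.inr ⟨rfl, rfl, rfl, rfl⟩))⟩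
  · exact ⟨2, .inl ⟨rfl, rfl, rfl, rfl⟩⟩

namespace DiscreteSpinorBundle

variable {V E : Type*} {G : WeightedOrientedGraph V E} {n : ℕ} {X S : V → Type*}
  [∀ v, AddCommGroup (X v)] [∀ v, Module ℝ (X v)]
  [∀ v, AddCommGroup (S v)] [∀ v, Module ℂ (S v)] [∀ v, FiniteDimensional ℂ (S v)]
  {B : DiscreteSpinorBundle G n X S}

variable (B) in
theorem ε_mul_self : B.ε * B.ε = 1 := by
  rcases B.ε_sign with h | h <;> simp [h]

variable (B) in
theorem krein_J (v : V) (ψ φ : S v) :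
    B.krein v (B.J v ψ) φ = conj (B.krein v ψ (-B.ε • B.J v φ)) := by
  obtain ⟨J', hJ', hJJ'⟩ := B.J_adjoint v
  have hJφ : B.J v φ = -(B.ε • J' φ) := by rw [← B.J_sq, hJJ', map_neg, neg_neg]
  rw [hJ', hJφ, smul_neg, neg_smul, neg_neg, smul_smul, B.ε_mul_self, one_smul]

namespace IsSpectral

variable (hB : B.IsSpectral)
include hB

theorem splitJ_splitJ (F : B.Sections) : B.splitJ (B.splitJ F) = B.ε • F :=
  funext fun p => by rw [hB.spinPreserving.splitJ_apply, swap_splitJ, B.J_sq, Pi.smul_apply]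

theorem isJReal_dirac :
    IsJReal 1 (B := B) fun p => G.diracCoeff p • B.γ p.1 p.2 := fun p ψ => by
  have hγ : IsJReal (-1) (B := B) fun p => B.γ p.1 p.2 :=
    hB.spinPreserving.isJReal_neg_one hB.γ_real
  obtain ⟨e, b⟩ := p
  have hγψ := hγ (e, b) ψ
  simp only [neg_one_smul] at hγψ
  simp only [LinearMap.smul_apply, G.diracCoeff_not, neg_smul, LinearMap.neg_apply, map_neg,
    LinearMap.map_smulₛₗ, G.conj_diracCoeff, map_smul, hγψ, smul_neg, neg_neg, one_smul]

theorem splitChirality_mul_splitDirac :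
    B.splitChirality * B.splitDirac = -(B.splitDirac * B.splitChirality) := by
  refine LinearMap.ext fun F => funext fun p => ?_
  have hodd : B.χ _ * (G.diracCoeff p • B.γ p.1 p.2) =
      -(G.diracCoeff p • B.γ p.1 p.2 * B.χ _) :=
    B.oddFamilies.smul_mem (G.diracCoeff p) (fun p => hB.γ_odd p.1 p.2) p
  rw [LinearMap.neg_apply, Pi.neg_apply, Module.End.mul_apply, Module.End.mul_apply,
    splitDirac_eq_offDiag, offDiag_apply, hB.preservesOrientation.swap_splitChirality]
  exact LinearMap.congr_fun hodd (B.swap F p)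

variable [Fintype E]

theorem splitKrein_splitJ (F F' : B.Sections) :
    B.splitKrein (B.splitJ F) F' = conj (B.splitKrein F (-B.ε • B.splitJ F')) := by
  have hswap (p : E × Bool) : B.swap (-B.ε • B.splitJ F') p = -B.ε • B.J _ (F' p) := by
    rw [map_smul, Pi.smul_apply, swap_splitJ]
  rw [hB.metric.splitKrein_eq_sum_swap, splitKrein_eq, map_sum]
  refine Finset.sum_congr rfl fun p _ => ?_
  rw [swap_splitJ, hswap, krein_J]

theorem isAdjointFor_splitDirac :
    IsAdjointFor (fun F F' => B.splitKrein F F') B.splitDirac B.splitDirac := by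
  rw [splitDirac_eq_offDiag, hB.metric.isAdjointFor_offDiag_iff]
  intro p ψ φ
  have hγ : B.krein _ (B.γ p.1 p.2 ψ) φ = B.krein _ ψ (B.γ p.1 p.2 φ) :=
    hB.γ_selfAdjoint p.1 p.2 ψ φ
  simp only [LinearMap.smul_apply, LinearMap.map_smulₛₗ, map_smul, G.conj_diracCoeff, hγ]

theorem isAdjointFor_splitChirality (hn : Even n) :
    IsAdjointFor (fun F F' => B.splitKrein F F') B.splitChirality (-B.splitChirality) := by
  intro F F'
  simp only [splitKrein_eq]
  refine Finset.sum_congr rfl fun p _ => ?_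
  rw [LinearMap.neg_apply, map_neg, Pi.neg_apply, hB.preservesOrientation.swap_splitChirality]
  exact χ_adjoint hn (F p) (B.swap F' p)

theorem exists_isAntilorentzianSpacetime (hn : Even n)
    (hβ : ∃ β, B.splitDiracStructure.IsPositiveTimeOrientation β) :
    ∃ k, B.splitDiracStructure.IsAntilorentzianSpacetime k := by
  obtain ⟨k, hk⟩ :=
    exists_isAntilorentzianKOSigns B.ε_sign (neg_one_pow_eq_or ℂ (n / 2 + 1))
  exact ⟨k,
    { krein := hB.metric.isKreinProduct_splitKrein
      D_selfAdjoint := hB.isAdjointFor_splitDirac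
      χ_sq := LinearMap.ext fun F => funext fun p => LinearMap.congr_fun (χ_mul_self hn) (F p)
      χ_comm := fun a => LinearMap.ext fun F => funext fun p =>
        (LinearMap.congr_fun (commute_χ_ρ_of_mem_even hn (a (G.endpt p.1 p.2)).2) (F p)).symm
      χ_D := hB.splitChirality_mul_splitDirac
      χ_adjoint := hB.isAdjointFor_splitChirality hn
      J_spec := by
        refine ⟨B.ε, (-1) ^ (n / 2 + 1), -1, hk, hB.splitJ_splitJ, fun F => ?_,
          fun F => funext fun p => ?_, -B.ε • B.splitJ, hB.splitKrein_splitJ, fun F => ?_⟩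
        · exact (splitJ_offDiag_iff.2 hB.isJReal_dirac F).trans (one_smul ℂ _)
        · change B.splitJ (B.splitChirality F) p = (-1 : ℂ) ^ (n / 2 + 1) • B.χ _ (B.splitJ F p)
          rw [hB.spinPreserving.splitJ_apply, hB.preservesOrientation.swap_splitChirality,
            hB.spinPreserving.splitJ_apply, J_χ hn]
        · change -B.ε • B.splitJ (B.splitJ F) = (-1 : ℂ) • F
          rw [hB.splitJ_splitJ, smul_smul, neg_mul, B.ε_mul_self]
      exists_orientation := hβ }⟩

end IsSpectral

end DiscreteSpinorBundle

section Inverse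

variable {K : Type*} [AddCommGroup K] [Module ℂ K] {B : K →ₗ⋆[ℂ] K →ₗ[ℂ] ℂ}
  {β : (Module.End ℂ K)ˣ}

theorem IsAdjointFor.inv (hβ : IsAdjointFor (fun ψ φ => B ψ φ) (β : Module.End ℂ K) β) :
    IsAdjointFor (fun ψ φ => B ψ φ) (↑β⁻¹ : Module.End ℂ K) (↑β⁻¹ : Module.End ℂ K) := by
  have hββ (ψ : K) : (β : Module.End ℂ K) ((↑β⁻¹ : Module.End ℂ K) ψ) = ψ :=
    LinearMap.congr_fun β.mul_inv ψ
  intro ψ φ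
  simpa only [hββ] using
    (hβ ((↑β⁻¹ : Module.End ℂ K) ψ) ((↑β⁻¹ : Module.End ℂ K) φ)).symm

theorem IsPosDefWith.inv (hβ : IsAdjointFor (fun ψ φ => B ψ φ) (β : Module.End ℂ K) β)
    (hpos : IsPosDefWith B (β : Module.End ℂ K)) : IsPosDefWith B (↑β⁻¹ : Module.End ℂ K) := by
  intro ψ hψ
  obtain ⟨φ, rfl⟩ : ∃ φ, (β : Module.End ℂ K) φ = ψ :=
    ⟨_, LinearMap.congr_fun β.mul_inv ψ⟩
  have hinv : (↑β⁻¹ : Module.End ℂ K) ((β : Module.End ℂ K) φ) = φ :=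
    LinearMap.congr_fun β.inv_mul φ
  have hφ : φ ≠ 0 := fun h => hψ (by rw [h, map_zero])
  have hsymm : B ((β : Module.End ℂ K) φ) φ = B φ ((β : Module.End ℂ K) φ) := hβ φ φ
  rw [hinv, hsymm]
  exact hpos φ hφ

theorem isPosDefWith_inv_iff (hβ : IsAdjointFor (fun ψ φ => B ψ φ) (β : Module.End ℂ K) β) :
    IsPosDefWith B (↑β⁻¹ : Module.End ℂ K) ↔ IsPosDefWith B (β : Module.End ℂ K) :=
  ⟨fun h => by simpa only [inv_inv] using h.inv hβ.inv, fun h => h.inv hβ⟩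

end Inverse

theorem SpectralData.isAdjointFor_innerWith_iff {A K : Type*} [Ring A] [Algebra ℂ A]
    [AddCommGroup K] [Module ℂ K] [FiniteDimensional ℂ K] {M : SpectralData A K}
    (hM : IsKreinProduct M.krein) (β : (Module.End ℂ K)ˣ) {T T' R : Module.End ℂ K}
    (hT : IsAdjointFor (fun F G => M.krein F G) T T') :
    IsAdjointFor (M.innerWith β) T R ↔ R * β = β * T' := by
  have hiff : IsAdjointFor (M.innerWith β) T R ↔
      T' * (↑β⁻¹ : Module.End ℂ K) = (↑β⁻¹ : Module.End ℂ K) * R :=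
    ⟨fun h => LinearMap.ext fun G => hM.eq_of_forall fun F => (hT F _).symm.trans (h F G),
      fun h F G => (hT F _).trans (congrArg (M.krein F) (LinearMap.congr_fun h G))⟩
  rw [hiff, Units.mul_inv_eq_iff_eq_mul, mul_assoc, Units.eq_inv_mul_iff_mul_eq, eq_comm]

namespace DiscreteSpinorBundle

variable {V E : Type*} {G : WeightedOrientedGraph V E} {n : ℕ} {X S : V → Type*}
  [∀ v, AddCommGroup (X v)] [∀ v, Module ℝ (X v)]
  [∀ v, AddCommGroup (S v)] [∀ v, Module ℂ (S v)] [∀ v, FiniteDimensional ℂ (S v)]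
  {B : DiscreteSpinorBundle G n X S}

/-- The families `T` whose off-diagonal operator is a positive time-orientation form. -/
structure IsPositiveFamily (T : B.EdgeOperators) : Prop where
  positive : ∀ p, B.IsPositiveOdd _ (T p)
  real : IsJReal (-1) T

theorem IsSpectral.isPositiveTimeOrientation_iff [Fintype E] (hB : B.IsSpectral) (hn : Even n)
    {β : (Module.End ℂ B.Sections)ˣ} :
    B.splitDiracStructure.IsPositiveTimeOrientation β ↔
      ∃ T, B.offDiag T = β ∧ IsPositiveFamily T := by
  constructor
  · rintro ⟨hmem, hsa, him, hpos⟩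
    rw [hB.oneForms_eq hn] at hmem
    obtain ⟨T, hodd, hT⟩ := hmem
    have hpos' := (isPosDefWith_inv_iff hsa).1 hpos
    rw [← hT] at hsa him hpos'
    exact ⟨T, hT, fun p => ⟨hodd p, hB.metric.isAdjointFor_offDiag_iff.1 hsa p,
      hB.metric.isPosDefWith_offDiag_iff.1 hpos' p⟩,
      splitJ_offDiag_iff.1 fun F => (him F).trans (neg_one_smul ℂ _).symm⟩
  · rintro ⟨T, hT, hpos, hreal⟩
    have hsa := hB.metric.isAdjointFor_offDiag_iff.2 fun p => (hpos p).selfAdjoint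
    have hpos' := hB.metric.isPosDefWith_offDiag_iff.2 fun p => (hpos p).posDef
    have him F := (splitJ_offDiag_iff.2 hreal F).trans (neg_one_smul ℂ _)
    rw [hT] at hsa hpos' him
    refine ⟨?_, hsa, him, hpos'.inv hsa⟩
    rw [hB.oneForms_eq hn]
    exact ⟨T, fun p => (hpos p).odd, hT⟩

theorem IsPositiveFamily.exists_isPositiveTimeOrientation [Fintype E] {T : B.EdgeOperators}
    (hT : IsPositiveFamily T) (hB : B.IsSpectral) (hn : Even n) :
    ∃ β : (Module.End ℂ B.Sections)ˣ, B.offDiag T = β ∧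
      B.splitDiracStructure.IsPositiveTimeOrientation β := by
  obtain ⟨β, hβ⟩ :=
    (hB.metric.isPosDefWith_offDiag_iff.2 fun p => (hT.positive p).posDef).isUnit
  exact ⟨β, hβ.symm, (hB.isPositiveTimeOrientation_iff hn).2 ⟨T, hβ.symm, hT⟩⟩

/-- Conjugation by the family `T` maps the even sections into themselves; for a positive family
this says that the adjunction of the associated inner product preserves them. -/
def NormalizesEven (T : B.EdgeOperators) : Prop :=
  ∀ a : B.EvenSections, ∃ a' : B.EvenSections, ∀ p,
    B.ρ _ (a' (G.endpt p.1 p.2) : CCl (B.Q _)) * T p =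
      T p * B.ρ _ (a (G.endpt p.1 p.2) : CCl (B.Q _))

theorem exists_even_adjoint (hn : Even n) (a : B.EvenSections) :
    ∃ a' : B.EvenSections, ∀ v, IsAdjointFor (fun ψ φ => B.krein v ψ φ)
      (B.ρ v (a v : CCl (B.Q v))) (B.ρ v (a' v : CCl (B.Q v))) := by
  have hfibre (v : V) : ∃ a' : CCl.even (B.Q v), IsAdjointFor (fun ψ φ => B.krein v ψ φ)
      (B.ρ v (a v : CCl (B.Q v))) (B.ρ v (a' : CCl (B.Q v))) := by
    obtain ⟨A, hA⟩ := (B.isKrein v).exists_adjoint (B.ρ v (a v : CCl (B.Q v)))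
    have hχA := hA.mul (χ_adjoint hn)
    rw [← (commute_χ_ρ_of_mem_even hn (a v).2).eq] at hχA
    have hcomm := IsAdjointFor.unique (B.isKrein v) hχA ((χ_adjoint hn).mul hA)
    rw [neg_mul, mul_neg, neg_inj] at hcomm
    obtain ⟨a', rfl⟩ := exists_even_of_commute_χ hn hcomm
    exact ⟨a', hA⟩
  choose a' ha' using hfibre
  exact ⟨a', ha'⟩

theorem isAdjointFor_splitRep [Fintype E] {a a' : B.EvenSections}
    (h : ∀ v, IsAdjointFor (fun ψ φ => B.krein v ψ φ) (B.ρ v (a v : CCl (B.Q v)))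
      (B.ρ v (a' v : CCl (B.Q v)))) :
    IsAdjointFor (fun F F' => B.splitKrein F F') (B.splitRep a)
      (B.swap * B.splitRep a' * B.swap) := by
  intro F F'
  simp only [splitKrein_eq, Module.End.mul_apply, swap_swap]
  exact Finset.sum_congr rfl fun p _ => h _ _ _

theorem offDiag_mul_swap_splitRep_swap (T : B.EdgeOperators) (a : B.EvenSections) :
    B.offDiag T * (B.swap * B.splitRep a * B.swap) =
      B.offDiag fun p => T p * B.ρ _ (a (G.endpt p.1 p.2) : CCl (B.Q _)) :=
  LinearMap.ext fun F => funext fun p =>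
    congrArg (T p) (congrFun (B.swap_swap (B.splitRep a (B.swap F))) p)

theorem IsSpectral.isAdjointFor_splitRep_iff [Fintype E] (hB : B.IsSpectral)
    {T : B.EdgeOperators} {β : (Module.End ℂ B.Sections)ˣ} (hβ : B.offDiag T = β)
    {a a' c : B.EvenSections}
    (h : ∀ v, IsAdjointFor (fun ψ φ => B.krein v ψ φ) (B.ρ v (a v : CCl (B.Q v)))
      (B.ρ v (a' v : CCl (B.Q v)))) :
    IsAdjointFor (B.splitDiracStructure.innerWith β) (B.splitRep a) (B.splitRep c) ↔
      ∀ p, B.ρ _ (c (G.endpt p.1 p.2) : CCl (B.Q _)) * T p =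
        T p * B.ρ _ (a' (G.endpt p.1 p.2) : CCl (B.Q _)) := by
  rw [SpectralData.isAdjointFor_innerWith_iff (M := B.splitDiracStructure)
    hB.metric.isKreinProduct_splitKrein β (isAdjointFor_splitRep h), ← hβ,
    offDiag_mul_swap_splitRep_swap, splitRep_mul_offDiag, offDiag_injective.eq_iff, funext_iff]

theorem splitRep_injective [Nonempty E] (hG : G.Connected) (hn : Even n) :
    Function.Injective B.splitRep := by
  classical
  intro a a' h
  funext v
  obtain ⟨p, rfl⟩ := WeightedOrientedGraph.exists_endpt_eq hG v
  refine Subtype.ext (ρ_injective hn (LinearMap.ext fun ψ => ?_))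
  simpa only [splitRep_apply, Pi.single_eq_same] using
    congrFun (LinearMap.congr_fun h (Pi.single p ψ)) p

theorem IsPositiveFamily.setOf_isAdjointFor_eq_range_iff [Fintype E] {T : B.EdgeOperators}
    (hT : IsPositiveFamily T) (hB : B.IsSpectral) (hn : Even n)
    {β : (Module.End ℂ B.Sections)ˣ} (hβ : B.offDiag T = β) :
    {R | ∃ a, IsAdjointFor (B.splitDiracStructure.innerWith β) (B.splitRep a) R} =
      Set.range B.splitRep ↔ NormalizesEven T := by
  have hadj {a a' : B.EvenSections} (h : ∀ v, IsAdjointFor (fun ψ φ => B.krein v ψ φ)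
      (B.ρ v (a v : CCl (B.Q v))) (B.ρ v (a' v : CCl (B.Q v)))) (R : Module.End ℂ B.Sections) :
      IsAdjointFor (B.splitDiracStructure.innerWith β) (B.splitRep a) R ↔
        R * β = β * (B.swap * B.splitRep a' * B.swap) :=
    SpectralData.isAdjointFor_innerWith_iff hB.metric.isKreinProduct_splitKrein β
      (isAdjointFor_splitRep h)
  constructor
  · intro hset a
    obtain ⟨b, hb⟩ := exists_even_adjoint hn a
    have hb' v := (hb v).symm (B.isKrein v)
    obtain ⟨a', ha'⟩ := hset.subset ⟨b, (hadj hb' _).2 (Units.inv_mul_cancel_right _ β)⟩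
    refine ⟨a', (hB.isAdjointFor_splitRep_iff hβ hb').1 ((hadj hb' _).2 ?_)⟩
    rw [ha', Units.inv_mul_cancel_right]
  · refine fun hnorm => Set.Subset.antisymm ?_ ?_
    · rintro R ⟨a, hR⟩
      obtain ⟨b, hb⟩ := exists_even_adjoint hn a
      obtain ⟨c, hc⟩ := hnorm b
      have hc' := (hB.isAdjointFor_splitRep_iff hβ hb).2 hc
      exact ⟨c, (Units.mul_left_inj β).1 (((hadj hb _).1 hc').trans ((hadj hb _).1 hR).symm)⟩
    · rintro _ ⟨c, rfl⟩
      obtain ⟨b, hb⟩ := exists_even_adjoint hn c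
      obtain ⟨a, ha⟩ := hnorm b
      obtain ⟨d, hd⟩ := exists_even_adjoint hn a
      refine ⟨a, (hB.isAdjointFor_splitRep_iff hβ hd).2 fun p => ?_⟩
      have hT' := (hT.positive p).selfAdjoint
      have hleft := (hd _).mul hT'
      rw [ha p] at hleft
      exact IsAdjointFor.unique (B.isKrein _) (hT'.mul ((hb _).symm (B.isKrein _))) hleft

theorem IsSpectral.isReconstructible_iff [Fintype E] [Nonempty E] (hB : B.IsSpectral)
    (hG : G.Connected) (hn : Even n) : B.splitDiracStructure.IsReconstructible ↔
      ∃ T, IsPositiveFamily (B := B) T ∧ NormalizesEven T := by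
  constructor
  · rintro ⟨-, -, β, hβ, hset⟩
    obtain ⟨T, hTβ, hT⟩ := (hB.isPositiveTimeOrientation_iff hn).1 hβ
    exact ⟨T, hT, (hT.setOf_isAdjointFor_eq_range_iff hB hn hTβ).1 hset⟩
  · rintro ⟨T, hT, hnorm⟩
    obtain ⟨β, hTβ, hβ⟩ := hT.exists_isPositiveTimeOrientation hB hn
    exact ⟨hB.exists_isAntilorentzianSpacetime hn ⟨β, hβ⟩, splitRep_injective hG hn, β, hβ,
      (hT.setOf_isAdjointFor_eq_range_iff hB hn hTβ).2 hnorm⟩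

/-! ### Dimension two -/

section DimensionTwo

theorem IsPositiveOdd.exists_even_mul_eq (hn : Even n) {v : V} {T : Module.End ℂ (S v)}
    (hT : B.IsPositiveOdd v T) (a : CCl.even (B.Q v)) :
    ∃ a' : CCl.even (B.Q v), B.ρ v (a' : CCl (B.Q v)) * T = T * B.ρ v (a : CCl (B.Q v)) := by
  obtain ⟨A, hA⟩ : ∃ A, A * T = T * B.ρ v (a : CCl (B.Q v)) := by
    obtain ⟨U, rfl⟩ := hT.posDef.isUnit
    exact ⟨_, Units.inv_mul_cancel_right _ U⟩
  have hcomm : Commute (B.χ v) A := hT.posDef.isUnit.mul_right_cancel <| calc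
    B.χ v * A * T = -(T * (B.χ v * B.ρ v a)) := by
      rw [mul_assoc, hA, ← mul_assoc, hT.odd, neg_mul, mul_assoc]
    _ = A * B.χ v * T := by
      rw [(commute_χ_ρ_of_mem_even hn a.2).eq, ← mul_assoc, ← hA, mul_assoc, mul_assoc, hT.odd,
        mul_neg]
  obtain ⟨a', rfl⟩ := exists_even_of_commute_χ hn hcomm
  exact ⟨a', hA⟩

theorem IsPositiveOdd.conj {v w : V} {T : Module.End ℂ (S v)} (hT : B.IsPositiveOdd v T)
    (h : S v ≃ₗ[ℂ] S w) (hχ : ∀ ψ, B.χ w (h ψ) = h (B.χ v ψ))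
    (hK : ∀ ψ φ, B.krein w (h ψ) (h φ) = B.krein v ψ φ) : B.IsPositiveOdd w (h.conj T) where
  odd := LinearMap.ext fun ψ => by
    obtain ⟨φ, rfl⟩ := h.surjective ψ
    have hφ : B.χ v (T φ) = -T (B.χ v φ) := LinearMap.congr_fun hT.odd φ
    simp [LinearEquiv.conj_apply, hχ, hφ]
  selfAdjoint ψ φ := by
    obtain ⟨ψ, rfl⟩ := h.surjective ψ
    obtain ⟨φ, rfl⟩ := h.surjective φ
    have hψφ : B.krein v (T ψ) φ = B.krein v ψ (T φ) := hT.selfAdjoint ψ φ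
    simp [LinearEquiv.conj_apply, hK, hψφ]
  posDef ψ hψ := by
    obtain ⟨ψ, rfl⟩ := h.surjective ψ
    simpa [LinearEquiv.conj_apply, hK] using hT.posDef ψ fun h0 => hψ (by rw [h0, map_zero])

variable (B) in
/-- The family equal to `U` at the sources of the edges and transported to their targets. -/
def sourceFamily (U : ∀ v, Module.End ℂ (S v)) : B.EdgeOperators
  | (e, false) => U (G.src e)
  | (e, true) => (B.h e).conj (U (G.src e))

theorem IsSpectral.isPositiveFamily_sourceFamily (hB : B.IsSpectral) (hn : Even n) {x : ∀ v, X v}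
    (hx : ∀ v, B.IsFutureTimelike (x v)) :
    IsPositiveFamily (B.sourceFamily fun v => B.cliff v (x v)) where
  positive := by
    have hsrc e := (hx (G.src e)).isPositiveOdd hn
    rintro ⟨e, _ | _⟩
    · exact hsrc e
    · exact (hsrc e).conj (B.h e) (hB.preservesOrientation e) (hB.metric e)
  real := hB.spinPreserving.isJReal_neg_one fun e ψ => by
    obtain ⟨φ, rfl⟩ := (B.h e).surjective ψ
    change B.J _ ((B.h e).conj (B.cliff _ (x (G.src e))) (B.h e φ)) =
      -B.h e (B.cliff _ (x (G.src e)) ((B.h e).symm (B.J _ (B.h e φ))))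
    rw [LinearEquiv.conj_apply_apply, LinearEquiv.symm_apply_apply, ← hB.spinPreserving,
      ← hB.spinPreserving, LinearEquiv.symm_apply_apply, J_cliff, map_neg]

theorem IsPositiveOdd.exists_eq_mul {v : V} {U T : Module.End ℂ (S v)}
    (hU : B.IsPositiveOdd v U) (hT : B.χ v * T = -(T * B.χ v)) :
    ∃ C, Commute (B.χ v) C ∧ T = U * C := by
  obtain ⟨C, rfl⟩ : ∃ C, T = U * C := by
    obtain ⟨U, rfl⟩ := hU.posDef.isUnit
    exact ⟨_, (U.mul_inv_cancel_left T).symm⟩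
  refine ⟨C, hU.posDef.isUnit.mul_left_cancel ?_, rfl⟩
  rwa [← mul_assoc, hU.odd, neg_mul, neg_inj, mul_assoc, mul_assoc] at hT

theorem IsPositiveOdd.mul_eq_mul_of_eq_two (hn : n = 2) {v : V}
    {U T A A' : Module.End ℂ (S v)} (hU : B.IsPositiveOdd v U)
    (hT : B.χ v * T = -(T * B.χ v)) (hA : Commute (B.χ v) A) (h : A' * U = U * A) :
    A' * T = T * A := by
  obtain ⟨C, hC, rfl⟩ := hU.exists_eq_mul hT
  rw [← mul_assoc, h, mul_assoc, (commute_of_eq_two hn hA hC).eq, mul_assoc]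

theorem IsPositiveFamily.normalizesEven_of_eq_two {T : B.EdgeOperators} (hT : IsPositiveFamily T)
    (hn : n = 2) : NormalizesEven T := by
  have hn' : Even n := hn ▸ even_two
  intro a
  choose x hx using B.exists_isFutureTimelike
  choose a' ha' using fun v => ((hx v).isPositiveOdd hn').exists_even_mul_eq hn' (a v)
  exact ⟨a', fun p => ((hx _).isPositiveOdd hn').mul_eq_mul_of_eq_two hn (hT.positive p).odd
    (commute_χ_ρ_of_mem_even hn' (a _).2) (ha' _)⟩

theorem IsSpectral.isReconstructible_of_eq_two [Fintype E] [Nonempty E] (hB : B.IsSpectral)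
    (hG : G.Connected) (hn : n = 2) : B.splitDiracStructure.IsReconstructible := by
  have hn' : Even n := hn ▸ even_two
  choose x hx using B.exists_isFutureTimelike
  have hT := hB.isPositiveFamily_sourceFamily hn' hx
  exact (hB.isReconstructible_iff hG hn').2 ⟨_, hT, hT.normalizesEven_of_eq_two hn⟩

end DimensionTwo

/-! ### Parallel vector fields and holonomy -/

section Parallel

theorem eq_adTransport_iff {v w : V} {p : G.Walk v w} {T : Module.End ℂ (S v)}
    {T' : Module.End ℂ (S w)} :
    T' = B.adTransport p T ↔ ∀ ψ, B.transport p (T ψ) = T' (B.transport p ψ) := by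
  have h (ψ : S v) : B.adTransport p T (B.transport p ψ) = B.transport p (T ψ) :=
    congrArg (fun φ => B.transport p (T φ)) ((B.transport p).symm_apply_apply ψ)
  refine ⟨fun hT ψ => by rw [hT, h], fun hT => LinearMap.ext fun ψ => ?_⟩
  obtain ⟨φ, rfl⟩ := (B.transport p).surjective ψ
  rw [h, hT]

theorem isParallel_iff {u : ∀ v, X v} : B.IsParallel u ↔
    ∀ e ψ, B.h e (B.cliff _ (u (G.src e)) ψ) = B.cliff _ (u (G.tgt e)) (B.h e ψ) := by
  refine ⟨fun hu e => eq_adTransport_iff.1 (hu _ _ (.fwd e .nil)),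
    fun hu v w p => eq_adTransport_iff.2 ?_⟩
  induction p with
  | nil => exact fun _ => rfl
  | fwd e p ih => exact fun ψ => (congrArg (B.h e) (ih ψ)).trans (hu e _)
  | bwd e p ih =>
    intro ψ
    change (B.h e).symm (B.transport p _) = B.cliff _ _ ((B.h e).symm (B.transport p ψ))
    rw [ih, LinearEquiv.symm_apply_eq, hu, LinearEquiv.apply_symm_apply]

theorem IsSpectral.isReconstructible_of_isParallel [Fintype E] [Nonempty E] (hB : B.IsSpectral)
    (hG : G.Connected) (hn : Even n) {u : ∀ v, X v} (hu : B.IsParallel u)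
    (hu' : ∀ v, B.IsFutureTimelike (u v)) : B.splitDiracStructure.IsReconstructible := by
  have hpos v := (hu' v).isPositiveOdd hn
  refine (hB.isReconstructible_iff hG hn).2 ⟨fun p => B.cliff _ (u (G.endpt p.1 p.2)),
    ⟨fun p => hpos _, hB.spinPreserving.isJReal_neg_one fun e ψ => ?_⟩, fun a => ?_⟩
  · change B.J _ (B.cliff _ (u (G.tgt e)) ψ) =
      -B.h e (B.cliff _ (u (G.src e)) ((B.h e).symm (B.J _ ψ)))
    rw [isParallel_iff.1 hu, LinearEquiv.apply_symm_apply, J_cliff]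
  · choose a' ha' using fun v => (hpos v).exists_even_mul_eq hn (a v)
    exact ⟨a', fun p => ha' _⟩

/-- `T.IsValueAt v U` says that `U` is one of the operators of the family `T` over the vertex `v`.
Being inductive, it lets values at different edges ending at `v` be compared without casts. -/
inductive IsValueAt (T : B.EdgeOperators) : (v : V) → Module.End ℂ (S v) → Prop
  | intro (p : E × Bool) : IsValueAt T (G.endpt p.1 p.2) (T p)

theorem IsPositiveFamily.isPositiveOdd {T : B.EdgeOperators} (hT : IsPositiveFamily T) {v : V}
    {U : Module.End ℂ (S v)} (hU : IsValueAt T v U) : B.IsPositiveOdd v U := by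
  cases hU
  exact hT.positive _

theorem IsPositiveFamily.timeVec_eq {T : B.EdgeOperators} (hT : IsPositiveFamily T)
    (hnorm : NormalizesEven T) (hn : Even n) {v : V} {U U' : Module.End ℂ (S v)}
    (hU : IsValueAt T v U) (hU' : IsValueAt T v U') : B.timeVec v U = B.timeVec v U' := by
  classical
  refine DiscreteSpinorBundle.timeVec_eq hn (hT.isPositiveOdd hU) (hT.isPositiveOdd hU')
    fun A hA => ?_
  obtain ⟨a, rfl⟩ := exists_even_of_commute_χ hn hA
  obtain ⟨a', ha'⟩ := hnorm (Pi.single v a)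
  have hmul {U : Module.End ℂ (S v)} (hU : IsValueAt T v U) :
      B.ρ v (a' v : CCl (B.Q v)) * U = U * B.ρ v (a : CCl (B.Q v)) := by
    obtain ⟨p⟩ := hU
    simpa only [Pi.single_eq_same] using ha' p
  exact ⟨_, hmul hU, hmul hU'⟩

theorem timeVec_eq_timeVec_conj (hn : Even n) {v w : V} {h : S v ≃ₗ[ℂ] S w}
    {T : Module.End ℂ (S v)} {T' : Module.End ℂ (S w)} (hJ : ∀ ψ, h (B.J v ψ) = B.J w (h ψ))
    (hT : ∀ ψ, h (B.J v (T ψ)) = -T' (B.J w (h ψ))) :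
    B.timeVec w T' = B.timeVec w (h.conj T) := by
  refine timeVec_of_J hn fun ψ => ?_
  obtain ⟨φ, rfl⟩ := h.surjective ψ
  rw [LinearEquiv.conj_apply_apply, LinearEquiv.symm_apply_apply, ← hJ (T φ), hT, neg_neg]

theorem IsSpectral.exists_isParallel_of_isReconstructible [Fintype E] [Nonempty E]
    (hB : B.IsSpectral) (hG : G.Connected) (hn : Even n) (hn2 : 2 < n)
    (hC : B.IsCliffordConnection) (hR : B.splitDiracStructure.IsReconstructible) :
    ∃ u : ∀ v, X v, B.IsParallel u ∧ ∀ v, B.IsFutureTimelike (u v) := by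
  obtain ⟨T, hT, hnorm⟩ := (hB.isReconstructible_iff hG hn).1 hR
  have hvalue (v : V) : ∃ U, IsValueAt T v U := by
    obtain ⟨p, rfl⟩ := WeightedOrientedGraph.exists_endpt_eq hG v
    exact ⟨_, .intro p⟩
  choose U hU using hvalue
  refine ⟨fun v => B.timeVec v (U v), isParallel_iff.2 fun e ψ => ?_,
    fun v => isFutureTimelike_timeVec hn hn2 (hT.isPositiveOdd (hU v))⟩
  obtain ⟨Λ, hΛ⟩ := hC e
  have hΛu : Λ (B.timeVec (G.src e) (U (G.src e))) = B.timeVec (G.tgt e) (U (G.tgt e)) := calc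
    Λ (B.timeVec (G.src e) (U (G.src e))) = Λ (B.timeVec (G.src e) (T (e, false))) :=
      congrArg Λ (hT.timeVec_eq hnorm hn (hU _) (.intro (e, false)))
    _ = B.timeVec (G.tgt e) ((B.h e).conj (T (e, false))) :=
      (timeVec_conj hΛ (hB.preservesOrientation e) _).symm
    _ = B.timeVec (G.tgt e) (T (e, true)) :=
      (timeVec_eq_timeVec_conj hn (hB.spinPreserving e) fun ψ =>
        (hT.real (e, true) ψ).trans (neg_one_smul ℂ _)).symm
    _ = B.timeVec (G.tgt e) (U (G.tgt e)) := hT.timeVec_eq hnorm hn (.intro (e, true)) (hU _)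
  rw [hΛ, hΛu]

end Parallel

section Holonomy

theorem IsCliffordConnection.exists_transport (hC : B.IsCliffordConnection) {v w : V}
    (p : G.Walk v w) (x : X v) :
    ∃ y : X w, ∀ ψ, B.transport p (B.cliff v x ψ) = B.cliff w y (B.transport p ψ) := by
  induction p with
  | nil => exact ⟨x, fun _ => rfl⟩
  | fwd e p ih =>
    obtain ⟨y, hy⟩ := ih
    obtain ⟨Λ, hΛ⟩ := hC e
    exact ⟨Λ y, fun ψ => (congrArg (B.h e) (hy ψ)).trans (hΛ y _)⟩
  | bwd e p ih =>
    obtain ⟨y, hy⟩ := ih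
    obtain ⟨Λ, hΛ⟩ := hC e
    obtain ⟨z, rfl⟩ := surjective_of_intertwines hΛ y
    refine ⟨z, fun ψ => ?_⟩
    change (B.h e).symm (B.transport p _) = B.cliff _ _ ((B.h e).symm (B.transport p ψ))
    rw [hy, LinearEquiv.symm_apply_eq, hΛ, LinearEquiv.apply_symm_apply]

theorem IsMetric.krein_transport (hB : B.IsMetric) {v w : V} (p : G.Walk v w) (ψ φ : S v) :
    B.krein w (B.transport p ψ) (B.transport p φ) = B.krein v ψ φ := by
  induction p with
  | nil => rfl
  | fwd e p ih => exact (hB e _ _).trans ih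
  | bwd e p ih => exact (hB.krein_hpm e false _ _).trans ih

theorem IsFutureTimelike.transport (hB : B.IsMetric) {v w : V} (p : G.Walk v w) {x : X v}
    (hx : B.IsFutureTimelike x) {y : X w}
    (hy : ∀ ψ, B.transport p (B.cliff v x ψ) = B.cliff w y (B.transport p ψ)) :
    B.IsFutureTimelike y := by
  refine ⟨?_, fun ψ hψ => ?_⟩
  · rw [IsTimelike, Q_eq_of_intertwines (B.transport p) hy]
    exact hx.1
  · obtain ⟨φ, rfl⟩ := (B.transport p).surjective ψ
    rw [← hy, hB.krein_transport]
    exact hx.2 φ fun h0 => hψ (by rw [h0, map_zero])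

theorem IsParallel.isHolonomyFixed {u : ∀ v, X v} (hu : B.IsParallel u) (v : V) :
    B.IsHolonomyFixed (u v) := by
  rintro _ ⟨p, rfl⟩
  exact (hu v v p).symm

theorem IsHolonomyFixed.exists_isParallel {v : V} {x : X v} (hfix : B.IsHolonomyFixed x)
    (hG : G.Connected) (hC : B.IsCliffordConnection) :
    ∃ u : ∀ w, X w, B.IsParallel u ∧ ∀ w, ∃ p : G.Walk v w,
      ∀ ψ, B.transport p (B.cliff v x ψ) = B.cliff w (u w) (B.transport p ψ) := by
  have P (w : V) : G.Walk v w := (hG v w).some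
  choose u hu using fun w => hC.exists_transport (P w) x
  refine ⟨u, fun a b q => eq_adTransport_iff.2 fun ψ => ?_, fun w => ⟨P w, hu w⟩⟩
  obtain ⟨φ, rfl⟩ := (B.transport (P a)).surjective ψ
  have hloop := eq_adTransport_iff.1
    (hfix _ ⟨((P a).append q).append (P b).reverse, rfl⟩).symm φ
  simp only [transport_append, transport_reverse, LinearEquiv.trans_apply] at hloop
  rw [LinearEquiv.symm_apply_eq, hu b, LinearEquiv.apply_symm_apply] at hloop
  rw [← hu a, hloop]

theorem IsHolonomyFixed.exists_isParallel_isFutureTimelike {v : V} {x : X v}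
    (hfix : B.IsHolonomyFixed x) (hx : B.IsTimelike x) (hG : G.Connected) (hB : B.IsMetric)
    (hC : B.IsCliffordConnection) :
    ∃ u : ∀ v, X v, B.IsParallel u ∧ ∀ v, B.IsFutureTimelike (u v) := by
  obtain ⟨x, hx, hfix⟩ : ∃ x : X v, B.IsFutureTimelike x ∧ B.IsHolonomyFixed x := by
    obtain h | h := hx.isFutureTimelike_or_neg
    · exact ⟨x, h, hfix⟩
    · exact ⟨-x, h, fun g hg => by rw [cliff_neg, map_neg, hfix g hg]⟩
  obtain ⟨u, hu, hux⟩ := hfix.exists_isParallel hG hC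
  exact ⟨u, hu, fun w => let ⟨p, hp⟩ := hux w; hx.transport hB p hp⟩

end Holonomy

end DiscreteSpinorBundle

end

theorem mainTheorem1 {V E : Type*} [Fintype V] [Fintype E] [Nonempty E]
    {X S : V → Type*} [∀ v, AddCommGroup (X v)] [∀ v, Module ℝ (X v)]
    [∀ v, AddCommGroup (S v)] [∀ v, Module ℂ (S v)] [∀ v, FiniteDimensional ℂ (S v)]
    (G : WeightedOrientedGraph V E) (hG : G.Connected) (n : ℕ) (hn : Even n)
    (B : DiscreteSpinorBundle G n X S) (hB : B.IsSpectral) :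
    (n = 2 → B.splitDiracStructure.IsReconstructible) ∧
    (2 < n → B.IsCliffordConnection →
      (B.splitDiracStructure.IsReconstructible ↔
        ∃ u : ∀ v, X v, B.IsParallel u ∧ ∀ v, B.IsFutureTimelike (u v)) ∧
      ∀ v, (B.splitDiracStructure.IsReconstructible ↔
        ∃ x : X v, B.IsTimelike x ∧ B.IsHolonomyFixed x)) := by
  refine ⟨hB.isReconstructible_of_eq_two hG, fun hn2 hC => ?_⟩
  have hparallel : B.splitDiracStructure.IsReconstructible ↔
      ∃ u : ∀ v, X v, B.IsParallel u ∧ ∀ v, B.IsFutureTimelike (u v) :=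
    ⟨hB.exists_isParallel_of_isReconstructible hG hn hn2 hC,
      fun ⟨_, hu, hu'⟩ => hB.isReconstructible_of_isParallel hG hn hu hu'⟩
  refine ⟨hparallel, fun v => hparallel.trans ⟨?_, ?_⟩⟩
  · rintro ⟨u, hu, hu'⟩
    exact ⟨u v, (hu' v).1, hu.isHolonomyFixed v⟩
  · rintro ⟨x, hx, hfix⟩
    exact hfix.exists_isParallel_isFutureTimelike hx hG hB.metric hC
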